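/- For each integer $n\ge 1$ let $m=m(n)\ge 1$ be an integer, and assume that $\lim_{n\to\infty} m(n)/n=\alpha$ for some $\alpha\in(0,\infty)$. Put $N=\sqrt{m(n)\,n}$. Let $P_n$ be a probability measure on $\mathbb{R}^m\times\mathbb{R}^n$, let $(X,Y)$ have law $P_n$, and let $W\in\mathbb{R}^{m\times n}$, $U\in\mathbb{R}^m$, $V\in\mathbb{R}^n$ have independent standard Gaussian entries, with $(X,Y),W,U,V$ independent. For $t\ge 0$ and $h=(h_1,h_2)\in[0,\infty)^2$ define \begin{align*} H_n(t,h,x,y)&=\sqrt{\tfrac{2t}{N}}\;x\cdot Wy+\tfrac{2t}{N}\,(xy^\intercal)\cdot(XY^\intercal)-\tfrac{t}{N}|xy^\intercal|^2\\ &\quad+\sqrt{2h_1}\,U\cdot x+2h_1\,X\cdot x-h_1|x|^2+\sqrt{2h_2}\,V\cdot y+2h_2\,Y\cdot y-h_2|y|^2, \end{align*} where $A\cdot B$ is the entrywise inner product and $|A|^2=A\cdot A$, and $$F_n(t,h)=\frac1N\log\int e^{H_n(t,h,x,y)}\,P_n(dx,dy),\qquad \overline F_n=\mathbb{E}F_n,\qquad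 K_{M,n}=\Big(\mathbb{E}\sup_{(t,h)\in[0,M]^3}|F_n-\overline F_n|^2\Big)^{1/2}.$$ There is a constant $C>0$, depending only on the sequence $(m(n))_{n\ge1}$, such that for all real $M\ge 1$ and all integers $n\ge 1$ $$K_{M,n}\le C\,n^{-1/2}\big(M+\sqrt{\log n}\big)$$ in each of the following two cases: (i.i.d. case) $P_n=(P^X_1)^{\otimes m}\otimes(P^Y_1)^{\otimes n}$, where $P^X_1$ and $P^Y_1$ are any probability measures on $\mathbb{R}$ supported on $[-1,1]$; (spherical case) $P_n=\mathscr{U}_m\otimes\mathscr{U}_n$, where $\mathscr{U}_k$ is the uniform probability measure on the centered sphere of radius $\sqrt k$ in $\mathbb{R}^k$. -/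

import Mathlib

open MeasureTheory ProbabilityTheory Filter Topology
open scoped ENNReal

noncomputable section

namespace RankOneInference

/-- The pairs `(x, y)` of a vector in `ℝ^m` and a vector in `ℝ^n`. -/
abbrev Signal (m n : ℕ) : Type := (Fin m → ℝ) × (Fin n → ℝ)

/-- All the randomness of the model: `((X, Y), W, U, V)` with the signal `(X, Y)`, the noise
matrix `W` of size `m × n`, and the noise vectors `U` and `V`. -/
abbrev Disorder (m n : ℕ) : Type :=
  Signal m n × (Fin m → Fin n → ℝ) × (Fin m → ℝ) × (Fin n → ℝ)

/-- The standard Gaussian measure on `ℝ^k` (independent `N(0,1)` coordinates). -/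
def stdGauss (k : ℕ) : Measure (Fin k → ℝ) :=
  Measure.pi fun _ => gaussianReal 0 1

/-- The law of an `m × n` matrix with independent standard Gaussian entries. -/
def stdGaussMatrix (m n : ℕ) : Measure (Fin m → Fin n → ℝ) :=
  Measure.pi fun _ => stdGauss n

/-- The law of `((X, Y), W, U, V)`: `(X, Y)` has law `P`, the entries of `W`, `U` and `V` are
standard Gaussian, and `(X, Y)`, `W`, `U`, `V` are independent. -/
def disorderLaw {m n : ℕ} (P : Measure (Signal m n)) : Measure (Disorder m n) :=
  P.prod ((stdGaussMatrix m n).prod ((stdGauss m).prod (stdGauss n)))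

/-- `N = √(m n)`. -/
def size (m n : ℕ) : ℝ := √((m : ℝ) * (n : ℝ))

/-- The enriched Hamiltonian `H_n(t, h, x, y)`, with `h = (h₁, h₂)`, for the disorder
`ω = ((X, Y), W, U, V)`. -/
def hamiltonian {m n : ℕ} (ω : Disorder m n) (t h₁ h₂ : ℝ) (z : Signal m n) : ℝ :=
  let X := ω.1.1
  let Y := ω.1.2
  let W := ω.2.1
  let U := ω.2.2.1
  let V := ω.2.2.2
  let x := z.1
  let y := z.2
  let N := size m n
  √(2 * t / N) * (∑ i, ∑ j, x i * W i j * y j)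
    + 2 * t / N * (∑ i, ∑ j, (x i * y j) * (X i * Y j))
    - t / N * (∑ i, ∑ j, (x i * y j) ^ 2)
    + √(2 * h₁) * (∑ i, U i * x i) + 2 * h₁ * (∑ i, X i * x i) - h₁ * (∑ i, x i ^ 2)
    + √(2 * h₂) * (∑ j, V j * y j) + 2 * h₂ * (∑ j, Y j * y j) - h₂ * (∑ j, y j ^ 2)

/-- The (random) free energy `F_n(t, h) = N⁻¹ log ∫ exp(H_n(t, h, x, y)) P(dx, dy)`. -/
def freeEnergy {m n : ℕ} (P : Measure (Signal m n)) (ω : Disorder m n) (t h₁ h₂ : ℝ) : ℝ :=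
  1 / size m n * Real.log (∫ z, Real.exp (hamiltonian ω t h₁ h₂ z) ∂P)

/-- The averaged free energy `E F_n(t, h)`. -/
def meanFreeEnergy {m n : ℕ} (P : Measure (Signal m n)) (t h₁ h₂ : ℝ) : ℝ :=
  ∫ ω, freeEnergy P ω t h₁ h₂ ∂(disorderLaw P)

/-- `K_{M,n} = (E sup_{(t,h) ∈ [0,M]³} |F_n - E F_n|²)^{1/2}`, as an element of `[0, ∞]`. -/
def concentrationRate {m n : ℕ} (P : Measure (Signal m n)) (M : ℝ) : ℝ≥0∞ :=
  (∫⁻ ω, ⨆ t ∈ Set.Icc (0 : ℝ) M, ⨆ h₁ ∈ Set.Icc (0 : ℝ) M, ⨆ h₂ ∈ Set.Icc (0 : ℝ) M,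
    ENNReal.ofReal (|freeEnergy P ω t h₁ h₂ - meanFreeEnergy P t h₁ h₂| ^ 2)
      ∂(disorderLaw P)) ^ (1 / 2 : ℝ)

/-- The law of `(X, Y)` in the i.i.d. case: all the entries are independent, those of `X` with
law `PX` and those of `Y` with law `PY`. -/
def iidLaw (m n : ℕ) (PX PY : Measure ℝ) : Measure (Signal m n) :=
  (Measure.pi fun _ : Fin m => PX).prod (Measure.pi fun _ : Fin n => PY)

/-- The uniform probability measure on the unit sphere of `ℝ^k` (`k ≥ 1`): normalized surface
measure. -/
def unitSphereUniform (k : ℕ) : Measure (Metric.sphere (0 : EuclideanSpace ℝ (Fin k)) 1) :=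
  ((volume : Measure (EuclideanSpace ℝ (Fin k))).toSphere Set.univ)⁻¹ •
    (volume : Measure (EuclideanSpace ℝ (Fin k))).toSphere

/-- The uniform probability measure on the centered sphere of radius `√k` in `ℝ^k` (`k ≥ 1`). -/
def sphereUniform (k : ℕ) : Measure (Fin k → ℝ) :=
  (unitSphereUniform k).map fun (u : Metric.sphere (0 : EuclideanSpace ℝ (Fin k)) 1) i =>
    √(k : ℝ) * (u : EuclideanSpace ℝ (Fin k)) i

/-- The law of `(X, Y)` in the spherical case. -/
def sphericalLaw (m n : ℕ) : Measure (Signal m n) :=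
  (sphereUniform m).prod (sphereUniform n)

end RankOneInference

end

open MeasureTheory ProbabilityTheory Filter Topology
open scoped ENNReal

noncomputable section

namespace RankOneInference

open scoped RealInnerProductSpace


/-! ### Integration and Gaussian preliminaries -/

/-! Up to the factor `1 / N`, the free energy is the log-partition function `log Z` of a Gaussian
channel. It observes `o = s(w) + g`, where `w = (X, Y)`, `g = (W, U, V)` and `s(z) = (√(2t) x yᵀ /
√N, √(2h₁) x, √(2h₂) y)` (`hamiltonian_eq`). The fluctuations split into those of the noise at fixed
signal and those of the noise average as a function of the signal. Each must cost at most `√n (M +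
√(log n))` before dividing by `N`.

Noise. Gaussian concentration applied directly to `log Z`, whose gradient grows with `M`, would mix
`M` with the logarithm that a union bound over the parameters produces. Subtracting the linear term
`⟨s(w), g⟩` removes this: the gradient becomes the Gibbs average of `s(z) - s(w)`. The rotation
argument of Maurey and Pisier (`lintegral_centredLogPartition_sub_le`) then bounds the moments of
the centred fluctuation by those of `‖s(z) - s(w)‖`.

These do not grow with `M`. With `Δ = s(z) - s(w)` and `g' = g - Δ` one has `‖Δ‖² = ⟨Δ, g⟩ - ⟨Δ,
g'⟩`. By the Nishimori identity `g'`, the noise seen from the replica `z`, is again standard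
Gaussian (`lintegral_nishimori`). The matrix block of `Δ` has rank at most two, so `|⟨Δ, g⟩| ≤ ‖Δ‖
T(g)` with `T = √2 ‖W‖ + |U| + |V|` (`abs_inner_combine_sub_le`), and `T` is of order `√(m + n)` by
a net argument (`lintegral_exp_noiseNorm_le`). Hence `‖Δ‖` is of order `√(m + n)` at any signal
strength (`lintegral_fluctuation_le`).

A maximum over a grid of mesh `1 / n`, taken through moments of order about `log (nM)`, costs the
`√(log n)`. The removed linear term is linear in three parameters, so its supremum needs no grid; it
contributes order `√(M n)` (`exists_uniform_bound`).

Signal. The noise average is invariant under every symmetry of the law of `(X, Y)` realised by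
isometries (`integral_channelLog_act`). In the spherical case rotations act transitively, so it is
constant. In the i.i.d. case permutations allow both signals to be sorted. The average is
`ℓ¹`-Lipschitz with constant of order `M`, and the `ℓ¹` distance of sorted vectors is controlled by
the `L¹` distance of their counting functions, which is of order `√n` in mean square
(`lintegral_countDist_sq_le`). This bound is uniform over the parameters, so no logarithm multiplies
`M`. -/

lemma lintegral_pow_le {α : Type*} [MeasurableSpace α] (μ : Measure α) [IsFiniteMeasure μ]
    {f : α → ℝ≥0∞} (hf : AEMeasurable f μ) (k : ℕ) :
    (∫⁻ x, f x ∂μ) ^ (k + 1) ≤ μ Set.univ ^ k * ∫⁻ x, f x ^ (k + 1) ∂μ := by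
  rcases Nat.eq_zero_or_pos k with rfl | hk
  · simp
  have hpq : Real.HolderConjugate ((k + 1 : ℕ) : ℝ) (((k + 1 : ℕ) : ℝ) / k) := by
    have h := Real.HolderConjugate.conjExponent (p := ((k + 1 : ℕ) : ℝ))
      (by push_cast; have : (0 : ℝ) < k := by exact_mod_cast hk
          linarith)
    have h2 : Real.conjExponent ((k + 1 : ℕ) : ℝ) = ((k + 1 : ℕ) : ℝ) / k := by
      simp [Real.conjExponent]
    rwa [h2] at h
  have h := ENNReal.lintegral_mul_le_Lp_mul_Lq μ hpq hf (aemeasurable_const (b := (1 : ℝ≥0∞)))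
  have hk0 : (0 : ℝ) < ((k + 1 : ℕ) : ℝ) := by positivity
  have hk1 : (0 : ℝ) < (k : ℝ) := by exact_mod_cast hk
  have h3 := pow_le_pow_left' h (k + 1)
  rw [mul_pow, ← ENNReal.rpow_mul_natCast, ← ENNReal.rpow_mul_natCast,
    one_div_mul_cancel hk0.ne', ENNReal.rpow_one] at h3
  have e : (1 / (((k + 1 : ℕ) : ℝ) / k)) * ((k + 1 : ℕ) : ℝ) = (k : ℕ) := by
    field_simp
  rw [e, ENNReal.rpow_natCast] at h3
  simp only [Pi.mul_apply, mul_one, ENNReal.one_rpow, lintegral_const, one_mul,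
    ENNReal.rpow_natCast] at h3
  rw [mul_comm]
  exact h3

lemma lintegral_pi_prod {ι : Type*} [Fintype ι] {X : ι → Type*} [∀ i, MeasurableSpace (X i)]
    (μ : ∀ i, Measure (X i)) [∀ i, IsProbabilityMeasure (μ i)] {f : ∀ i, X i → ℝ≥0∞}
    (hf : ∀ i, Measurable (f i)) :
    ∫⁻ x, ∏ i, f i (x i) ∂(Measure.pi μ) = ∏ i, ∫⁻ x, f i x ∂(μ i) := by
  have h := lintegral_prod_eq_prod_lintegral_of_indepFun (μ := Measure.pi μ) Finset.univ
    (fun i (x : ∀ i, X i) => f i (x i))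
    (iIndepFun_pi (μ := μ) (X := fun i => f i) fun i => (hf i).aemeasurable)
    (fun i => (hf i).comp (measurable_pi_apply i))
  rw [h]
  refine Finset.prod_congr rfl fun i _ => ?_
  rw [← (measurePreserving_eval μ i).lintegral_comp (hf i)]

/-- Completing the square: the one-dimensional Cameron–Martin density, from which the general
formula is built coordinate by coordinate. -/
lemma gaussianReal_withDensity_exp (a : ℝ) :
    (gaussianReal 0 1).withDensity (fun x => ENNReal.ofReal (Real.exp (a * x - a ^ 2 / 2))) =
      gaussianReal a 1 := by
  rw [gaussianReal_of_var_ne_zero _ one_ne_zero, gaussianReal_of_var_ne_zero _ one_ne_zero,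
    ← withDensity_mul _ (measurable_gaussianPDF 0 1) (by fun_prop)]
  congr 1
  ext x
  simp only [Pi.mul_apply, gaussianPDF, gaussianPDFReal]
  rw [← ENNReal.ofReal_mul (by positivity), mul_assoc, ← Real.exp_add]
  congr 3
  simp
  ring

lemma lintegral_pi_gaussian_add {ι : Type*} [Fintype ι] (a : ι → ℝ) {Φ : (ι → ℝ) → ℝ≥0∞}
    (hΦ : Measurable Φ) :
    ∫⁻ x, Φ (x + a) ∂(Measure.pi fun _ : ι => gaussianReal 0 1) =
      ∫⁻ x, (∏ i, ENNReal.ofReal (Real.exp (a i * x i - a i ^ 2 / 2))) * Φ x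
        ∂(Measure.pi fun _ : ι => gaussianReal 0 1) := by
  have h1 : MeasurePreserving (fun (x : ι → ℝ) i => x i + a i)
      (Measure.pi fun _ : ι => gaussianReal 0 1) (Measure.pi fun i : ι => gaussianReal (a i) 1) := by
    refine measurePreserving_pi (f := fun i x => x + a i) _ _ fun i => ⟨by fun_prop, ?_⟩
    rw [gaussianReal_map_add_const, zero_add]
  have hm : ∀ i, Measurable fun x : ℝ => ENNReal.ofReal (Real.exp (a i * x - a i ^ 2 / 2)) :=
    fun i => by fun_prop
  have hm' : Measurable fun x : ι → ℝ =>
      ∏ i, ENNReal.ofReal (Real.exp (a i * x i - a i ^ 2 / 2)) :=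
    Finset.measurable_prod _ fun i _ => (hm i).comp (measurable_pi_apply i)
  have h2 : (Measure.pi fun i : ι => gaussianReal (a i) 1) =
      (Measure.pi fun _ : ι => gaussianReal 0 1).withDensity
        (fun x => ∏ i, ENNReal.ofReal (Real.exp (a i * x i - a i ^ 2 / 2))) := by
    refine Measure.pi_eq fun s hs => ?_
    rw [withDensity_apply _ (MeasurableSet.univ_pi hs), ← lintegral_indicator (MeasurableSet.univ_pi hs)]
    have e : ∀ x : ι → ℝ, (Set.univ.pi s).indicator
        (fun x : ι → ℝ => ∏ i, ENNReal.ofReal (Real.exp (a i * x i - a i ^ 2 / 2))) x =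
        ∏ i, (s i).indicator
          (fun x : ℝ => ENNReal.ofReal (Real.exp (a i * x - a i ^ 2 / 2))) (x i) := by
      intro x
      by_cases hx : x ∈ Set.univ.pi s
      · rw [Set.indicator_of_mem hx]
        refine Finset.prod_congr rfl fun i _ => ?_
        rw [Set.indicator_of_mem (hx i (Set.mem_univ i))]
      · rw [Set.indicator_of_notMem hx]
        simp only [Set.mem_univ_pi, not_forall] at hx
        obtain ⟨i, hi⟩ := hx
        exact (Finset.prod_eq_zero (Finset.mem_univ i) (Set.indicator_of_notMem hi _)).symm
    simp_rw [e]
    rw [lintegral_pi_prod _ fun i => (hm i).indicator (hs i)]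
    refine Finset.prod_congr rfl fun i _ => ?_
    rw [lintegral_indicator (hs i), ← withDensity_apply _ (hs i), gaussianReal_withDensity_exp]
  rw [show (fun x : ι → ℝ => Φ (x + a)) = fun x => Φ ((fun (x : ι → ℝ) i => x i + a i) x) from rfl,
    h1.lintegral_comp hΦ, h2, lintegral_withDensity_eq_lintegral_mul _ hm' hΦ]
  rfl

/-- The Cameron–Martin formula for the standard Gaussian measure. -/
lemma lintegral_stdGaussian_add {E : Type*} [NormedAddCommGroup E] [InnerProductSpace ℝ E]
    [FiniteDimensional ℝ E] [MeasurableSpace E] [BorelSpace E] (a : E) {Φ : E → ℝ≥0∞}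
    (hΦ : Measurable Φ) :
    ∫⁻ x, Φ (x + a) ∂(stdGaussian E) =
      ∫⁻ x, ENNReal.ofReal (Real.exp (⟪a, x⟫ - ‖a‖ ^ 2 / 2)) * Φ x ∂(stdGaussian E) := by
  set b := stdOrthonormalBasis ℝ E
  have hb : Measurable fun x : Fin (Module.finrank ℝ E) → ℝ => ∑ i, x i • b i := by fun_prop
  rw [stdGaussian, lintegral_map (by fun_prop) hb, lintegral_map (by fun_prop) hb]
  have h1 : ∀ x : Fin (Module.finrank ℝ E) → ℝ,
      ∑ i, x i • b i + a = ∑ i, (x + fun i => ⟪b i, a⟫) i • b i := by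
    intro x
    simp only [Pi.add_apply, add_smul, Finset.sum_add_distrib, b.sum_repr' a]
  simp_rw [h1]
  rw [lintegral_pi_gaussian_add (fun i => ⟪b i, a⟫) (Φ := fun x => Φ (∑ i, x i • b i)) (by fun_prop)]
  refine lintegral_congr fun x => ?_
  rw [← ENNReal.ofReal_prod_of_nonneg fun i _ => (Real.exp_pos _).le, ← Real.exp_sum]
  congr 3
  rw [Finset.sum_sub_distrib, ← Finset.sum_div, b.sum_sq_inner_right, inner_sum]
  congr 1
  refine Finset.sum_congr rfl fun i _ => ?_
  rw [real_inner_smul_right, real_inner_comm, mul_comm]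

/-- The characteristic function of the image at `t` is that of the Gaussian at `L' t`, which depends
only on `‖L' t‖`. The adjoint identity is all that is needed, so linearity of `L` is not assumed.
This identifies the laws of `U`, of `V` and of `W v` for a unit vector `v`. -/
lemma stdGaussian_map_of_adjoint {E E' : Type*} [NormedAddCommGroup E] [InnerProductSpace ℝ E]
    [FiniteDimensional ℝ E] [MeasurableSpace E] [BorelSpace E]
    [NormedAddCommGroup E'] [InnerProductSpace ℝ E']
    [FiniteDimensional ℝ E'] [MeasurableSpace E'] [BorelSpace E']
    (L : E → E') (hL : Measurable L) (L' : E' → E) (h : ∀ x t, ⟪L x, t⟫ = ⟪x, L' t⟫)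
    (hn : ∀ t, ‖L' t‖ = ‖t‖) : (stdGaussian E).map L = stdGaussian E' := by
  have : IsProbabilityMeasure ((stdGaussian E).map L) :=
    Measure.isProbabilityMeasure_map hL.aemeasurable
  refine Measure.ext_of_charFun ?_
  ext t
  rw [charFun_stdGaussian, charFun_apply, integral_map hL.aemeasurable
    (Measurable.aestronglyMeasurable (by fun_prop))]
  simp_rw [h]
  rw [← charFun_apply, charFun_stdGaussian, hn]

lemma lintegral_gaussianReal_exp_sq :
    ∫⁻ x, ENNReal.ofReal (Real.exp (x ^ 2 / 4)) ∂(gaussianReal 0 1) = ENNReal.ofReal √2 := by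
  rw [gaussianReal_of_var_ne_zero _ one_ne_zero,
    lintegral_withDensity_eq_lintegral_mul _ (measurable_gaussianPDF 0 1) (by fun_prop)]
  have e : ∀ x : ℝ, (gaussianPDF 0 1 * fun x => ENNReal.ofReal (Real.exp (x ^ 2 / 4))) x =
      ENNReal.ofReal ((√(2 * Real.pi))⁻¹ * Real.exp (-(1 / 4) * x ^ 2)) := by
    intro x
    simp only [Pi.mul_apply, gaussianPDF, gaussianPDFReal]
    rw [← ENNReal.ofReal_mul (by positivity), mul_assoc, ← Real.exp_add]
    congr 3
    · simp
    · simp; ring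
  simp_rw [e]
  rw [← ofReal_integral_eq_lintegral_ofReal ((integrable_exp_neg_mul_sq (by norm_num)).const_mul _)
    (ae_of_all _ fun x => by positivity), integral_const_mul, integral_gaussian]
  congr 1
  rw [show Real.pi / (1 / 4) = (2 * Real.pi) * 2 by ring,
    Real.sqrt_mul (x := 2 * Real.pi) (by positivity) 2]
  rw [← mul_assoc, inv_mul_cancel₀ (by positivity), one_mul]

lemma lintegral_stdGaussian_exp_norm_sq (ι : Type*) [Fintype ι] :
    ∫⁻ x, ENNReal.ofReal (Real.exp (‖x‖ ^ 2 / 4)) ∂(stdGaussian (EuclideanSpace ℝ ι)) =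
      ENNReal.ofReal √2 ^ Fintype.card ι := by
  rw [← map_pi_eq_stdGaussian, lintegral_map (by fun_prop) (by fun_prop)]
  have e : ∀ x : ι → ℝ, ENNReal.ofReal (Real.exp (‖WithLp.toLp 2 x‖ ^ 2 / 4)) =
      ∏ i, ENNReal.ofReal (Real.exp (x i ^ 2 / 4)) := by
    intro x
    rw [← ENNReal.ofReal_prod_of_nonneg fun i _ => (Real.exp_pos _).le, ← Real.exp_sum,
      EuclideanSpace.real_norm_sq_eq, Finset.sum_div]
  simp_rw [e]
  rw [lintegral_pi_prod (f := fun _ x => ENNReal.ofReal (Real.exp (x ^ 2 / 4))) _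
    fun i => by fun_prop]
  simp [lintegral_gaussianReal_exp_sq]

lemma stdGaussian_map_inner {E : Type*} [NormedAddCommGroup E] [InnerProductSpace ℝ E]
    [FiniteDimensional ℝ E] [MeasurableSpace E] [BorelSpace E] (a : E) :
    (stdGaussian E).map (fun x => ⟪a, x⟫) = (gaussianReal 0 1).map (fun x => ‖a‖ * x) := by
  have h := IsGaussian.map_eq_gaussianReal (μ := stdGaussian E) (innerSL ℝ a)
  rw [integral_strongDual_stdGaussian, variance_dual_stdGaussian, innerSL_apply_norm] at h
  rw [gaussianReal_map_const_mul, mul_zero, mul_one]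
  refine Eq.trans ?_ (h.trans ?_)
  · rfl
  · congr 1
    ext
    simp

lemma pow_le_factorial_mul_exp (x : ℝ) (hx : 0 ≤ x) (p : ℕ) :
    x ^ p ≤ p.factorial * Real.exp x := by
  have := Real.pow_div_factorial_le_exp x hx p
  rwa [div_le_iff₀' (by positivity)] at this

/-- Follows from `y ^ p ≤ p! exp y` at `y = x² / 4` and the exponential moment above. Growth like `p
^ p` is the sub-Gaussian order, needed because `p` will grow like `log n`. -/
lemma lintegral_gaussianReal_pow (p : ℕ) :
    ∫⁻ x, ENNReal.ofReal (x ^ (2 * p)) ∂(gaussianReal 0 1) ≤ ENNReal.ofReal (2 * (4 * p) ^ p) := by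
  calc ∫⁻ x, ENNReal.ofReal (x ^ (2 * p)) ∂(gaussianReal 0 1)
      ≤ ∫⁻ x, ENNReal.ofReal ((4 * p) ^ p) * ENNReal.ofReal (Real.exp (x ^ 2 / 4))
          ∂(gaussianReal 0 1) := by
        refine lintegral_mono fun x => ?_
        rw [← ENNReal.ofReal_mul (by positivity)]
        refine ENNReal.ofReal_le_ofReal ?_
        have h := pow_le_factorial_mul_exp (x ^ 2 / 4) (by positivity) p
        have h2 : (p.factorial : ℝ) ≤ (p : ℝ) ^ p := by exact_mod_cast Nat.factorial_le_pow p
        calc x ^ (2 * p) = 4 ^ p * (x ^ 2 / 4) ^ p := by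
              rw [← mul_pow, pow_mul]; congr 1; ring
          _ ≤ 4 ^ p * (p ^ p * Real.exp (x ^ 2 / 4)) := by
              refine mul_le_mul_of_nonneg_left (h.trans ?_) (by positivity)
              exact mul_le_mul_of_nonneg_right h2 (by positivity)
          _ = _ := by rw [mul_pow]; ring
    _ = ENNReal.ofReal ((4 * p) ^ p) * ENNReal.ofReal √2 := by
        rw [lintegral_const_mul _ (by fun_prop), lintegral_gaussianReal_exp_sq]
    _ ≤ _ := by
        rw [← ENNReal.ofReal_mul (by positivity), mul_comm]
        refine ENNReal.ofReal_le_ofReal (mul_le_mul_of_nonneg_right ?_ (by positivity))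
        rw [Real.sqrt_le_left (by norm_num)]; norm_num

lemma lintegral_inner_pow_le {E : Type*} [NormedAddCommGroup E] [InnerProductSpace ℝ E]
    [FiniteDimensional ℝ E] [MeasurableSpace E] [BorelSpace E] (a : E) (p : ℕ) :
    ∫⁻ x, ENNReal.ofReal (⟪a, x⟫ ^ (2 * p)) ∂(stdGaussian E) ≤
      ENNReal.ofReal (2 * (4 * p) ^ p) * ENNReal.ofReal (‖a‖ ^ (2 * p)) := by
  have h1 : ∫⁻ x, ENNReal.ofReal (⟪a, x⟫ ^ (2 * p)) ∂(stdGaussian E) =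
      ∫⁻ y, ENNReal.ofReal (y ^ (2 * p)) ∂((stdGaussian E).map (fun x => ⟪a, x⟫)) := by
    rw [lintegral_map (by fun_prop) (by fun_prop)]
  rw [h1, stdGaussian_map_inner, lintegral_map (by fun_prop) (by fun_prop)]
  simp_rw [mul_pow, ENNReal.ofReal_mul (pow_nonneg (norm_nonneg a) (2 * p))]
  rw [lintegral_const_mul _ (by fun_prop), mul_comm]
  gcongr
  simpa [ENNReal.ofReal_mul, ENNReal.ofReal_pow, mul_pow] using lintegral_gaussianReal_pow p

lemma lintegral_inner_sq {E : Type*} [NormedAddCommGroup E] [InnerProductSpace ℝ E]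
    [FiniteDimensional ℝ E] [MeasurableSpace E] [BorelSpace E] (a : E) :
    ∫⁻ x, ENNReal.ofReal (⟪a, x⟫ ^ 2) ∂(stdGaussian E) = ENNReal.ofReal (‖a‖ ^ 2) := by
  have h := variance_dual_stdGaussian (E := E) (innerSL ℝ a)
  rw [variance_of_integral_eq_zero (by fun_prop) (integral_strongDual_stdGaussian _),
    innerSL_apply_norm] at h
  rw [← h, ofReal_integral_eq_lintegral_ofReal]
  · simp
  · exact (IsGaussian.memLp_dual (stdGaussian E) (innerSL ℝ a) 2 (by simp)).integrable_sq
  · exact ae_of_all _ fun x => by positivity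

lemma lintegral_norm_sq_stdGaussian (ι : Type*) [Fintype ι] :
    ∫⁻ x, ENNReal.ofReal (‖x‖ ^ 2) ∂(stdGaussian (EuclideanSpace ℝ ι)) = Fintype.card ι := by
  classical
  simp_rw [EuclideanSpace.real_norm_sq_eq,
    ENNReal.ofReal_sum_of_nonneg fun i _ => sq_nonneg (_ : ℝ)]
  rw [lintegral_finsetSum _ fun i _ => by fun_prop]
  have : ∀ i : ι, ∫⁻ x, ENNReal.ofReal (x i ^ 2) ∂(stdGaussian (EuclideanSpace ℝ ι)) = 1 := by
    intro i
    have := lintegral_inner_sq (EuclideanSpace.single i (1 : ℝ))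
    simpa [EuclideanSpace.inner_single_left] using this
  simp [this]

/-- Moments from one exponential moment. -/
lemma lintegral_pow_le_of_exp {α : Type*} [MeasurableSpace α] (μ : Measure α)
    [IsProbabilityMeasure μ] {Y : α → ℝ} (hY : Measurable Y) (h0 : ∀ x, 0 ≤ Y x) {A : ℝ}
    (hA : 0 ≤ A) (h : ∫⁻ x, ENNReal.ofReal (Real.exp (Y x)) ∂μ ≤ ENNReal.ofReal (Real.exp A))
    (p : ℕ) (hp : p ≠ 0) :
    ∫⁻ x, ENNReal.ofReal (Y x ^ p) ∂μ ≤ ENNReal.ofReal ((2 * A + 2 * p) ^ p) := by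
  -- Splitting at `2 * A` keeps the bound polynomial in `A`: beyond that point `exp (y / 2) ≤ exp
  -- (-A) * exp y`, and the factor `exp (-A)` cancels the assumed exponential moment.
  have key : ∀ y : ℝ, 0 ≤ y → y ^ p ≤ (2 * A) ^ p + (2 * p) ^ p * Real.exp (-A) * Real.exp y := by
    intro y hy
    rcases le_total y (2 * A) with h1 | h1
    · have : y ^ p ≤ (2 * A) ^ p := pow_le_pow_left₀ hy h1 p
      have : 0 ≤ (2 * p) ^ p * Real.exp (-A) * Real.exp y := by positivity
      linarith
    · have h3 := pow_le_factorial_mul_exp (y / 2) (by positivity) p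
      have h2 : (p.factorial : ℝ) ≤ (p : ℝ) ^ p := by exact_mod_cast Nat.factorial_le_pow p
      have h4 : y ^ p ≤ (2 * p) ^ p * Real.exp (y / 2) := by
        calc y ^ p = 2 ^ p * (y / 2) ^ p := by rw [← mul_pow]; congr 1; ring
          _ ≤ 2 ^ p * (p ^ p * Real.exp (y / 2)) := by
              refine mul_le_mul_of_nonneg_left (h3.trans ?_) (by positivity)
              exact mul_le_mul_of_nonneg_right h2 (by positivity)
          _ = _ := by rw [mul_pow]; ring
      have h5 : Real.exp (y / 2) ≤ Real.exp (-A) * Real.exp y := by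
        rw [← Real.exp_add]; exact Real.exp_le_exp.2 (by linarith)
      have h6 : (2 * (p : ℝ)) ^ p * Real.exp (y / 2) ≤ (2 * p) ^ p * (Real.exp (-A) * Real.exp y) :=
        mul_le_mul_of_nonneg_left h5 (by positivity)
      have h7 : 0 ≤ (2 * A) ^ p := by positivity
      linarith
  calc ∫⁻ x, ENNReal.ofReal (Y x ^ p) ∂μ
      ≤ ∫⁻ x, (ENNReal.ofReal ((2 * A) ^ p) + ENNReal.ofReal ((2 * p) ^ p * Real.exp (-A)) *
          ENNReal.ofReal (Real.exp (Y x))) ∂μ := by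
        refine lintegral_mono fun x => ?_
        rw [← ENNReal.ofReal_mul (by positivity), ← ENNReal.ofReal_add (by positivity) (by positivity)]
        exact ENNReal.ofReal_le_ofReal (key _ (h0 x))
    _ ≤ ENNReal.ofReal ((2 * A) ^ p) + ENNReal.ofReal ((2 * p) ^ p * Real.exp (-A)) *
          ENNReal.ofReal (Real.exp A) := by
        rw [lintegral_add_left measurable_const, lintegral_const_mul _ (by fun_prop)]
        simp only [lintegral_const, measure_univ, mul_one]
        gcongr
    _ = ENNReal.ofReal ((2 * A) ^ p + (2 * p) ^ p) := by
        rw [← ENNReal.ofReal_mul (by positivity), ← ENNReal.ofReal_add (by positivity) (by positivity),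
          mul_assoc, ← Real.exp_add]
        simp
    _ ≤ _ := ENNReal.ofReal_le_ofReal (pow_add_pow_le (by positivity) (by positivity) hp)


/-! ### Gibbs measures of a Gaussian channel -/

section Gibbs

variable {E : Type*} [NormedAddCommGroup E] [InnerProductSpace ℝ E] {Ω : Type*}

/-- Log-likelihood ratio of the observation `o` for the signal `s z`. -/
def gibbsExponent (s : Ω → E) (o : E) (z : Ω) : ℝ := ⟪s z, o⟫ - ‖s z‖ ^ 2 / 2

/-- The logarithm of the partition function of the channel `o = s z + g`. -/
def logPartition [MeasurableSpace Ω] (P : Measure Ω) (s : Ω → E) (o : E) : ℝ :=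
  Real.log (∫ z, Real.exp (gibbsExponent s o z) ∂P)

/-- The posterior measure given the observation `o`. -/
def gibbs [MeasurableSpace Ω] (P : Measure Ω) (s : Ω → E) (o : E) : Measure Ω :=
  P.tilted (gibbsExponent s o)

lemma gibbsExponent_le {s : Ω → E} {b : ℝ} {o : E} {z : Ω} (h : ‖s z‖ ≤ b) : gibbsExponent s o z ≤ b * ‖o‖ := by
  have h1 := real_inner_le_norm (s z) o
  have h2 : ‖s z‖ * ‖o‖ ≤ b * ‖o‖ := mul_le_mul_of_nonneg_right h (norm_nonneg _)
  have h3 := sq_nonneg ‖s z‖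
  unfold gibbsExponent
  linarith

lemma le_gibbsExponent {s : Ω → E} {b : ℝ} {o : E} {z : Ω} (h : ‖s z‖ ≤ b) :
    -(b * ‖o‖ + b ^ 2 / 2) ≤ gibbsExponent s o z := by
  have h1 := abs_le.1 (abs_real_inner_le_norm (s z) o)
  have h2 : ‖s z‖ * ‖o‖ ≤ b * ‖o‖ := mul_le_mul_of_nonneg_right h (norm_nonneg _)
  have h3 : ‖s z‖ ^ 2 ≤ b ^ 2 := pow_le_pow_left₀ (norm_nonneg _) h 2
  unfold gibbsExponent
  linarith [h1.1]

lemma lintegral_gibbs [MeasurableSpace Ω] {P : Measure Ω} {s : Ω → E} (o : E) (F : Ω → ℝ≥0∞) :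
    ∫⁻ z, F z ∂(gibbs P s o) = ∫⁻ z, ENNReal.ofReal (Real.exp (gibbsExponent s o z) /
      ∫ z, Real.exp (gibbsExponent s o z) ∂P) * F z ∂P :=
  lintegral_tilted _ _

lemma ae_gibbs [MeasurableSpace Ω] {P : Measure Ω} {s : Ω → E} {p : Ω → Prop} (o : E) (h : ∀ᵐ z ∂P, p z) : ∀ᵐ z ∂(gibbs P s o), p z :=
  (tilted_absolutelyContinuous P _).ae_le h

variable [FiniteDimensional ℝ E] [MeasurableSpace E] [BorelSpace E] [MeasurableSpace Ω]
  {P : Measure Ω} [IsProbabilityMeasure P] {s : Ω → E} {b : ℝ}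

lemma measurable_gibbsExponent (hs : Measurable s) :
    Measurable fun q : E × Ω => gibbsExponent s q.1 q.2 := by
  unfold gibbsExponent
  fun_prop

lemma integrable_exp_gibbsExponent (hs : Measurable s) (hb : ∀ᵐ z ∂P, ‖s z‖ ≤ b) (o : E) :
    Integrable (fun z => Real.exp (gibbsExponent s o z)) P := by
  refine Integrable.of_bound (C := Real.exp (b * ‖o‖)) ?_ ?_
  · exact (Real.measurable_exp.comp ((measurable_gibbsExponent hs).comp
      measurable_prodMk_left)).aestronglyMeasurable
  · filter_upwards [hb] with z hz
    rw [Real.norm_of_nonneg (Real.exp_pos _).le]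
    exact Real.exp_le_exp.2 (gibbsExponent_le hz)

lemma partition_pos (hs : Measurable s) (hb : ∀ᵐ z ∂P, ‖s z‖ ≤ b) (o : E) :
    0 < ∫ z, Real.exp (gibbsExponent s o z) ∂P :=
  integral_exp_pos (integrable_exp_gibbsExponent hs hb o)

lemma isProbabilityMeasure_gibbs (hs : Measurable s) (hb : ∀ᵐ z ∂P, ‖s z‖ ≤ b) (o : E) :
    IsProbabilityMeasure (gibbs P s o) :=
  isProbabilityMeasure_tilted (integrable_exp_gibbsExponent hs hb o)

lemma measurable_partition (hs : Measurable s) :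
    Measurable fun o : E => ∫ z, Real.exp (gibbsExponent s o z) ∂P :=
  (StronglyMeasurable.integral_prod_right' (f := fun q : E × Ω => Real.exp (gibbsExponent s q.1 q.2))
    (Real.measurable_exp.comp (measurable_gibbsExponent hs)).stronglyMeasurable).measurable

lemma measurable_logPartition (hs : Measurable s) : Measurable (logPartition P s) :=
  Real.measurable_log.comp (measurable_partition hs)

/-- The logarithm of an average of exponentials is 1-Lipschitz in the exponent for the essential
supremum norm. It gives the crude size of `logPartition`, its dependence on the parameters and its
dependence on the true signal. -/
lemma abs_log_integral_exp_sub_le {u v : Ω → ℝ} {c : ℝ}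
    (hu : Integrable (fun z => Real.exp (u z)) P) (hv : Integrable (fun z => Real.exp (v z)) P)
    (h : ∀ᵐ z ∂P, |u z - v z| ≤ c) :
    |Real.log (∫ z, Real.exp (u z) ∂P) - Real.log (∫ z, Real.exp (v z) ∂P)| ≤ c := by
  have key : ∀ {u v : Ω → ℝ}, Integrable (fun z => Real.exp (u z)) P →
      Integrable (fun z => Real.exp (v z)) P → (∀ᵐ z ∂P, |u z - v z| ≤ c) →
      Real.log (∫ z, Real.exp (u z) ∂P) - Real.log (∫ z, Real.exp (v z) ∂P) ≤ c := by
    intro u v hu hv h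
    have h1 : ∫ z, Real.exp (u z) ∂P ≤ Real.exp c * ∫ z, Real.exp (v z) ∂P := by
      rw [← integral_const_mul]
      refine integral_mono_ae hu (hv.const_mul _) ?_
      filter_upwards [h] with z hz
      rw [← Real.exp_add]
      exact Real.exp_le_exp.2 (by linarith [(abs_le.1 hz).2])
    have h2 := Real.log_le_log (integral_exp_pos hu) h1
    rw [Real.log_mul (Real.exp_pos c).ne' (integral_exp_pos hv).ne', Real.log_exp] at h2
    linarith
  rw [abs_le]
  constructor
  · have := key hv hu (by simpa only [abs_sub_comm] using h)
    linarith
  · exact key hu hv h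

lemma abs_logPartition_le (hs : Measurable s) (hb : ∀ᵐ z ∂P, ‖s z‖ ≤ b) (o : E) :
    |logPartition P s o| ≤ b * ‖o‖ + b ^ 2 / 2 := by
  have h := abs_log_integral_exp_sub_le (P := P) (u := gibbsExponent s o) (v := fun _ => 0)
    (c := b * ‖o‖ + b ^ 2 / 2)
    (integrable_exp_gibbsExponent hs hb o) (integrable_const _) (by
      filter_upwards [hb] with z hz
      rw [sub_zero, abs_le]
      exact ⟨le_gibbsExponent hz, (gibbsExponent_le hz).trans (by linarith [sq_nonneg b])⟩)
  simpa [logPartition] using h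

lemma measurable_lintegral_gibbs {X : Type*} [MeasurableSpace X] (hs : Measurable s) {o : X → E}
    (ho : Measurable o) {F : X × Ω → ℝ≥0∞} (hF : Measurable F) :
    Measurable fun x => ∫⁻ z, F (x, z) ∂(gibbs P s (o x)) := by
  simp_rw [lintegral_gibbs]
  refine Measurable.lintegral_prod_right' (f := fun q : X × Ω =>
    ENNReal.ofReal (Real.exp (gibbsExponent s (o q.1) q.2) /
      ∫ z, Real.exp (gibbsExponent s (o q.1) z) ∂P) * F q) ?_
  have h1 : Measurable fun q : X × Ω => gibbsExponent s (o q.1) q.2 :=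
    (measurable_gibbsExponent hs).comp ((ho.comp measurable_fst).prodMk measurable_snd)
  have h2 : Measurable fun q : X × Ω => ∫ z, Real.exp (gibbsExponent s (o q.1) z) ∂P :=
    (measurable_partition hs).comp (ho.comp measurable_fst)
  fun_prop

/-- Differentiation under the integral. Requiring the whole path and its velocity to stay within
radius `R` makes the dominating function a constant. -/
lemma hasDerivAt_logPartition (hs : Measurable s) (hb : ∀ᵐ z ∂P, ‖s z‖ ≤ b) (hb0 : 0 ≤ b)
    {c : ℝ → E} {d : ℝ → E} (hc : ∀ θ, HasDerivAt c (d θ) θ) {R : ℝ} (hcR : ∀ θ, ‖c θ‖ ≤ R)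
    (hdR : ∀ θ, ‖d θ‖ ≤ R) (θ : ℝ) :
    HasDerivAt (fun θ => logPartition P s (c θ)) (∫ z, ⟪s z, d θ⟫ ∂(gibbs P s (c θ))) θ := by
  have hmeas : ∀ o : E, Measurable (gibbsExponent s o) := fun o =>
    (measurable_gibbsExponent hs).comp measurable_prodMk_left
  have h := hasDerivAt_integral_of_dominated_loc_of_deriv_le (μ := P) (x₀ := θ)
    (s := Set.univ) (F := fun θ z => Real.exp (gibbsExponent s (c θ) z))
    (F' := fun θ z => Real.exp (gibbsExponent s (c θ) z) * ⟪s z, d θ⟫)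
    (bound := fun _ => Real.exp (b * R) * (b * R))
    univ_mem (Eventually.of_forall fun θ => by have := hmeas (c θ); fun_prop)
    (integrable_exp_gibbsExponent hs hb _)
    (by have := hmeas (c θ); fun_prop)
    (by
      filter_upwards [hb] with z hz θ _
      rw [norm_mul, Real.norm_of_nonneg (Real.exp_pos _).le]
      refine mul_le_mul (Real.exp_le_exp.2 ((gibbsExponent_le hz).trans ?_)) ?_ (norm_nonneg _)
        (Real.exp_pos _).le
      · exact mul_le_mul_of_nonneg_left (hcR θ) hb0
      · exact (norm_inner_le_norm _ _).trans (mul_le_mul hz (hdR θ) (norm_nonneg _) hb0))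
    (integrable_const _)
    (by
      filter_upwards with z θ _
      refine HasDerivAt.exp ?_
      unfold gibbsExponent
      exact ((innerSL ℝ (s z)).hasFDerivAt.comp_hasDerivAt θ (hc θ)).sub_const _)
  have h2 := h.2.log (partition_pos hs hb (c θ)).ne'
  convert! h2 using 1
  rw [gibbs, integral_tilted, ← integral_div]
  refine integral_congr_ae (ae_of_all _ fun z => ?_)
  simp only [smul_eq_mul]
  ring

/-- The centred logarithm of the partition function seen from the signal `a`. -/
def centredLogPartition (P : Measure Ω) (s : Ω → E) (a g : E) : ℝ :=
  logPartition P s (g + a) - ⟪a, g⟫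

lemma measurable_centredLogPartition (hs : Measurable s) :
    Measurable fun q : E × E => centredLogPartition P s q.1 q.2 := by
  have := measurable_logPartition (P := P) hs
  unfold centredLogPartition
  fun_prop

/-- The quarter circle `cos θ • x.1 + sin θ • x.2` joins `x.1` to `x.2`, and its velocity is the
second component of the rotated pair. Because of the centring, the derivative along it is the Gibbs
average of `⟪s z - a, velocity⟫`. Jensen's inequality is applied in `θ`, over length `π / 2`, and
then under the Gibbs measure. -/
lemma enorm_rotation_sub_le (hs : Measurable s) (hb : ∀ᵐ z ∂P, ‖s z‖ ≤ b) (hb0 : 0 ≤ b)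
    (a : E) (x : E × E) (k : ℕ) :
    ‖centredLogPartition P s a x.2 - centredLogPartition P s a x.1‖ₑ ^ (k + 1) ≤
      ENNReal.ofReal (Real.pi / 2) ^ k * ∫⁻ θ in Set.Ioc 0 (Real.pi / 2),
        ∫⁻ z, ‖⟪s z - a, (ContinuousLinearMap.rotation θ x).2⟫‖ₑ ^ (k + 1)
          ∂(gibbs P s ((ContinuousLinearMap.rotation θ x).1 + a)) := by
  set c : ℝ → E := fun θ => (ContinuousLinearMap.rotation θ x).1 with hc
  set d : ℝ → E := fun θ => (ContinuousLinearMap.rotation θ x).2 with hd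
  have hc' : ∀ θ, HasDerivAt c (d θ) θ := by
    intro θ
    simp only [hc, hd, ContinuousLinearMap.rotation_apply]
    exact ((Real.hasDerivAt_cos θ).smul_const x.1).add ((Real.hasDerivAt_sin θ).smul_const x.2)
  have hbd : ∀ u v : ℝ, |u| ≤ 1 → |v| ≤ 1 → ‖u • x.1 + v • x.2‖ ≤ ‖x.1‖ + ‖x.2‖ := by
    intro u v hu hv
    refine (norm_add_le _ _).trans ?_
    rw [norm_smul, norm_smul]
    exact add_le_add (mul_le_of_le_one_left (norm_nonneg _) hu)
      (mul_le_of_le_one_left (norm_nonneg _) hv)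
  have hcR : ∀ θ, ‖c θ‖ ≤ ‖x.1‖ + ‖x.2‖ := fun θ =>
    hbd _ _ (Real.abs_cos_le_one θ) (Real.abs_sin_le_one θ)
  have hdR : ∀ θ, ‖d θ‖ ≤ ‖x.1‖ + ‖x.2‖ := fun θ =>
    hbd _ _ (by rw [abs_neg]; exact Real.abs_sin_le_one θ) (Real.abs_cos_le_one θ)
  set r : ℝ → ℝ := fun θ => centredLogPartition P s a (c θ) with hr
  have hint : ∀ θ, Integrable (fun z => ⟪s z, d θ⟫) (gibbs P s (c θ + a)) := fun θ => by
    have := isProbabilityMeasure_gibbs hs hb (c θ + a)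
    refine Integrable.of_bound (C := b * ‖d θ‖) (by fun_prop) ?_
    filter_upwards [ae_gibbs _ hb] with z hz
    exact (norm_inner_le_norm _ _).trans (mul_le_mul_of_nonneg_right hz (norm_nonneg _))
  have hr' : ∀ θ, HasDerivAt r (∫ z, ⟪s z - a, d θ⟫ ∂(gibbs P s (c θ + a))) θ := by
    intro θ
    have := isProbabilityMeasure_gibbs hs hb (c θ + a)
    have h1 := hasDerivAt_logPartition hs hb hb0 (c := fun θ => c θ + a)
      (fun θ => (hc' θ).add_const a) (R := ‖x.1‖ + ‖x.2‖ + ‖a‖)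
      (fun θ => (norm_add_le _ _).trans (by linarith [hcR θ]))
      (fun θ => (hdR θ).trans (by linarith [norm_nonneg a])) θ
    have h2 := (innerSL ℝ a).hasFDerivAt.comp_hasDerivAt θ (hc' θ)
    convert! h1.sub h2 using 1
    simp_rw [inner_sub_left]
    rw [integral_sub (hint θ) (integrable_const _)]
    simp
  have hbound : ∀ θ, ‖deriv r θ‖ ≤ (b + ‖a‖) * (‖x.1‖ + ‖x.2‖) := by
    intro θ
    have := isProbabilityMeasure_gibbs hs hb (c θ + a)
    rw [(hr' θ).deriv]
    have := norm_integral_le_of_norm_le_const (μ := gibbs P s (c θ + a))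
      (f := fun z => ⟪s z - a, d θ⟫) (C := (b + ‖a‖) * (‖x.1‖ + ‖x.2‖)) (by
        filter_upwards [ae_gibbs _ hb] with z hz
        refine (norm_inner_le_norm _ _).trans (mul_le_mul ?_ (hdR θ) (norm_nonneg _) (by positivity))
        exact (norm_sub_le _ _).trans (by linarith))
    simpa using this
  have hII : IntervalIntegrable (deriv r) volume 0 (Real.pi / 2) := by
    rw [intervalIntegrable_iff]
    exact Measure.integrableOn_of_bounded (M := (b + ‖a‖) * (‖x.1‖ + ‖x.2‖))
      (by simp) (measurable_deriv r).aestronglyMeasurable (ae_of_all _ hbound)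
  have hFTC := intervalIntegral.integral_eq_sub_of_hasDerivAt
    (fun θ _ => (hr' θ).differentiableAt.hasDerivAt) hII
  have e1 : r (Real.pi / 2) = centredLogPartition P s a x.2 := by
    simp [hr, hc, ContinuousLinearMap.rotation_apply]
  have e0 : r 0 = centredLogPartition P s a x.1 := by
    simp [hr, hc, ContinuousLinearMap.rotation_apply]
  rw [← e1, ← e0, ← hFTC, intervalIntegral.integral_of_le (by positivity)]
  calc ‖∫ θ in Set.Ioc 0 (Real.pi / 2), deriv r θ‖ₑ ^ (k + 1)
      ≤ (∫⁻ θ in Set.Ioc 0 (Real.pi / 2), ‖deriv r θ‖ₑ) ^ (k + 1) :=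
        pow_le_pow_left' (enorm_integral_le_lintegral_enorm _) _
    _ ≤ ENNReal.ofReal (Real.pi / 2) ^ k *
          ∫⁻ θ in Set.Ioc 0 (Real.pi / 2), ‖deriv r θ‖ₑ ^ (k + 1) := by
        refine (lintegral_pow_le _ (measurable_deriv r).enorm.aemeasurable k).trans ?_
        simp
    _ ≤ _ := by
        refine mul_le_mul_right (lintegral_mono fun θ => ?_) _
        rw [(hr' θ).deriv]
        have := isProbabilityMeasure_gibbs hs hb (c θ + a)
        refine (pow_le_pow_left' (enorm_integral_le_lintegral_enorm _) _).trans ?_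
        refine (lintegral_pow_le _ (by fun_prop) k).trans ?_
        simp [hc, hd]

lemma enorm_pow_two_mul (x : ℝ) (p : ℕ) : ‖x‖ₑ ^ (2 * p) = ENNReal.ofReal (x ^ (2 * p)) := by
  rw [← ofReal_norm, ← ENNReal.ofReal_pow (norm_nonneg _), Real.norm_eq_abs, pow_mul,
    sq_abs, ← pow_mul]

/-- A Maurey–Pisier type moment bound for the logarithm of the partition function. -/
lemma lintegral_centredLogPartition_sub_le (hs : Measurable s) (hb : ∀ᵐ z ∂P, ‖s z‖ ≤ b)
    (hb0 : 0 ≤ b) (a : E) {p : ℕ} (hp : p ≠ 0) :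
    ∫⁻ x : E × E, ‖centredLogPartition P s a x.2 - centredLogPartition P s a x.1‖ₑ ^ (2 * p)
        ∂((stdGaussian E).prod (stdGaussian E)) ≤
      ENNReal.ofReal (Real.pi / 2) ^ (2 * p) * (ENNReal.ofReal (2 * (4 * p) ^ p) *
        ∫⁻ g, ∫⁻ z, ‖s z - a‖ₑ ^ (2 * p) ∂(gibbs P s (g + a)) ∂(stdGaussian E)) := by
  obtain ⟨k, hk⟩ : ∃ k, 2 * p = k + 1 := ⟨2 * p - 1, by omega⟩
  set K : E × E → ℝ≥0∞ := fun y => ∫⁻ z, ‖⟪s z - a, y.2⟫‖ₑ ^ (2 * p) ∂(gibbs P s (y.1 + a)) with hK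
  have hKm : Measurable K := by
    refine measurable_lintegral_gibbs (o := fun y : E × E => y.1 + a)
      (F := fun q : (E × E) × Ω => ‖⟪s q.2 - a, q.1.2⟫‖ₑ ^ (2 * p)) hs (by fun_prop) ?_
    fun_prop
  have hrot : Measurable fun q : (E × E) × ℝ => ContinuousLinearMap.rotation q.2 q.1 := by
    simp only [ContinuousLinearMap.rotation_apply]
    fun_prop
  -- A pair of independent standard Gaussians is rotation invariant, so each `θ` contributes the
  -- same amount and the `θ`-integral only adds a factor `π / 2`.
  have hinv : ∀ θ : ℝ, ∫⁻ x, K (ContinuousLinearMap.rotation θ x)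
      ∂((stdGaussian E).prod (stdGaussian E)) = ∫⁻ x, K x ∂((stdGaussian E).prod (stdGaussian E)) := by
    intro θ
    rw [← lintegral_map hKm (by fun_prop), IsGaussian.map_rotation_eq_self (by simp) θ]
  calc _ ≤ ∫⁻ x : E × E, ENNReal.ofReal (Real.pi / 2) ^ k * (∫⁻ θ in Set.Ioc 0 (Real.pi / 2),
          K (ContinuousLinearMap.rotation θ x)) ∂((stdGaussian E).prod (stdGaussian E)) := by
        refine lintegral_mono fun x => ?_
        simp only [hK, hk]
        exact enorm_rotation_sub_le hs hb hb0 a x k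
    _ = ENNReal.ofReal (Real.pi / 2) ^ k * (ENNReal.ofReal (Real.pi / 2) *
          ∫⁻ x, K x ∂((stdGaussian E).prod (stdGaussian E))) := by
        rw [lintegral_const_mul _ (Measurable.lintegral_prod_right'
          (f := fun q : (E × E) × ℝ => K (ContinuousLinearMap.rotation q.2 q.1)) (hKm.comp hrot))]
        rw [lintegral_lintegral_swap (f := fun (x : E × E) (θ : ℝ) => K (ContinuousLinearMap.rotation θ x))
          (hKm.comp hrot).aemeasurable]
        simp_rw [hinv]
        simp [mul_comm]
    _ = ENNReal.ofReal (Real.pi / 2) ^ (2 * p) *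
          ∫⁻ x, K x ∂((stdGaussian E).prod (stdGaussian E)) := by
        rw [hk, pow_succ, mul_assoc]
    _ ≤ _ := by
        refine mul_le_mul_right ?_ _
        rw [lintegral_prod _ hKm.aemeasurable, ← lintegral_const_mul]
        · refine lintegral_mono fun g => ?_
          simp only [hK]
          have := isProbabilityMeasure_gibbs hs hb (g + a)
          -- The Gibbs measure depends only on the first Gaussian. For fixed `z` the second one is
          -- independent of it, and its inner product with `s z - a` has variance `‖s z - a‖²`.
          rw [lintegral_lintegral_swap (by fun_prop), ← lintegral_const_mul _ (by fun_prop)]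
          refine lintegral_mono fun z => ?_
          simp_rw [enorm_pow_two_mul]
          refine (lintegral_inner_pow_le (s z - a) p).trans_eq ?_
          rw [← ofReal_norm, ENNReal.ofReal_pow (norm_nonneg _)]
        · exact measurable_lintegral_gibbs (o := fun g : E => g + a)
            (F := fun q : E × Ω => ‖s q.2 - a‖ₑ ^ (2 * p)) hs (by fun_prop) (by fun_prop)

/-- Under the joint law of signal, noise and replica, the noise seen from the replica is again
standard Gaussian (Nishimori identity). -/
lemma lintegral_nishimori (hs : Measurable s) (hb : ∀ᵐ z ∂P, ‖s z‖ ≤ b) {Ψ : E → ℝ≥0∞}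
    (hΨ : Measurable Ψ) :
    ∫⁻ w, ∫⁻ g, ∫⁻ z, Ψ (g + s w - s z) ∂(gibbs P s (g + s w)) ∂(stdGaussian E) ∂P =
      ∫⁻ g, Ψ g ∂(stdGaussian E) := by
  set Q : E → ℝ≥0∞ := fun o => ∫⁻ z, Ψ (o - s z) ∂(gibbs P s o) with hQ
  have hQm : Measurable Q := measurable_lintegral_gibbs (o := fun o : E => o)
    (F := fun q : E × Ω => Ψ (q.1 - s q.2)) hs measurable_id (by fun_prop)
  have hexp : ∀ (o : E) (w : Ω), ENNReal.ofReal (Real.exp (⟪s w, o⟫ - ‖s w‖ ^ 2 / 2)) =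
    ENNReal.ofReal (Real.exp (gibbsExponent s o w)) := fun o w => rfl
  have hm1 := measurable_gibbsExponent (E := E) hs
  have hm2 : Measurable fun q : Ω × E => gibbsExponent s q.2 q.1 :=
    hm1.comp measurable_swap
  have hm3 : ∀ o : E, Measurable fun w => gibbsExponent s o w := fun o =>
    hm1.comp measurable_prodMk_left
  have hm4 : ∀ w, Measurable fun o : E => gibbsExponent s o w := fun w =>
    hm1.comp measurable_prodMk_right
  calc _ = ∫⁻ w, ∫⁻ g, ENNReal.ofReal (Real.exp (gibbsExponent s g w)) * Q g ∂(stdGaussian E) ∂P := by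
        refine lintegral_congr fun w => ?_
        -- Cameron–Martin trades the true signal in the observation for its likelihood weight;
        -- afterwards the observation is pure noise.
        exact lintegral_stdGaussian_add (s w) hQm
    _ = ∫⁻ g, ∫⁻ w, ENNReal.ofReal (Real.exp (gibbsExponent s g w)) * Q g ∂P ∂(stdGaussian E) :=
        lintegral_lintegral_swap (by fun_prop)
    _ = ∫⁻ g, ∫⁻ z, ENNReal.ofReal (Real.exp (gibbsExponent s g z)) * Ψ (g - s z)
          ∂P ∂(stdGaussian E) := by
        refine lintegral_congr fun g => ?_
        -- Averaging the weight over the true signal produces the partition function, which cancels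
        -- the Gibbs normalisation. The replica is left carrying the likelihood weight, that is, in
        -- the role of the true signal.
        have hZ := partition_pos hs hb g
        rw [lintegral_mul_const _ (by have := hm3 g; fun_prop),
          ← ofReal_integral_eq_lintegral_ofReal (integrable_exp_gibbsExponent hs hb g)
          (ae_of_all _ fun z => (Real.exp_pos _).le)]
        simp only [hQ]
        rw [lintegral_gibbs, ← lintegral_const_mul _ (by have := hm3 g; fun_prop)]
        refine lintegral_congr fun z => ?_
        rw [← mul_assoc, ← ENNReal.ofReal_mul hZ.le, mul_div_cancel₀ _ hZ.ne']
    _ = ∫⁻ z, ∫⁻ g, ENNReal.ofReal (Real.exp (gibbsExponent s g z)) * Ψ (g - s z)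
          ∂(stdGaussian E) ∂P :=
        lintegral_lintegral_swap (by fun_prop)
    _ = ∫⁻ _z, ∫⁻ g, Ψ g ∂(stdGaussian E) ∂P := by
        refine lintegral_congr fun z => ?_
        -- Cameron–Martin read backwards, now with the replica as signal.
        have := lintegral_stdGaussian_add (s z) (Φ := fun g => Ψ (g - s z)) (by fun_prop)
        simp only [add_sub_cancel_right] at this
        exact this.symm
    _ = _ := by simp

/-- Moments of the fluctuation of the centred log-partition function, in terms of a bound `T` on
the noise tested against differences of signals. -/
theorem lintegral_fluctuation_le (hs : Measurable s) (hb : ∀ᵐ z ∂P, ‖s z‖ ≤ b) (hb0 : 0 ≤ b)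
    {T : E → ℝ} (hTm : Measurable T) (hT0 : ∀ g, 0 ≤ T g)
    (hT : ∀ g w z, |⟪s w - s z, g⟫| ≤ ‖s w - s z‖ * T g) {p : ℕ} (hp : p ≠ 0) :
    ∫⁻ w, ∫⁻ x : E × E,
        ‖centredLogPartition P s (s w) x.2 - centredLogPartition P s (s w) x.1‖ₑ ^ (2 * p)
        ∂((stdGaussian E).prod (stdGaussian E)) ∂P ≤
      ENNReal.ofReal (Real.pi ^ (2 * p) * (2 * (4 * p) ^ p)) *
        ∫⁻ g, ENNReal.ofReal (T g ^ (2 * p)) ∂(stdGaussian E) := by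
  set J := ∫⁻ g, ENNReal.ofReal (T g ^ (2 * p)) ∂(stdGaussian E) with hJ
  obtain ⟨k, hk⟩ : ∃ k, 2 * p = k + 1 := ⟨2 * p - 1, by omega⟩
  have hΔ : ∀ g w z, ‖s z - s w‖ₑ ^ (2 * p) ≤
      2 ^ k * (ENNReal.ofReal (T g ^ (2 * p)) + ENNReal.ofReal (T (g + s w - s z) ^ (2 * p))) := by
    intro g w z
    -- The squared norm is the difference of two tests of `s z - s w`, against the true noise and
    -- against the noise seen from the replica. Each test is at most the norm times `T`, so one
    -- factor of the norm divides out.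
    have h1 : ‖s z - s w‖ ≤ T g + T (g + s w - s z) := by
      have h2 := hT g z w
      have h3 := hT (g + s w - s z) z w
      have h4 : ⟪s z - s w, g⟫ - ⟪s z - s w, g + s w - s z⟫ = ‖s z - s w‖ ^ 2 := by
        rw [← inner_sub_right, ← real_inner_self_eq_norm_sq]; congr 1; abel
      have h5 : ‖s z - s w‖ ^ 2 ≤ ‖s z - s w‖ * (T g + T (g + s w - s z)) := by
        rw [← h4, mul_add]
        linarith [le_abs_self ⟪s z - s w, g⟫, neg_abs_le ⟪s z - s w, g + s w - s z⟫]
      rcases (norm_nonneg (s z - s w)).eq_or_lt with h0 | h0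
      · rw [← h0]; exact add_nonneg (hT0 _) (hT0 _)
      · rw [pow_two] at h5; exact le_of_mul_le_mul_left h5 h0
    rw [← ofReal_norm, ← ENNReal.ofReal_pow (norm_nonneg _),
      ← ENNReal.ofReal_add (pow_nonneg (hT0 _) _) (pow_nonneg (hT0 _) _),
      show (2 : ℝ≥0∞) ^ k = ENNReal.ofReal (2 ^ k) by simp [ENNReal.ofReal_pow],
      ← ENNReal.ofReal_mul (by positivity)]
    refine ENNReal.ofReal_le_ofReal ((pow_le_pow_left₀ (norm_nonneg _) h1 _).trans ?_)
    have := add_pow_le (hT0 g) (hT0 (g + s w - s z)) (2 * p)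
    rwa [show 2 * p - 1 = k by omega] at this
  have hΔ' : ∫⁻ w, ∫⁻ g, ∫⁻ z, ‖s z - s w‖ₑ ^ (2 * p) ∂(gibbs P s (g + s w)) ∂(stdGaussian E) ∂P ≤
      2 ^ (2 * p) * J := by
    have hN := lintegral_nishimori (P := P) hs hb
      (Ψ := fun g => ENNReal.ofReal (T g ^ (2 * p))) (by fun_prop)
    have hmQ : Measurable fun q : Ω × E => ∫⁻ z, ENNReal.ofReal (T (q.2 + s q.1 - s z) ^ (2 * p))
        ∂(gibbs P s (q.2 + s q.1)) :=
      measurable_lintegral_gibbs (o := fun q : Ω × E => q.2 + s q.1)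
        (F := fun q : (Ω × E) × Ω => ENNReal.ofReal (T (q.1.2 + s q.1.1 - s q.2) ^ (2 * p))) hs
        (by fun_prop) (by fun_prop)
    calc _ ≤ ∫⁻ w, ∫⁻ g, 2 ^ k * (ENNReal.ofReal (T g ^ (2 * p)) +
            ∫⁻ z, ENNReal.ofReal (T (g + s w - s z) ^ (2 * p)) ∂(gibbs P s (g + s w)))
              ∂(stdGaussian E) ∂P := by
          refine lintegral_mono fun w => lintegral_mono fun g => ?_
          have := isProbabilityMeasure_gibbs hs hb (g + s w)
          refine (lintegral_mono fun z => hΔ g w z).trans ?_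
          rw [lintegral_const_mul _ (by fun_prop), lintegral_add_left (by fun_prop)]
          simp
      _ = 2 ^ k * (J + J) := by
          have : ∀ w, ∫⁻ g, 2 ^ k * (ENNReal.ofReal (T g ^ (2 * p)) +
            ∫⁻ z, ENNReal.ofReal (T (g + s w - s z) ^ (2 * p)) ∂(gibbs P s (g + s w)))
              ∂(stdGaussian E) = 2 ^ k * (J + ∫⁻ g, ∫⁻ z, ENNReal.ofReal
                (T (g + s w - s z) ^ (2 * p)) ∂(gibbs P s (g + s w)) ∂(stdGaussian E)) := by
            intro w
            have := hmQ.comp (measurable_prodMk_left (x := w))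
            simp only [Function.comp_def] at this
            rw [lintegral_const_mul _ (by fun_prop), lintegral_add_left (by fun_prop)]
          simp_rw [this]
          have := Measurable.lintegral_prod_right' (ν := stdGaussian E) hmQ
          rw [lintegral_const_mul _ (by fun_prop), lintegral_add_left (by fun_prop), hN]
          simp [hJ]
      _ = 2 ^ (2 * p) * J := by rw [hk, pow_succ, ← two_mul, mul_assoc]
  calc _ ≤ ∫⁻ w, ENNReal.ofReal (Real.pi / 2) ^ (2 * p) * (ENNReal.ofReal (2 * (4 * p) ^ p) *
        ∫⁻ g, ∫⁻ z, ‖s z - s w‖ₑ ^ (2 * p) ∂(gibbs P s (g + s w)) ∂(stdGaussian E)) ∂P :=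
        lintegral_mono fun w => lintegral_centredLogPartition_sub_le hs hb hb0 (s w) hp
    _ = ENNReal.ofReal (Real.pi / 2) ^ (2 * p) * (ENNReal.ofReal (2 * (4 * p) ^ p) *
        ∫⁻ w, ∫⁻ g, ∫⁻ z, ‖s z - s w‖ₑ ^ (2 * p) ∂(gibbs P s (g + s w)) ∂(stdGaussian E) ∂P) := by
        have hm : Measurable fun w => ∫⁻ g, ∫⁻ z, ‖s z - s w‖ₑ ^ (2 * p)
            ∂(gibbs P s (g + s w)) ∂(stdGaussian E) :=
          Measurable.lintegral_prod_right' (f := fun q : Ω × E =>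
            ∫⁻ z, ‖s z - s q.1‖ₑ ^ (2 * p) ∂(gibbs P s (q.2 + s q.1)))
            (measurable_lintegral_gibbs (o := fun q : Ω × E => q.2 + s q.1)
              (F := fun q : (Ω × E) × Ω => ‖s q.2 - s q.1.1‖ₑ ^ (2 * p)) hs
              (by fun_prop) (by fun_prop))
        rw [lintegral_const_mul _ (by fun_prop), lintegral_const_mul _ (by fun_prop)]
    _ ≤ ENNReal.ofReal (Real.pi / 2) ^ (2 * p) * (ENNReal.ofReal (2 * (4 * p) ^ p) *
        (2 ^ (2 * p) * J)) := by gcongr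
    _ = _ := by
        rw [show (2 : ℝ≥0∞) ^ (2 * p) = ENNReal.ofReal (2 ^ (2 * p)) by simp [ENNReal.ofReal_pow],
          ← ENNReal.ofReal_pow (by positivity), ← mul_assoc, ← mul_assoc,
          ← ENNReal.ofReal_mul (by positivity), ← ENNReal.ofReal_mul (by positivity)]
        congr 2
        rw [div_pow]
        field_simp

end Gibbs


/-! ### Uniform concentration for a family of Gaussian channels -/

section Uniform

variable {E : Type*} [NormedAddCommGroup E] [InnerProductSpace ℝ E] {Ω : Type*}

/-- The signal `∑ aᵢ eᵢ(z)`. -/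
def combine (e : Fin 3 → Ω → E) (a : Fin 3 → ℝ) (z : Ω) : E := ∑ i, a i • e i z

/-- The log-partition function of the channel with signal `combine e a`, as a function of the
true signal and the noise. -/
def channelLog [MeasurableSpace Ω] (P : Measure Ω) (e : Fin 3 → Ω → E) (a : Fin 3 → ℝ)
    (q : Ω × E) : ℝ :=
  logPartition P (combine e a) (q.2 + combine e a q.1)

lemma norm_combine_le {e : Fin 3 → Ω → E} {a : Fin 3 → ℝ} {z : Ω} {A ℓ : ℝ}
    (ha : ∀ i, |a i| ≤ A) (hz : ∀ i, ‖e i z‖ ≤ ℓ) : ‖combine e a z‖ ≤ 3 * A * ℓ := by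
  have hA : 0 ≤ A := (abs_nonneg _).trans (ha 0)
  calc ‖combine e a z‖ ≤ ∑ i, ‖a i • e i z‖ := norm_sum_le _ _
    _ ≤ ∑ _i : Fin 3, A * ℓ := Finset.sum_le_sum fun i _ => by
        rw [norm_smul]; exact mul_le_mul (ha i) (hz i) (norm_nonneg _) hA
    _ = _ := by simp; ring

lemma combine_sub (e : Fin 3 → Ω → E) (a a' : Fin 3 → ℝ) (z : Ω) :
    combine e a z - combine e a' z = combine e (a - a') z := by
  simp [combine, sub_smul]

lemma abs_le_of_mem_Icc {A : ℝ} {a : Fin 3 → ℝ} (ha : ∀ i, a i ∈ Set.Icc 0 A) (i : Fin 3) : |a i| ≤ A := by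
  rw [abs_of_nonneg (ha i).1]; exact (ha i).2

lemma ae_norm_combine_le [MeasurableSpace Ω] {P : Measure Ω} {e : Fin 3 → Ω → E} {A ℓ : ℝ}
    (hℓ : ∀ᵐ z ∂P, ∀ i, ‖e i z‖ ≤ ℓ) {a : Fin 3 → ℝ}
    (ha : ∀ i, a i ∈ Set.Icc 0 A) : ∀ᵐ z ∂P, ‖combine e a z‖ ≤ 3 * A * ℓ := by
  filter_upwards [hℓ] with z hz
  exact norm_combine_le (abs_le_of_mem_Icc ha) hz

variable [FiniteDimensional ℝ E] [MeasurableSpace E] [BorelSpace E] [MeasurableSpace Ω]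
  {P : Measure Ω} [IsProbabilityMeasure P] {e : Fin 3 → Ω → E} {A ℓ : ℝ}

lemma measurable_combine (he : ∀ i, Measurable (e i)) (a : Fin 3 → ℝ) :
    Measurable (combine e a) := by
  unfold combine
  exact Finset.measurable_sum _ fun i _ => (he i).const_smul (a i)

lemma measurable_channelLog (he : ∀ i, Measurable (e i)) (a : Fin 3 → ℝ) :
    Measurable (channelLog P e a) := by
  have h1 := measurable_combine he a
  have h2 := measurable_logPartition (P := P) h1
  unfold channelLog
  fun_prop

lemma integrable_channelLog (he : ∀ i, Measurable (e i)) (hℓ : ∀ᵐ z ∂P, ∀ i, ‖e i z‖ ≤ ℓ)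
    {a : Fin 3 → ℝ} (ha : ∀ i, a i ∈ Set.Icc 0 A) :
    Integrable (channelLog P e a) (P.prod (stdGaussian E)) := by
  set b := 3 * A * ℓ with hb
  have hb0 : 0 ≤ b := by
    obtain ⟨z, hz⟩ := (ae_norm_combine_le hℓ ha).exists
    exact (norm_nonneg _).trans hz
  have hg : Integrable (fun q : Ω × E => b * (‖q.2‖ + b) + b ^ 2 / 2) (P.prod (stdGaussian E)) := by
    have h1 : Integrable (fun g : E => ‖g‖) (stdGaussian E) := IsGaussian.integrable_id.norm
    exact (((h1.comp_snd P).add (integrable_const _)).const_mul _).add (integrable_const _)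
  refine hg.mono' (measurable_channelLog he a).aestronglyMeasurable ?_
  have h3 := Measure.quasiMeasurePreserving_fst (μ := P) (ν := stdGaussian E) |>.ae
    (ae_norm_combine_le hℓ ha)
  filter_upwards [h3] with q hq
  refine (abs_logPartition_le (measurable_combine he a) (ae_norm_combine_le hℓ ha) _).trans ?_
  have h4 : ‖q.2 + combine e a q.1‖ ≤ ‖q.2‖ + b := (norm_add_le _ _).trans (by linarith)
  have := mul_le_mul_of_nonneg_left h4 hb0
  linarith

lemma integrable_channelLog_right (he : ∀ i, Measurable (e i)) (hℓ : ∀ᵐ z ∂P, ∀ i, ‖e i z‖ ≤ ℓ)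
    {a : Fin 3 → ℝ} (ha : ∀ i, a i ∈ Set.Icc 0 A) (w : Ω) :
    Integrable (fun g => channelLog P e a (w, g)) (stdGaussian E) := by
  set b := 3 * A * ℓ with hb
  have hb0 : 0 ≤ b := by
    obtain ⟨z, hz⟩ := (ae_norm_combine_le hℓ ha).exists
    exact (norm_nonneg _).trans hz
  have hg : Integrable (fun g : E => b * (‖g‖ + ‖combine e a w‖) + b ^ 2 / 2) (stdGaussian E) := by
    have h1 : Integrable (fun g : E => ‖g‖) (stdGaussian E) := IsGaussian.integrable_id.norm
    exact ((h1.add (integrable_const _)).const_mul _).add (integrable_const _)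
  refine hg.mono' ((measurable_channelLog he a).comp measurable_prodMk_left).aestronglyMeasurable ?_
  filter_upwards with g
  refine (abs_logPartition_le (measurable_combine he a) (ae_norm_combine_le hℓ ha) _).trans ?_
  have := mul_le_mul_of_nonneg_left (norm_add_le g (combine e a w)) hb0
  linarith

lemma enorm_integral_sub_sq_le {α : Type*} [MeasurableSpace α] {μ : Measure α}
    [IsProbabilityMeasure μ] {u : α → ℝ} (hu : Integrable u μ) (c : ℝ) :
    ‖c - ∫ x, u x ∂μ‖ₑ ^ 2 ≤ ∫⁻ x, ‖c - u x‖ₑ ^ 2 ∂μ := by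
  have h1 : c - ∫ x, u x ∂μ = ∫ x, (c - u x) ∂μ := by
    rw [integral_sub (integrable_const _) hu]; simp
  rw [h1]
  refine (pow_le_pow_left' (enorm_integral_le_lintegral_enorm _) 2).trans ?_
  refine (lintegral_pow_le μ (aemeasurable_const.sub hu.aemeasurable).enorm 1).trans ?_
  simp

/-- A crude Lipschitz bound in the parameters, used only below the mesh scale of the grid. The full
norm of the noise is allowed here because `δ` will be `1 / n`. The `9 * A * ℓ` collects three
contributions `3 * A * ℓ`: one from each signal cross term and one from the difference of the
squared norms. -/
lemma abs_channelLog_sub_le (he : ∀ i, Measurable (e i)) (hℓ : ∀ᵐ z ∂P, ∀ i, ‖e i z‖ ≤ ℓ)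
    {a a' : Fin 3 → ℝ} (ha : ∀ i, a i ∈ Set.Icc 0 A) (ha' : ∀ i, a' i ∈ Set.Icc 0 A) {δ : ℝ}
    (hδ : ∀ i, |a i - a' i| ≤ δ) {w : Ω} (hw : ∀ i, ‖e i w‖ ≤ ℓ) (g : E) :
    |channelLog P e a (w, g) - channelLog P e a' (w, g)| ≤ 3 * δ * ℓ * (‖g‖ + 9 * A * ℓ) := by
  refine abs_log_integral_exp_sub_le
    (integrable_exp_gibbsExponent (measurable_combine he a) (ae_norm_combine_le hℓ ha) _)
    (integrable_exp_gibbsExponent (measurable_combine he a') (ae_norm_combine_le hℓ ha') _) ?_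
  filter_upwards [hℓ] with z hz
  set u := combine e a z
  set u' := combine e a' z
  set v := combine e a w
  set v' := combine e a' w
  have hd : ∀ {x : Ω}, (∀ i, ‖e i x‖ ≤ ℓ) → ‖combine e a x - combine e a' x‖ ≤ 3 * δ * ℓ := by
    intro x hx
    rw [combine_sub]
    exact norm_combine_le hδ hx
  have h1 : ‖u - u'‖ ≤ 3 * δ * ℓ := hd hz
  have h2 : ‖v - v'‖ ≤ 3 * δ * ℓ := hd hw
  have h3 : ‖u‖ ≤ 3 * A * ℓ := norm_combine_le (abs_le_of_mem_Icc ha) hz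
  have h4 : ‖u'‖ ≤ 3 * A * ℓ := norm_combine_le (abs_le_of_mem_Icc ha') hz
  have h5 : ‖v‖ ≤ 3 * A * ℓ := norm_combine_le (abs_le_of_mem_Icc ha) hw
  have hid : gibbsExponent (combine e a) ((w, g).2 + combine e a (w, g).1) z -
      gibbsExponent (combine e a') ((w, g).2 + combine e a' (w, g).1) z =
      ⟪u - u', g⟫ + ⟪u - u', v⟫ + ⟪u', v - v'⟫ - ⟪u - u', u + u'⟫ / 2 := by
    change ⟪u, g + v⟫ - ‖u‖ ^ 2 / 2 - (⟪u', g + v'⟫ - ‖u'‖ ^ 2 / 2) = _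
    rw [← real_inner_self_eq_norm_sq, ← real_inner_self_eq_norm_sq]
    simp only [inner_add_right, inner_sub_left, inner_sub_right]
    rw [real_inner_comm u u']
    ring
  rw [hid]
  have hδℓ : 0 ≤ 3 * δ * ℓ := (norm_nonneg _).trans h1
  have i1 : |⟪u - u', g⟫| ≤ 3 * δ * ℓ * ‖g‖ :=
    (abs_real_inner_le_norm _ _).trans (mul_le_mul_of_nonneg_right h1 (norm_nonneg _))
  have i2 : |⟪u - u', v⟫| ≤ 3 * δ * ℓ * (3 * A * ℓ) :=
    (abs_real_inner_le_norm _ _).trans (mul_le_mul h1 h5 (norm_nonneg _) hδℓ)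
  have i3 : |⟪u', v - v'⟫| ≤ (3 * A * ℓ) * (3 * δ * ℓ) :=
    (abs_real_inner_le_norm _ _).trans (mul_le_mul h4 h2 (norm_nonneg _) ((norm_nonneg _).trans h4))
  have i4 : |⟪u - u', u + u'⟫| ≤ 3 * δ * ℓ * (3 * A * ℓ + 3 * A * ℓ) :=
    (abs_real_inner_le_norm _ _).trans
      (mul_le_mul h1 ((norm_add_le _ _).trans (add_le_add h3 h4)) (norm_nonneg _) hδℓ)
  rw [abs_le] at *
  constructor <;> linarith [i1.1, i1.2, i2.1, i2.2, i3.1, i3.2, i4.1, i4.2]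

/-- The grid of mesh `δ` in `[0, Lδ]³`. -/
def grid (δ : ℝ) (L : ℕ) : Finset (Fin 3 → ℝ) :=
  (Fintype.piFinset fun _ : Fin 3 => Finset.range (L + 1)).image fun k i => (k i : ℝ) * δ

lemma card_grid_le (δ : ℝ) (L : ℕ) : (grid δ L).card ≤ (L + 1) ^ 3 := by
  refine Finset.card_image_le.trans ?_
  simp

lemma mem_Icc_of_mem_grid {δ : ℝ} (hδ : 0 < δ) {a : Fin 3 → ℝ}
    (ha : a ∈ grid δ ⌊A / δ⌋₊) (hA : 0 ≤ A) (i : Fin 3) : a i ∈ Set.Icc 0 A := by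
  obtain ⟨k, hk, rfl⟩ := Finset.mem_image.1 ha
  have h1 : k i ≤ ⌊A / δ⌋₊ := by
    have := Fintype.mem_piFinset.1 hk i
    rw [Finset.mem_range] at this; omega
  refine ⟨by positivity, ?_⟩
  rw [← le_div_iff₀ hδ]
  exact (Nat.cast_le.2 h1).trans (Nat.floor_le (by positivity))

lemma exists_mem_grid {δ : ℝ} (hδ : 0 < δ) {a : Fin 3 → ℝ} (ha : ∀ i, a i ∈ Set.Icc 0 A) :
    ∃ a' ∈ grid δ ⌊A / δ⌋₊, ∀ i, |a i - a' i| ≤ δ := by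
  refine ⟨fun i => (⌊a i / δ⌋₊ : ℝ) * δ, Finset.mem_image.2 ⟨fun i => ⌊a i / δ⌋₊, ?_, rfl⟩, ?_⟩
  · rw [Fintype.mem_piFinset]
    intro i
    rw [Finset.mem_range, Nat.lt_succ_iff]
    exact Nat.floor_le_floor (div_le_div_of_nonneg_right (ha i).2 hδ.le)
  · intro i
    have h1 := Nat.floor_le (div_nonneg (ha i).1 hδ.le)
    have h2 := Nat.lt_floor_add_one (a i / δ)
    rw [le_div_iff₀ hδ] at h1
    rw [div_lt_iff₀ hδ] at h2
    rw [abs_le]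
    constructor <;> linarith

/-- A maximum is bounded by an `ℓ^p` sum, so the price of the maximum is `card ^ (1 / p)`. This
stays bounded once `p` is of the order of the logarithm of the cardinality. -/
lemma lintegral_sup_le_of_pow {α ι : Type*} [MeasurableSpace α] {μ : Measure α}
    [IsProbabilityMeasure μ] {S : Finset ι} {u : ι → α → ℝ≥0∞} (hu : ∀ i, Measurable (u i))
    {p : ℕ} (hp : p ≠ 0) {B K : ℝ≥0∞} (hB : ∀ i ∈ S, ∫⁻ x, u i x ^ p ∂μ ≤ B ^ p)
    (hK : (S.card : ℝ≥0∞) ≤ K ^ p) : ∫⁻ x, S.sup (fun i => u i x) ∂μ ≤ K * B := by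
  obtain ⟨k, rfl⟩ := Nat.exists_eq_succ_of_ne_zero hp
  have h1 : (∫⁻ x, S.sup (fun i => u i x) ∂μ) ^ (k + 1) ≤ (K * B) ^ (k + 1) := by
    calc _ ≤ ∫⁻ x, S.sup (fun i => u i x) ^ (k + 1) ∂μ := by
          have hm : Measurable fun x => S.sup (fun i => u i x) := by
            simp_rw [Finset.sup_eq_iSup]
            exact Measurable.biSup _ S.countable_toSet fun i _ => hu i
          simpa using lintegral_pow_le μ hm.aemeasurable k
      _ ≤ ∫⁻ x, ∑ i ∈ S, u i x ^ (k + 1) ∂μ := by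
          refine lintegral_mono fun x => ?_
          rcases S.eq_empty_or_nonempty with rfl | hS
          · simp
          · obtain ⟨i, hi, h⟩ := Finset.exists_mem_eq_sup S hS fun i => u i x
            simp only [h]
            exact Finset.single_le_sum (f := fun i => u i x ^ (k + 1)) (fun _ _ => zero_le) hi
      _ = ∑ i ∈ S, ∫⁻ x, u i x ^ (k + 1) ∂μ :=
          lintegral_finsetSum _ fun i _ => (hu i).pow_const _
      _ ≤ ∑ _i ∈ S, B ^ (k + 1) := Finset.sum_le_sum hB
      _ = S.card * B ^ (k + 1) := by simp
      _ ≤ K ^ (k + 1) * B ^ (k + 1) := by gcongr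
      _ = _ := (mul_pow _ _ _).symm
  exact (ENNReal.pow_le_pow_left_iff (by omega)).1 h1

set_option maxHeartbeats 1000000 in
/-- Uniform concentration of the log-partition functions of a three-parameter family of channels,
given bounds on the moments of the fluctuations of the centred log-partition functions and on the
dependence of the noise average on the signal. -/
theorem exists_uniform_bound (he : ∀ i, Measurable (e i)) (hℓ : ∀ᵐ z ∂P, ∀ i, ‖e i z‖ ≤ ℓ)
    (hA : 0 ≤ A) {δ : ℝ} (hδ : 0 < δ) {p : ℕ} (hp : p ≠ 0) {B K : ℝ}
    (hK : (((⌊A / δ⌋₊ + 1) ^ 3 : ℕ) : ℝ) ≤ K ^ p) (hK0 : 0 ≤ K)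
    (hB : ∀ a : Fin 3 → ℝ, (∀ i, a i ∈ Set.Icc 0 A) → ∫⁻ w, ∫⁻ x : E × E,
        ‖centredLogPartition P (combine e a) (combine e a w) x.2 -
          centredLogPartition P (combine e a) (combine e a w) x.1‖ₑ ^ (2 * p)
        ∂((stdGaussian E).prod (stdGaussian E)) ∂P ≤ ENNReal.ofReal B ^ p) (hB0 : 0 ≤ B)
    {d : ℝ} (hd0 : 0 ≤ d) (hd : ∫⁻ g, ENNReal.ofReal (‖g‖ ^ 2) ∂(stdGaussian E) ≤ ENNReal.ofReal d)
    {S : Ω × Ω → ℝ≥0∞} (hS : Measurable S)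
    (hS' : ∀ᵐ w ∂P, ∀ᵐ w' ∂P, ∀ a : Fin 3 → ℝ, (∀ i, a i ∈ Set.Icc 0 A) →
      ‖∫ g, channelLog P e a (w, g) ∂(stdGaussian E) -
        ∫ g, channelLog P e a (w', g) ∂(stdGaussian E)‖ₑ ^ 2 ≤ S (w, w')) {σ : ℝ} (hσ : 0 ≤ σ)
    (hSσ : ∫⁻ w, ∫⁻ w', S (w, w') ∂P ∂P ≤ ENNReal.ofReal σ) :
    ∃ D : Ω × E → ℝ≥0∞, Measurable D ∧
      (∀ᵐ q ∂(P.prod (stdGaussian E)), ∀ a : Fin 3 → ℝ, (∀ i, a i ∈ Set.Icc 0 A) →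
        ‖channelLog P e a q - ∫ q, channelLog P e a q ∂(P.prod (stdGaussian E))‖ₑ ^ 2 ≤ D q) ∧
      ∫⁻ q, D q ∂(P.prod (stdGaussian E)) ≤ ENNReal.ofReal
        (8 * (K * B + 36 * A ^ 2 * ℓ ^ 2 + 36 * δ ^ 2 * ℓ ^ 2 * (d + 81 * A ^ 2 * ℓ ^ 2)) + 2 * σ) := by
  set γ := stdGaussian E with hγ
  set net := grid δ ⌊A / δ⌋₊ with hnet
  have hnetA : ∀ a ∈ net, ∀ i, a i ∈ Set.Icc 0 A := fun a ha => mem_Icc_of_mem_grid hδ ha hA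
  have hℓ0 : 0 ≤ ℓ := by
    obtain ⟨z, hz⟩ := hℓ.exists
    exact (norm_nonneg _).trans (hz 0)
  set u : (Fin 3 → ℝ) → Ω × (E × E) → ℝ≥0∞ := fun a y =>
    ‖centredLogPartition P (combine e a) (combine e a y.1) y.2.2 -
      centredLogPartition P (combine e a) (combine e a y.1) y.2.1‖ₑ ^ 2 with hu
  have hum : ∀ a, Measurable (u a) := fun a => by
    have h1 := measurable_combine he a
    have h2 := measurable_centredLogPartition (P := P) h1
    have h3 : Measurable fun y : Ω × (E × E) =>
        centredLogPartition P (combine e a) (combine e a y.1) y.2.2 :=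
      h2.comp (f := fun y : Ω × (E × E) => (combine e a y.1, y.2.2)) (by fun_prop)
    have h4 : Measurable fun y : Ω × (E × E) =>
        centredLogPartition P (combine e a) (combine e a y.1) y.2.1 :=
      h2.comp (f := fun y : Ω × (E × E) => (combine e a y.1, y.2.1)) (by fun_prop)
    exact (h3.sub h4).enorm.pow_const 2
  set v : Ω × (E × E) → ℝ≥0∞ := fun y => net.sup fun a => u a y with hv
  have hvm : Measurable v := by
    simp only [hv, Finset.sup_eq_iSup]
    exact Measurable.biSup _ net.countable_toSet fun i _ => hum i
  have hvint : ∫⁻ y, v y ∂(P.prod (γ.prod γ)) ≤ ENNReal.ofReal (K * B) := by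
    rw [ENNReal.ofReal_mul hK0]
    refine lintegral_sup_le_of_pow hum hp (fun a ha => ?_) ?_
    · rw [lintegral_prod _ ((hum a).pow_const _).aemeasurable]
      simp only [hu, ← pow_mul]
      exact hB a (hnetA a ha)
    · rw [← ENNReal.ofReal_pow hK0, ← ENNReal.ofReal_natCast]
      exact ENNReal.ofReal_le_ofReal ((Nat.cast_le.2 (card_grid_le _ _)).trans hK)
  -- This dominates, for all parameters in the cube at once, the square of the linear term removed
  -- by the centring; the factor 3 is Cauchy–Schwarz over the three components.
  set lin : Ω × (E × E) → ℝ := fun y => 3 * A ^ 2 * ∑ i, ⟪e i y.1, y.2.1 - y.2.2⟫ ^ 2 with hlin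
  have hlinm : Measurable lin := by
    simp only [hlin]
    refine Measurable.const_mul (Finset.measurable_sum _ fun i _ => ?_) _
    have := he i
    fun_prop
  have hlin0 : ∀ y, 0 ≤ lin y := fun y => by simp only [hlin]; positivity
  have hlinint : ∫⁻ y, ENNReal.ofReal (lin y) ∂(P.prod (γ.prod γ)) ≤
      ENNReal.ofReal (36 * A ^ 2 * ℓ ^ 2) := by
    rw [lintegral_prod _ hlinm.ennreal_ofReal.aemeasurable]
    have key : ∀ᵐ w ∂P, ∫⁻ x, ENNReal.ofReal (lin (w, x)) ∂(γ.prod γ) ≤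
        ENNReal.ofReal (36 * A ^ 2 * ℓ ^ 2) := by
      filter_upwards [hℓ] with w hw
      calc _ ≤ ∫⁻ x : E × E, ∑ i, (ENNReal.ofReal (6 * A ^ 2) * ENNReal.ofReal (⟪e i w, x.1⟫ ^ 2) +
              ENNReal.ofReal (6 * A ^ 2) * ENNReal.ofReal (⟪e i w, x.2⟫ ^ 2)) ∂(γ.prod γ) := by
            refine lintegral_mono fun x => ?_
            simp only [← ENNReal.ofReal_mul (show 0 ≤ 6 * A ^ 2 by positivity)]
            simp_rw [← ENNReal.ofReal_add (show 0 ≤ 6 * A ^ 2 * ⟪e _ w, x.1⟫ ^ 2 by positivity)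
              (show 0 ≤ 6 * A ^ 2 * ⟪e _ w, x.2⟫ ^ 2 by positivity)]
            rw [← ENNReal.ofReal_sum_of_nonneg fun i _ => by positivity]
            refine ENNReal.ofReal_le_ofReal ?_
            simp only [hlin, Finset.mul_sum]
            refine Finset.sum_le_sum fun i _ => ?_
            rw [inner_sub_right]
            nlinarith [mul_nonneg (sq_nonneg A) (sq_nonneg (⟪e i w, x.1⟫ + ⟪e i w, x.2⟫))]
        _ ≤ ∑ _i : Fin 3, ENNReal.ofReal (12 * A ^ 2 * ℓ ^ 2) := by
            rw [lintegral_finsetSum _ fun i _ => by fun_prop]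
            refine Finset.sum_le_sum fun i _ => ?_
            have h6 : ∫⁻ g, ENNReal.ofReal (⟪e i w, g⟫ ^ 2) ∂γ ≤ ENNReal.ofReal (ℓ ^ 2) := by
              rw [hγ, lintegral_inner_sq]
              exact ENNReal.ofReal_le_ofReal (pow_le_pow_left₀ (norm_nonneg _) (hw i) 2)
            rw [lintegral_add_left (by fun_prop), lintegral_const_mul _ (by fun_prop),
              lintegral_const_mul _ (by fun_prop),
              lintegral_prod _ (Measurable.aemeasurable (by fun_prop)),
              lintegral_prod _ (Measurable.aemeasurable (by fun_prop))]
            simp only [lintegral_const, measure_univ, mul_one]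
            calc _ ≤ ENNReal.ofReal (6 * A ^ 2) * ENNReal.ofReal (ℓ ^ 2) +
                  ENNReal.ofReal (6 * A ^ 2) * ENNReal.ofReal (ℓ ^ 2) := by gcongr
              _ = _ := by
                rw [← ENNReal.ofReal_mul (by positivity),
                  ← ENNReal.ofReal_add (by positivity) (by positivity)]
                congr 1; ring
        _ = _ := by
            rw [← ENNReal.ofReal_sum_of_nonneg fun i _ => by positivity]
            congr 1; simp; ring
    refine (lintegral_mono_ae key).trans ?_
    simp
  -- Squared error of moving a parameter to the grid.
  set osc : E → ℝ := fun g => (3 * δ * ℓ * (‖g‖ + 9 * A * ℓ)) ^ 2 with hosc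
  have hoscm : Measurable osc := by simp only [hosc]; fun_prop
  have hosc0 : ∀ g, 0 ≤ osc g := fun g => sq_nonneg _
  have hoscint : ∫⁻ g, ENNReal.ofReal (osc g) ∂γ ≤
      ENNReal.ofReal (18 * δ ^ 2 * ℓ ^ 2 * (d + 81 * A ^ 2 * ℓ ^ 2)) := by
    calc _ ≤ ∫⁻ g, (ENNReal.ofReal (18 * δ ^ 2 * ℓ ^ 2) * ENNReal.ofReal (‖g‖ ^ 2) +
            ENNReal.ofReal (18 * δ ^ 2 * ℓ ^ 2 * (81 * A ^ 2 * ℓ ^ 2))) ∂γ := by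
          refine lintegral_mono fun g => ?_
          rw [← ENNReal.ofReal_mul (by positivity), ← ENNReal.ofReal_add (by positivity) (by positivity)]
          refine ENNReal.ofReal_le_ofReal ?_
          simp only [hosc]
          nlinarith [mul_nonneg (sq_nonneg (δ * ℓ)) (sq_nonneg (‖g‖ - 9 * A * ℓ))]
      _ ≤ ENNReal.ofReal (18 * δ ^ 2 * ℓ ^ 2) * ENNReal.ofReal d +
            ENNReal.ofReal (18 * δ ^ 2 * ℓ ^ 2 * (81 * A ^ 2 * ℓ ^ 2)) := by
          rw [lintegral_add_left (by fun_prop), lintegral_const_mul _ (by fun_prop)]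
          simp only [lintegral_const, measure_univ, mul_one]
          gcongr
      _ = _ := by
          rw [← ENNReal.ofReal_mul (by positivity), ← ENNReal.ofReal_add (by positivity) (by positivity)]
          congr 1; ring
  set V : Ω × (E × E) → ℝ≥0∞ := fun y =>
    4 * (v y + ENNReal.ofReal (lin y) + ENNReal.ofReal (osc y.2.1) + ENNReal.ofReal (osc y.2.2))
    with hV
  have hVm : Measurable V := by simp only [hV]; fun_prop
  have hVint : ∫⁻ y, V y ∂(P.prod (γ.prod γ)) ≤ ENNReal.ofReal
      (4 * (K * B + 36 * A ^ 2 * ℓ ^ 2 + 36 * δ ^ 2 * ℓ ^ 2 * (d + 81 * A ^ 2 * ℓ ^ 2))) := by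
    have i1 : ∫⁻ y : Ω × (E × E), ENNReal.ofReal (osc y.2.1) ∂(P.prod (γ.prod γ)) =
        ∫⁻ g, ENNReal.ofReal (osc g) ∂γ := by
      rw [lintegral_prod _ (Measurable.aemeasurable (by fun_prop))]
      simp only
      rw [lintegral_prod _ (Measurable.aemeasurable (by fun_prop))]
      simp
    have i2 : ∫⁻ y : Ω × (E × E), ENNReal.ofReal (osc y.2.2) ∂(P.prod (γ.prod γ)) =
        ∫⁻ g, ENNReal.ofReal (osc g) ∂γ := by
      rw [lintegral_prod _ (Measurable.aemeasurable (by fun_prop))]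
      simp only
      rw [lintegral_prod _ (Measurable.aemeasurable (by fun_prop))]
      simp
    simp only [hV]
    rw [lintegral_const_mul _ (by fun_prop), lintegral_add_left (by fun_prop),
      lintegral_add_left (by fun_prop), lintegral_add_left hvm, i1, i2]
    calc _ ≤ 4 * (ENNReal.ofReal (K * B) + ENNReal.ofReal (36 * A ^ 2 * ℓ ^ 2) +
          ENNReal.ofReal (18 * δ ^ 2 * ℓ ^ 2 * (d + 81 * A ^ 2 * ℓ ^ 2)) +
          ENNReal.ofReal (18 * δ ^ 2 * ℓ ^ 2 * (d + 81 * A ^ 2 * ℓ ^ 2))) := by gcongr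
      _ = _ := by
        rw [← ENNReal.ofReal_add (by positivity) (by positivity),
          ← ENNReal.ofReal_add (by positivity) (by positivity),
          ← ENNReal.ofReal_add (by positivity) (by positivity),
          show (4 : ℝ≥0∞) = ENNReal.ofReal 4 by simp, ← ENNReal.ofReal_mul (by positivity)]
        congr 1; ring
  -- Symmetrised bound with an independent copy `g'` of the noise. The difference splits into the
  -- centred fluctuation at a grid point, the linear term, and two discretisation errors; four terms
  -- give the factor 4 in `V`.
  have hpoint : ∀ w, (∀ i, ‖e i w‖ ≤ ℓ) → ∀ g g' : E, ∀ a : Fin 3 → ℝ, (∀ i, a i ∈ Set.Icc 0 A) →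
      ‖channelLog P e a (w, g) - channelLog P e a (w, g')‖ₑ ^ 2 ≤ V (w, (g, g')) := by
    intro w hw g g' a ha
    obtain ⟨a', ha', hδa⟩ := exists_mem_grid hδ ha
    have ha'A := hnetA a' ha'
    have o1 := abs_channelLog_sub_le he hℓ ha ha'A hδa hw g
    have o2 := abs_channelLog_sub_le he hℓ ha ha'A hδa hw g'
    set r := centredLogPartition P (combine e a') (combine e a' w) g' -
      centredLogPartition P (combine e a') (combine e a' w) g with hr
    set l := ⟪combine e a' w, g - g'⟫ with hl
    have hrl : channelLog P e a' (w, g) - channelLog P e a' (w, g') = -r + l := by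
      simp only [hr, hl, centredLogPartition, channelLog, inner_sub_right]
      ring
    have hl2 : l ^ 2 ≤ lin (w, (g, g')) := by
      have h1 : l = ∑ i, a' i * ⟪e i w, g - g'⟫ := by
        simp only [hl, combine, sum_inner, real_inner_smul_left]
      have h2 := sq_sum_le_card_mul_sum_sq (s := Finset.univ)
        (f := fun i => a' i * ⟪e i w, g - g'⟫)
      rw [← h1] at h2
      refine h2.trans ?_
      simp only [hlin, Finset.mul_sum]
      refine Finset.sum_le_sum fun i _ => ?_
      have h3 : a' i ^ 2 ≤ A ^ 2 := pow_le_pow_left₀ (ha'A i).1 (ha'A i).2 2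
      have := mul_le_mul_of_nonneg_right h3 (sq_nonneg ⟪e i w, g - g'⟫)
      simp only [Finset.card_univ, Fintype.card_fin, mul_pow]
      push_cast
      linarith
    set c := channelLog P e a (w, g) - channelLog P e a' (w, g) with hc
    set c' := channelLog P e a (w, g') - channelLog P e a' (w, g') with hc'
    have hsum : channelLog P e a (w, g) - channelLog P e a (w, g') = -r + l + c - c' := by
      rw [← hrl]; simp only [hc, hc']; ring
    have hc2 : c ^ 2 ≤ osc g := by
      rw [← sq_abs]; exact pow_le_pow_left₀ (abs_nonneg _) o1 2
    have hc2' : c' ^ 2 ≤ osc g' := by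
      rw [← sq_abs]; exact pow_le_pow_left₀ (abs_nonneg _) o2 2
    have hfin : (-r + l + c - c') ^ 2 ≤ 4 * (r ^ 2 + lin (w, (g, g')) + osc g + osc g') := by
      nlinarith [sq_nonneg (r + l), sq_nonneg (r + c), sq_nonneg (r - c'), sq_nonneg (l - c),
        sq_nonneg (l + c'), sq_nonneg (c + c')]
    have hur : ENNReal.ofReal (r ^ 2) ≤ v (w, (g, g')) := by
      have h1 : u a' (w, (g, g')) = ENNReal.ofReal (r ^ 2) := by
        have := enorm_pow_two_mul r 1
        rw [mul_one] at this
        rw [← this]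
      rw [← h1]
      exact Finset.le_sup (f := fun a => u a (w, (g, g'))) ha'
    have h1 := enorm_pow_two_mul (-r + l + c - c') 1
    rw [mul_one] at h1
    rw [hsum, h1]
    refine (ENNReal.ofReal_le_ofReal hfin).trans ?_
    rw [ENNReal.ofReal_mul (by norm_num),
      ENNReal.ofReal_add (add_nonneg (add_nonneg (sq_nonneg _) (hlin0 _)) (hosc0 _)) (hosc0 _),
      ENNReal.ofReal_add (add_nonneg (sq_nonneg _) (hlin0 _)) (hosc0 _),
      ENNReal.ofReal_add (sq_nonneg _) (hlin0 _)]
    simp only [hV, ENNReal.ofReal_ofNat]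
    gcongr
  have hVm' : Measurable fun q : Ω × E => ∫⁻ g', V (q.1, (q.2, g')) ∂γ :=
    Measurable.lintegral_prod_right' (f := fun q : (Ω × E) × E => V (q.1.1, (q.1.2, q.2)))
      (by fun_prop)
  have hSm' : Measurable fun w => ∫⁻ w', S (w, w') ∂P := hS.lintegral_prod_right'
  -- Integrating out the independent copies `g'` and `w'` turns the two symmetrised bounds into
  -- bounds on the deviations from the corresponding means, by Jensen's inequality.
  refine ⟨fun q => 2 * ∫⁻ g', V (q.1, (q.2, g')) ∂γ + 2 * ∫⁻ w', S (q.1, w') ∂P, by fun_prop, ?_, ?_⟩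
  · have hgood := Measure.quasiMeasurePreserving_fst (μ := P) (ν := γ) |>.ae (hℓ.and hS')
    filter_upwards [hgood] with ⟨w, g⟩ ⟨hw, hwS⟩ a ha
    have hint := integrable_channelLog he hℓ ha
    have e1 : ∫ q, channelLog P e a q ∂(P.prod γ) = ∫ w', ∫ g, channelLog P e a (w', g) ∂γ ∂P :=
      integral_prod _ hint
    set m := ∫ g, channelLog P e a (w, g) ∂γ with hm
    have b1 : ‖channelLog P e a (w, g) - m‖ₑ ^ 2 ≤ ∫⁻ g', V (w, (g, g')) ∂γ :=
      (enorm_integral_sub_sq_le (integrable_channelLog_right he hℓ ha w) _).trans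
        (lintegral_mono fun g' => hpoint w hw g g' a ha)
    have b2 : ‖m - ∫ q, channelLog P e a q ∂(P.prod γ)‖ₑ ^ 2 ≤ ∫⁻ w', S (w, w') ∂P := by
      rw [e1]
      refine (enorm_integral_sub_sq_le hint.integral_prod_left _).trans (lintegral_mono_ae ?_)
      filter_upwards [hwS] with w' hw'
      exact hw' a ha
    calc _ = ‖(channelLog P e a (w, g) - m) +
            (m - ∫ q, channelLog P e a q ∂(P.prod γ))‖ₑ ^ 2 := by rw [sub_add_sub_cancel]
      _ ≤ 2 * ‖channelLog P e a (w, g) - m‖ₑ ^ 2 +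
            2 * ‖m - ∫ q, channelLog P e a q ∂(P.prod γ)‖ₑ ^ 2 := by
          have h1 : ∀ x : ℝ, ‖x‖ₑ ^ 2 = ENNReal.ofReal (x ^ 2) := fun x => by
            simpa using enorm_pow_two_mul x 1
          rw [h1, h1, h1, show (2 : ℝ≥0∞) = ENNReal.ofReal 2 by simp,
            ← ENNReal.ofReal_mul (by positivity), ← ENNReal.ofReal_mul (by positivity),
            ← ENNReal.ofReal_add (by positivity) (by positivity)]
          refine ENNReal.ofReal_le_ofReal ?_
          nlinarith [sq_nonneg (channelLog P e a (w, g) - m -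
            (m - ∫ q, channelLog P e a q ∂(P.prod γ)))]
      _ ≤ _ := by gcongr
  · rw [lintegral_add_left (by fun_prop), lintegral_const_mul _ hVm',
      lintegral_const_mul _ (by fun_prop)]
    have i1 : ∫⁻ q : Ω × E, ∫⁻ g', V (q.1, (q.2, g')) ∂γ ∂(P.prod γ) =
        ∫⁻ y, V y ∂(P.prod (γ.prod γ)) := by
      rw [lintegral_prod _ hVm'.aemeasurable, lintegral_prod _ hVm.aemeasurable]
      refine lintegral_congr fun w => ?_
      rw [lintegral_prod _ (Measurable.aemeasurable (by fun_prop))]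
    have i2 : ∫⁻ q : Ω × E, ∫⁻ w', S (q.1, w') ∂P ∂(P.prod γ) = ∫⁻ w, ∫⁻ w', S (w, w') ∂P ∂P := by
      rw [lintegral_prod _ (Measurable.aemeasurable (by fun_prop))]
      simp
    rw [i1, i2]
    have hX : ∀ X : ℝ, 0 ≤ X → 2 * ENNReal.ofReal (4 * X) + 2 * ENNReal.ofReal σ =
        ENNReal.ofReal (8 * X + 2 * σ) := by
      intro X hX
      rw [show (2 : ℝ≥0∞) = ENNReal.ofReal 2 by simp,
        ← ENNReal.ofReal_mul (by positivity), ← ENNReal.ofReal_mul (by positivity),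
        ← ENNReal.ofReal_add (by positivity) (by positivity)]
      congr 1; ring
    exact (add_le_add (mul_le_mul_right hVint 2) (mul_le_mul_right hSσ 2)).trans_eq
      (hX _ (by positivity))

end Uniform


/-! ### The rank-one model as a Gaussian channel -/

section Model

variable {m n : ℕ}

/-- The indices of the observed entries. -/
abbrev NoiseIndex (m n : ℕ) : Type := (Fin m × Fin n) ⊕ (Fin m ⊕ Fin n)

/-- The Euclidean space of the observations. -/
abbrev NoiseSpace (m n : ℕ) : Type := EuclideanSpace ℝ (NoiseIndex m n)

/-- The noise `(W, U, V)` as one vector. -/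
def encode (η : (Fin m → Fin n → ℝ) × (Fin m → ℝ) × (Fin n → ℝ)) : NoiseSpace m n :=
  WithLp.toLp 2 (Sum.elim (fun q => η.1 q.1 q.2) (Sum.elim η.2.1 η.2.2))

lemma measurePreserving_uncurry (m n : ℕ) :
    MeasurePreserving (fun (W : Fin m → Fin n → ℝ) (q : Fin m × Fin n) => W q.1 q.2)
      (stdGaussMatrix m n) (Measure.pi fun _ : Fin m × Fin n => gaussianReal 0 1) := by
  have hm : Measurable fun (W : Fin m → Fin n → ℝ) (q : Fin m × Fin n) => W q.1 q.2 := by fun_prop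
  refine ⟨hm, (Measure.pi_eq fun s hs => ?_).symm⟩
  rw [Measure.map_apply hm (MeasurableSet.univ_pi hs)]
  have e : (fun (W : Fin m → Fin n → ℝ) (q : Fin m × Fin n) => W q.1 q.2) ⁻¹' (Set.univ.pi s) =
      Set.univ.pi fun i => Set.univ.pi fun j => s (i, j) := by
    ext W; simp
  rw [e, stdGaussMatrix]
  have : IsProbabilityMeasure (stdGauss n) := by unfold stdGauss; infer_instance
  rw [Measure.pi_pi]
  simp_rw [stdGauss, Measure.pi_pi]
  rw [Fintype.prod_prod_type]

instance (k : ℕ) : IsProbabilityMeasure (stdGauss k) := by unfold stdGauss; infer_instance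

instance (m n : ℕ) : IsProbabilityMeasure (stdGaussMatrix m n) := by
  unfold stdGaussMatrix; infer_instance

lemma measurePreserving_encode (m n : ℕ) :
    MeasurePreserving (encode (m := m) (n := n))
      ((stdGaussMatrix m n).prod ((stdGauss m).prod (stdGauss n))) (stdGaussian (NoiseSpace m n)) := by
  have h1 : MeasurePreserving (MeasurableEquiv.sumPiEquivProdPi fun _ : Fin m ⊕ Fin n => ℝ).symm
      ((stdGauss m).prod (stdGauss n)) (Measure.pi fun _ => gaussianReal 0 1) :=
    measurePreserving_sumPiEquivProdPi_symm fun _ : Fin m ⊕ Fin n => gaussianReal 0 1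
  have h2 := (measurePreserving_uncurry m n).prod h1
  have h3 : MeasurePreserving (MeasurableEquiv.sumPiEquivProdPi fun _ : NoiseIndex m n => ℝ).symm
      ((Measure.pi fun _ => gaussianReal 0 1).prod (Measure.pi fun _ => gaussianReal 0 1))
      (Measure.pi fun _ => gaussianReal 0 1) :=
    measurePreserving_sumPiEquivProdPi_symm fun _ : NoiseIndex m n => gaussianReal 0 1
  have h4 : MeasurePreserving (WithLp.toLp 2) (Measure.pi fun _ : NoiseIndex m n => gaussianReal 0 1)
      (stdGaussian (NoiseSpace m n)) := ⟨by fun_prop, map_pi_eq_stdGaussian⟩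
  convert! h4.comp (h3.comp h2) using 1

/-- The three components of the signal: `x yᵀ / √N`, `x` and `y`. -/
def component (m n : ℕ) : Fin 3 → Signal m n → NoiseSpace m n :=
  ![fun z => WithLp.toLp 2 (Sum.elim (fun q => z.1 q.1 * z.2 q.2 / √(size m n)) 0),
    fun z => WithLp.toLp 2 (Sum.elim 0 (Sum.elim z.1 0)),
    fun z => WithLp.toLp 2 (Sum.elim 0 (Sum.elim 0 z.2))]

lemma measurable_component (i : Fin 3) : Measurable (component m n i) := by
  have key : ∀ f : Signal m n → NoiseIndex m n → ℝ, (∀ k, Measurable fun z => f z k) →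
      Measurable fun z => (WithLp.toLp 2 (f z) : NoiseSpace m n) := by
    intro f hf
    have : Measurable f := measurable_pi_lambda _ hf
    fun_prop
  fin_cases i
  · refine key (fun z => Sum.elim (fun q => z.1 q.1 * z.2 q.2 / √(size m n)) 0) ?_
    rintro (q | q)
    · simp only [Sum.elim_inl]; fun_prop
    · simp only [Sum.elim_inr]; fun_prop
  · refine key (fun z => Sum.elim 0 (Sum.elim z.1 0)) ?_
    rintro (q | q | q)
    · simp only [Sum.elim_inl]; fun_prop
    · simp only [Sum.elim_inr, Sum.elim_inl]; fun_prop
    · simp only [Sum.elim_inr]; fun_prop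
  · refine key (fun z => Sum.elim 0 (Sum.elim 0 z.2)) ?_
    rintro (q | q | q)
    · simp only [Sum.elim_inl]; fun_prop
    · simp only [Sum.elim_inr, Sum.elim_inl]; fun_prop
    · simp only [Sum.elim_inr]; fun_prop

lemma size_nonneg (m n : ℕ) : 0 ≤ size m n := Real.sqrt_nonneg _

lemma combine_component (a : Fin 3 → ℝ) (z : Signal m n) :
    combine (component m n) a z = WithLp.toLp 2 (Sum.elim
      (fun q => a 0 * (z.1 q.1 * z.2 q.2 / √(size m n)))
      (Sum.elim (fun i => a 1 * z.1 i) (fun j => a 2 * z.2 j))) := by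
  ext k
  rcases k with q | i | j <;>
    simp [combine, component, Fin.sum_univ_three]

lemma noise_inner (f g : NoiseSpace m n) :
    ⟪f, g⟫ = ∑ i, ∑ j, f (.inl (i, j)) * g (.inl (i, j)) + (∑ i, f (.inr (.inl i)) * g (.inr (.inl i)) +
      ∑ j, f (.inr (.inr j)) * g (.inr (.inr j))) := by
  rw [PiLp.inner_apply, Fintype.sum_sum_type, Fintype.sum_sum_type, Fintype.sum_prod_type]
  simp [mul_comm]

/-- Expanding `⟪s z, g + s w⟫ - ‖s z‖² / 2` gives in each block the noise term, the planted term and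
the quadratic correction of the Hamiltonian. The square roots as channel amplitudes make the three
coefficients consistent, and nonnegative parameters are what allows squaring them back. -/
lemma hamiltonian_eq (ω : Disorder m n) {t h₁ h₂ : ℝ} (ht : 0 ≤ t) (hh₁ : 0 ≤ h₁) (hh₂ : 0 ≤ h₂)
    (z : Signal m n) :
    hamiltonian ω t h₁ h₂ z = gibbsExponent (combine (component m n) ![√(2 * t), √(2 * h₁), √(2 * h₂)])
      (encode ω.2 + combine (component m n) ![√(2 * t), √(2 * h₁), √(2 * h₂)] ω.1) z := by
  have hN := size_nonneg m n
  have s0 : √(2 * t / size m n) = √(2 * t) / √(size m n) := Real.sqrt_div (by positivity) _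
  have e0 : 2 * t / size m n = (√(2 * t) / √(size m n)) ^ 2 := by
    rw [div_pow, Real.sq_sqrt (by positivity), Real.sq_sqrt hN]
  have e1 : 2 * h₁ = √(2 * h₁) ^ 2 := (Real.sq_sqrt (by positivity)).symm
  have e2 : 2 * h₂ = √(2 * h₂) ^ 2 := (Real.sq_sqrt (by positivity)).symm
  have f0 : t / size m n = (√(2 * t) / √(size m n)) ^ 2 / 2 := by rw [← e0]; ring
  have f1 : h₁ = √(2 * h₁) ^ 2 / 2 := by rw [← e1]; ring
  have f2 : h₂ = √(2 * h₂) ^ 2 / 2 := by rw [← e2]; ring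
  rw [gibbsExponent, inner_add_right, ← real_inner_self_eq_norm_sq, noise_inner, noise_inner,
    noise_inner]
  simp only [combine_component, encode, Sum.elim_inl, Sum.elim_inr, Matrix.cons_val_zero,
    Matrix.cons_val_one, Matrix.cons_val, hamiltonian]
  set r := √(size m n)
  set a := √(2 * t)
  set b := √(2 * h₁)
  set c := √(2 * h₂)
  have w0 : ∀ F : Fin m → Fin n → ℝ, ∑ i, ∑ j, a * (z.1 i * z.2 j / r) * F i j =
      a / r * ∑ i, ∑ j, z.1 i * F i j * z.2 j := by
    intro F
    simp only [Finset.mul_sum]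
    exact Finset.sum_congr rfl fun i _ => Finset.sum_congr rfl fun j _ => by ring
  have w1 : ∑ i, ∑ j, z.1 i * (a * (ω.1.1 i * ω.1.2 j / r)) * z.2 j =
      a / r * ∑ i, ∑ j, z.1 i * z.2 j * (ω.1.1 i * ω.1.2 j) := by
    simp only [Finset.mul_sum]
    exact Finset.sum_congr rfl fun i _ => Finset.sum_congr rfl fun j _ => by ring
  have w2 : ∑ i, ∑ j, z.1 i * (a * (z.1 i * z.2 j / r)) * z.2 j =
      a / r * ∑ i, ∑ j, (z.1 i * z.2 j) ^ 2 := by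
    simp only [Finset.mul_sum]
    exact Finset.sum_congr rfl fun i _ => Finset.sum_congr rfl fun j _ => by ring
  have v0 : ∀ (k : ℕ) (c : ℝ) (x F : Fin k → ℝ), ∑ i, c * x i * F i = c * ∑ i, F i * x i := by
    intro k c x F
    rw [Finset.mul_sum]
    exact Finset.sum_congr rfl fun i _ => by ring
  have v1 : ∀ (k : ℕ) (c : ℝ) (x F : Fin k → ℝ),
      ∑ i, c * x i * (c * F i) = c * (c * ∑ i, F i * x i) := by
    intro k c x F
    simp only [Finset.mul_sum]
    exact Finset.sum_congr rfl fun i _ => by ring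
  have v2 : ∀ (k : ℕ) (c : ℝ) (x : Fin k → ℝ), ∑ i, c * x i * (c * x i) = c * (c * ∑ i, x i ^ 2) := by
    intro k c x
    simp only [Finset.mul_sum]
    exact Finset.sum_congr rfl fun i _ => by ring
  rw [w0, w0, w0, w1, w2, v0 _ b z.1 ω.2.2.1, v0 _ c z.2 ω.2.2.2, v1 _ b z.1 ω.1.1,
    v1 _ c z.2 ω.1.2, v2 _ b z.1, v2 _ c z.2, s0, e0, f0]
  linear_combination (∑ i, ω.1.1 i * z.1 i) * e1 + (∑ i, ω.1.2 i * z.2 i) * e2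
    - (∑ i, z.1 i ^ 2) * f1 - (∑ i, z.2 i ^ 2) * f2

lemma freeEnergy_eq (P : Measure (Signal m n)) (ω : Disorder m n) {t h₁ h₂ : ℝ} (ht : 0 ≤ t)
    (hh₁ : 0 ≤ h₁) (hh₂ : 0 ≤ h₂) :
    freeEnergy P ω t h₁ h₂ = 1 / size m n *
      channelLog P (component m n) ![√(2 * t), √(2 * h₁), √(2 * h₂)] (ω.1, encode ω.2) := by
  rw [freeEnergy, channelLog, logPartition]
  simp_rw [hamiltonian_eq ω ht hh₁ hh₂]

/-- Linear-algebra bound for differences of rank-one matrices tested against an operator. -/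
lemma abs_bilin_sub_le {F G : Type*} [NormedAddCommGroup F] [InnerProductSpace ℝ F]
    [NormedAddCommGroup G] [InnerProductSpace ℝ G] (T : G →L[ℝ] F) (x x' : F) (y y' : G) :
    |⟪x, T y⟫ - ⟪x', T y'⟫| ≤ √2 * ‖T‖ *
      √(‖x‖ ^ 2 * ‖y‖ ^ 2 + ‖x'‖ ^ 2 * ‖y'‖ ^ 2 - 2 * (⟪x, x'⟫ * ⟪y, y'⟫)) := by
  -- `c • x'` is the projection of `x` on the line of `x'`. Then `x yᵀ - x' y'ᵀ = (x - c x') yᵀ + x'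
  -- (c y - y')ᵀ` is a Frobenius-orthogonal sum of two rank-one matrices. The `√2` comes from `p + q
  -- ≤ √2 √(p² + q²)`.
  obtain ⟨c, hc⟩ : ∃ c : ℝ, c * ‖x'‖ ^ 2 = ⟪x, x'⟫ := by
    rcases eq_or_ne x' 0 with rfl | hx
    · exact ⟨0, by simp⟩
    · exact ⟨⟪x, x'⟫ / ‖x'‖ ^ 2, div_mul_cancel₀ _ (by positivity)⟩
  set p := ‖x - c • x'‖ * ‖y‖ with hp
  set q := ‖x'‖ * ‖c • y - y'‖ with hq
  have h1 : ⟪x, T y⟫ - ⟪x', T y'⟫ = ⟪x - c • x', T y⟫ + ⟪x', T (c • y - y')⟫ := by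
    rw [inner_sub_left, map_sub, inner_sub_right, map_smul, real_inner_smul_left,
      real_inner_smul_right]
    ring
  have h2 : |⟪x, T y⟫ - ⟪x', T y'⟫| ≤ ‖T‖ * (p + q) := by
    rw [h1]
    refine (abs_add_le _ _).trans ?_
    have i1 : |⟪x - c • x', T y⟫| ≤ ‖x - c • x'‖ * (‖T‖ * ‖y‖) :=
      (abs_real_inner_le_norm _ _).trans
        (mul_le_mul_of_nonneg_left (T.le_opNorm y) (norm_nonneg _))
    have i2 : |⟪x', T (c • y - y')⟫| ≤ ‖x'‖ * (‖T‖ * ‖c • y - y'‖) :=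
      (abs_real_inner_le_norm _ _).trans
        (mul_le_mul_of_nonneg_left (T.le_opNorm _) (norm_nonneg _))
    rw [hp, hq]
    linarith
  have h3 : ‖x‖ ^ 2 * ‖y‖ ^ 2 + ‖x'‖ ^ 2 * ‖y'‖ ^ 2 - 2 * (⟪x, x'⟫ * ⟪y, y'⟫) = p ^ 2 + q ^ 2 := by
    rw [hp, hq, mul_pow, mul_pow, norm_sub_sq_real, norm_sub_sq_real, norm_smul, norm_smul,
      mul_pow, mul_pow, real_inner_smul_left, real_inner_smul_right, ← hc, Real.norm_eq_abs, sq_abs]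
    ring
  rw [h3]
  have h4 : p + q ≤ √2 * √(p ^ 2 + q ^ 2) := by
    rw [← Real.sqrt_mul (by norm_num)]
    refine Real.le_sqrt_of_sq_le ?_
    nlinarith [sq_nonneg (p - q)]
  calc _ ≤ ‖T‖ * (p + q) := h2
    _ ≤ ‖T‖ * (√2 * √(p ^ 2 + q ^ 2)) := mul_le_mul_of_nonneg_left h4 (norm_nonneg _)
    _ = _ := by ring

/-- The operator with matrix `W`. -/
def noiseOp (m n : ℕ) :
    NoiseSpace m n →ₗ[ℝ] (EuclideanSpace ℝ (Fin n) →L[ℝ] EuclideanSpace ℝ (Fin m)) :=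
  (LinearMap.toContinuousLinearMap.toLinearMap ∘ₗ Matrix.toEuclideanLin.toLinearMap) ∘ₗ
    { toFun := fun g => Matrix.of fun i j => g (.inl (i, j))
      map_add' := fun _ _ => rfl
      map_smul' := fun _ _ => rfl }

lemma noiseOp_apply (g : NoiseSpace m n) (y : EuclideanSpace ℝ (Fin n)) (i : Fin m) :
    noiseOp m n g y i = ∑ j, g (.inl (i, j)) * y j := by
  simp [noiseOp, Matrix.mulVec, dotProduct]
  rfl

/-- The component `U` of the noise. -/
def noiseFst (g : NoiseSpace m n) : EuclideanSpace ℝ (Fin m) := WithLp.toLp 2 fun i => g (.inr (.inl i))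

/-- The component `V` of the noise. -/
def noiseSnd (g : NoiseSpace m n) : EuclideanSpace ℝ (Fin n) := WithLp.toLp 2 fun j => g (.inr (.inr j))

/-- A bound for the noise tested against normalized differences of signals. -/
def noiseNorm (g : NoiseSpace m n) : ℝ := √2 * ‖noiseOp m n g‖ + ‖noiseFst g‖ + ‖noiseSnd g‖

lemma noiseNorm_nonneg (g : NoiseSpace m n) : 0 ≤ noiseNorm g := by unfold noiseNorm; positivity

lemma measurable_noiseFst : Measurable (noiseFst (m := m) (n := n)) := by
  unfold noiseFst; fun_prop

lemma measurable_noiseSnd : Measurable (noiseSnd (m := m) (n := n)) := by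
  unfold noiseSnd; fun_prop

lemma measurable_norm_noiseOp : Measurable fun g => ‖noiseOp m n g‖ :=
  ((noiseOp m n).continuous_of_finiteDimensional.norm).measurable

lemma measurable_noiseNorm : Measurable (noiseNorm (m := m) (n := n)) := by
  have h1 := measurable_norm_noiseOp (m := m) (n := n)
  have h2 := measurable_noiseFst (m := m) (n := n)
  have h3 := measurable_noiseSnd (m := m) (n := n)
  unfold noiseNorm
  fun_prop

/-- The matrix block of a difference of signals has rank at most two, so testing it against `W`
costs the operator norm of `W`, of order `√m + √n`. Cauchy–Schwarz on that block would cost the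
Frobenius norm, of order `√(mn)`. The two vector blocks are handled by Cauchy–Schwarz. -/
lemma abs_inner_combine_sub_le (a : Fin 3 → ℝ) (g : NoiseSpace m n) (w z : Signal m n) :
    |⟪combine (component m n) a w - combine (component m n) a z, g⟫| ≤
      ‖combine (component m n) a w - combine (component m n) a z‖ * noiseNorm g := by
  set Δ := combine (component m n) a w - combine (component m n) a z with hΔ
  have hex : ∀ u : Signal m n, ∃ x : EuclideanSpace ℝ (Fin m), ∃ y : EuclideanSpace ℝ (Fin n),
      (∀ i, x i = u.1 i) ∧ ∀ j, y j = u.2 j := fun u => ⟨WithLp.toLp 2 u.1, WithLp.toLp 2 u.2, by simp⟩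
  obtain ⟨x, y, hx, hy⟩ := hex w
  obtain ⟨x', y', hx', hy'⟩ := hex z
  set c := a 0 / √(size m n) with hc
  have d0 : ∀ i j, Δ (.inl (i, j)) = c * (x i * y j - x' i * y' j) := by
    intro i j
    simp only [hΔ, combine_component, PiLp.sub_apply, Sum.elim_inl, hc, hx, hy, hx', hy']
    ring
  have d1 : noiseFst Δ = a 1 • (x - x') := by
    ext i
    simp [noiseFst, hΔ, combine_component, hx, hx', mul_sub]
  have d2 : noiseSnd Δ = a 2 • (y - y') := by
    ext i
    simp [noiseSnd, hΔ, combine_component, hy, hy', mul_sub]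
  have hin : ∀ f g : NoiseSpace m n, ⟪f, g⟫ = ∑ i, ∑ j, f (.inl (i, j)) * g (.inl (i, j)) +
      (⟪noiseFst f, noiseFst g⟫ + ⟪noiseSnd f, noiseSnd g⟫) := by
    intro f g
    rw [noise_inner, PiLp.inner_apply, PiLp.inner_apply]
    simp [noiseFst, noiseSnd, mul_comm]
  set ρ := ‖x‖ ^ 2 * ‖y‖ ^ 2 + ‖x'‖ ^ 2 * ‖y'‖ ^ 2 - 2 * (⟪x, x'⟫ * ⟪y, y'⟫) with hρ
  have hW1 : ∑ i, ∑ j, Δ (.inl (i, j)) * Δ (.inl (i, j)) = c ^ 2 * ρ := by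
    have hsq : ∀ (x x' : EuclideanSpace ℝ (Fin m)) (y y' : EuclideanSpace ℝ (Fin n)),
        ∑ i, ∑ j, (x i * x' i) * (y j * y' j) = ⟪x, x'⟫ * ⟪y, y'⟫ := by
      intro x x' y y'
      rw [PiLp.inner_apply, PiLp.inner_apply, Finset.sum_mul_sum]
      simp [mul_comm]
    rw [hρ, ← real_inner_self_eq_norm_sq, ← real_inner_self_eq_norm_sq,
      ← real_inner_self_eq_norm_sq, ← real_inner_self_eq_norm_sq, ← hsq, ← hsq, ← hsq]
    simp only [Finset.mul_sum, ← Finset.sum_add_distrib, ← Finset.sum_sub_distrib]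
    refine Finset.sum_congr rfl fun i _ => Finset.sum_congr rfl fun j _ => ?_
    rw [d0]; ring
  have hW2 : ∑ i, ∑ j, Δ (.inl (i, j)) * g (.inl (i, j)) =
      c * (⟪x, noiseOp m n g y⟫ - ⟪x', noiseOp m n g y'⟫) := by
    have hb : ∀ (x : EuclideanSpace ℝ (Fin m)) (y : EuclideanSpace ℝ (Fin n)),
        ⟪x, noiseOp m n g y⟫ = ∑ i, ∑ j, (x i * y j) * g (.inl (i, j)) := by
      intro x y
      rw [PiLp.inner_apply]
      simp only [noiseOp_apply, Real.inner_apply, Finset.mul_sum]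
      refine Finset.sum_congr rfl fun i _ => Finset.sum_congr rfl fun j _ => by ring
    rw [hb, hb]
    simp only [Finset.mul_sum, ← Finset.sum_sub_distrib]
    refine Finset.sum_congr rfl fun i _ => Finset.sum_congr rfl fun j _ => ?_
    rw [d0]; ring
  have hn : ‖Δ‖ ^ 2 = c ^ 2 * ρ + (‖noiseFst Δ‖ ^ 2 + ‖noiseSnd Δ‖ ^ 2) := by
    rw [← real_inner_self_eq_norm_sq, hin, hW1, real_inner_self_eq_norm_sq,
      real_inner_self_eq_norm_sq]
  have hcρ : 0 ≤ c ^ 2 * ρ := by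
    rw [← hW1]; exact Finset.sum_nonneg fun i _ => Finset.sum_nonneg fun j _ => mul_self_nonneg _
  have n0 : |c| * √ρ ≤ ‖Δ‖ := by
    rw [← Real.sqrt_sq_eq_abs, ← Real.sqrt_mul (sq_nonneg c)]
    refine (Real.sqrt_le_left (norm_nonneg _)).2 ?_
    rw [hn]; nlinarith [sq_nonneg ‖noiseFst Δ‖, sq_nonneg ‖noiseSnd Δ‖]
  have n1 : ‖noiseFst Δ‖ ≤ ‖Δ‖ := by
    refine (pow_le_pow_iff_left₀ (norm_nonneg _) (norm_nonneg _) two_ne_zero).1 ?_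
    rw [hn]; nlinarith [sq_nonneg ‖noiseSnd Δ‖]
  have n2 : ‖noiseSnd Δ‖ ≤ ‖Δ‖ := by
    refine (pow_le_pow_iff_left₀ (norm_nonneg _) (norm_nonneg _) two_ne_zero).1 ?_
    rw [hn]; nlinarith [sq_nonneg ‖noiseFst Δ‖]
  rw [hin, hW2]
  have b0 : |c * (⟪x, noiseOp m n g y⟫ - ⟪x', noiseOp m n g y'⟫)| ≤
      ‖Δ‖ * (√2 * ‖noiseOp m n g‖) := by
    rw [abs_mul]
    calc _ ≤ |c| * (√2 * ‖noiseOp m n g‖ * √ρ) :=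
          mul_le_mul_of_nonneg_left (abs_bilin_sub_le _ x x' y y') (abs_nonneg c)
      _ = (|c| * √ρ) * (√2 * ‖noiseOp m n g‖) := by ring
      _ ≤ _ := mul_le_mul_of_nonneg_right n0 (by positivity)
  have b1 : |⟪noiseFst Δ, noiseFst g⟫| ≤ ‖Δ‖ * ‖noiseFst g‖ :=
    (abs_real_inner_le_norm _ _).trans (mul_le_mul_of_nonneg_right n1 (norm_nonneg _))
  have b2 : |⟪noiseSnd Δ, noiseSnd g⟫| ≤ ‖Δ‖ * ‖noiseSnd g‖ :=
    (abs_real_inner_le_norm _ _).trans (mul_le_mul_of_nonneg_right n2 (norm_nonneg _))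
  refine (abs_add_le _ _).trans ?_
  refine (add_le_add b0 ((abs_add_le _ _).trans (add_le_add b1 b2))).trans ?_
  unfold noiseNorm
  linarith

end Model


/-! ### Moments of the noise norm -/

section NoiseMoments

/-- Integer points whose rescaling by `1 / (2√n)` lies in the unit ball. -/
def latticeBall (n : ℕ) : Finset (Fin n → ℤ) :=
  (Fintype.piFinset fun _ => Finset.Icc (-(2 * n : ℤ)) (2 * n)).filter
    fun k => ∑ i, (k i) ^ 2 ≤ 4 * (n : ℤ)

/-- The rescaling of an integer vector by `1 / (2√n)`. -/
def latticePoint {n : ℕ} (k : Fin n → ℤ) : EuclideanSpace ℝ (Fin n) :=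
  WithLp.toLp 2 fun i => (k i : ℝ) / (2 * √n)

lemma sum_half_pow_natAbs_le (L : ℕ) :
    ∑ j ∈ Finset.Icc (-(L : ℤ)) L, ((1 : ℝ) / 2) ^ j.natAbs ≤ 3 - 2 * (1 / 2) ^ L := by
  induction L with
  | zero => norm_num
  | succ L ih =>
    have h : Finset.Icc (-((L + 1 : ℕ) : ℤ)) ((L + 1 : ℕ) : ℤ) =
        insert ((L + 1 : ℕ) : ℤ) (insert (-((L + 1 : ℕ) : ℤ)) (Finset.Icc (-(L : ℤ)) L)) := by
      ext j
      simp only [Finset.mem_insert, Finset.mem_Icc]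
      push_cast
      omega
    rw [h, Finset.sum_insert, Finset.sum_insert, Int.natAbs_neg, Int.natAbs_natCast]
    · rw [pow_succ]; linarith
    · simp
    · simp only [Finset.mem_insert, Finset.mem_Icc]; push_cast; omega

/-- For integers `|k| ≤ k²`, so each point has `ℓ¹` norm at most `4n` and weight `2 ^ (-‖k‖₁) ≥ 16 ^
(-n)`. The total weight factorises over coordinates, each factor being at most 3, whence `48 = 16 *
3`. -/
lemma card_latticeBall_le (n : ℕ) : ((latticeBall n).card : ℝ) ≤ 48 ^ n := by
  have h1 : ∀ k ∈ latticeBall n, (1 : ℝ) ≤ 16 ^ n * ∏ i, (1 / 2) ^ (k i).natAbs := by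
    intro k hk
    have h2 : ∑ i, (k i) ^ 2 ≤ 4 * (n : ℤ) := (Finset.mem_filter.1 hk).2
    have h3 : ∑ i, (k i).natAbs ≤ 4 * n := by
      have : ∑ i, ((k i).natAbs : ℤ) ≤ ∑ i, (k i) ^ 2 := by
        refine Finset.sum_le_sum fun i _ => ?_
        rw [← Int.natAbs_sq]
        exact_mod_cast Nat.le_self_pow two_ne_zero _
      have := this.trans h2
      exact_mod_cast this
    rw [Finset.prod_pow_eq_pow_sum, show (16 : ℝ) ^ n = 2 ^ (4 * n) by rw [pow_mul]; norm_num]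
    calc (1 : ℝ) = 2 ^ (4 * n) * (1 / 2) ^ (4 * n) := by rw [← mul_pow]; norm_num
      _ ≤ _ := mul_le_mul_of_nonneg_left
          (pow_le_pow_of_le_one (by norm_num) (by norm_num) h3) (by positivity)
  calc ((latticeBall n).card : ℝ) = ∑ _k ∈ latticeBall n, (1 : ℝ) := by simp
    _ ≤ ∑ k ∈ latticeBall n, 16 ^ n * ∏ i, ((1 : ℝ) / 2) ^ (k i).natAbs := Finset.sum_le_sum h1
    _ ≤ ∑ k ∈ Fintype.piFinset fun _ : Fin n => Finset.Icc (-(2 * n : ℤ)) (2 * n),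
          16 ^ n * ∏ i, ((1 : ℝ) / 2) ^ (k i).natAbs :=
        Finset.sum_le_sum_of_subset_of_nonneg (Finset.filter_subset _ _)
          fun _ _ _ => by positivity
    _ = 16 ^ n * ∏ _i : Fin n, ∑ j ∈ Finset.Icc (-(2 * n : ℤ)) (2 * n), ((1 : ℝ) / 2) ^ j.natAbs := by
        rw [← Finset.mul_sum, Finset.prod_univ_sum]
    _ ≤ 16 ^ n * ∏ _i : Fin n, (3 : ℝ) := by
        refine mul_le_mul_of_nonneg_left (Finset.prod_le_prod (fun _ _ => by positivity)
          fun _ _ => ?_) (by positivity)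
        have := sum_half_pow_natAbs_le (2 * n)
        push_cast at this
        have h0 : (0 : ℝ) ≤ (1 / 2) ^ (2 * n) := by positivity
        linarith
    _ = 48 ^ n := by simp [← mul_pow]; norm_num

/-- Rounding toward zero never increases absolute values, so rounded points of the unit ball remain
in the lattice ball. -/
lemma exists_int_trunc (y : ℝ) : ∃ k : ℤ, |y - k| ≤ 1 ∧ |(k : ℝ)| ≤ |y| := by
  rcases le_total 0 y with h | h
  · have h1 := Int.floor_le y
    have h2 := Int.lt_floor_add_one y
    have h3 : (0 : ℝ) ≤ ⌊y⌋ := by exact_mod_cast Int.floor_nonneg.2 h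
    refine ⟨⌊y⌋, ?_, ?_⟩
    · rw [abs_le]; constructor <;> linarith
    · rwa [abs_of_nonneg h3, abs_of_nonneg h]
  · have h1 := Int.le_ceil y
    have h2 := Int.ceil_lt_add_one y
    have h3 : (⌈y⌉ : ℝ) ≤ 0 := by exact_mod_cast Int.ceil_nonpos.2 h
    refine ⟨⌈y⌉, ?_, ?_⟩
    · rw [abs_le]; constructor <;> linarith
    · rw [abs_of_nonpos h3, abs_of_nonpos h]; linarith

lemma norm_latticePoint_le {n : ℕ} {k : Fin n → ℤ} (hk : k ∈ latticeBall n) :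
    ‖latticePoint k‖ ≤ 1 := by
  rcases Nat.eq_zero_or_pos n with rfl | hn
  · simp [latticePoint, EuclideanSpace.norm_eq]
  have hn' : (0 : ℝ) < n := by exact_mod_cast hn
  have h2 : ∑ i, (k i) ^ 2 ≤ 4 * (n : ℤ) := (Finset.mem_filter.1 hk).2
  have h3 : ∑ i, ((k i : ℝ)) ^ 2 ≤ 4 * n := by exact_mod_cast h2
  rw [← abs_norm, ← sq_le_one_iff_abs_le_one, EuclideanSpace.real_norm_sq_eq]
  simp only [latticePoint, div_pow, mul_pow, Real.sq_sqrt hn'.le]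
  rw [← Finset.sum_div, div_le_one (by positivity)]
  linarith

/-- Truncating `2√n x` moves each coordinate by at most 1, hence each coordinate of `x` by at most
`1 / (2√n)` and the vector by at most `1 / 2`. -/
lemma exists_latticePoint {n : ℕ} (x : EuclideanSpace ℝ (Fin n)) (hx : ‖x‖ ≤ 1) :
    ∃ k ∈ latticeBall n, ‖x - latticePoint k‖ ≤ 1 / 2 := by
  rcases Nat.eq_zero_or_pos n with rfl | hn
  · exact ⟨0, by simp [latticeBall, eq_iff_true_of_subsingleton], by simp [EuclideanSpace.norm_eq]⟩
  have hn' : (0 : ℝ) < n := by exact_mod_cast hn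
  have hs : 0 < √(n : ℝ) := Real.sqrt_pos.2 hn'
  choose k hk1 hk2 using fun i => exists_int_trunc (2 * √n * x i)
  have hx2 : ∑ i, x i ^ 2 ≤ 1 := by
    rw [← EuclideanSpace.real_norm_sq_eq]
    exact pow_le_one₀ (norm_nonneg _) hx
  have hsum : ∑ i, (k i) ^ 2 ≤ 4 * (n : ℤ) := by
    have : ∑ i, (k i : ℝ) ^ 2 ≤ 4 * n := by
      calc ∑ i, (k i : ℝ) ^ 2 ≤ ∑ i, 4 * n * x i ^ 2 := by
            refine Finset.sum_le_sum fun i _ => ?_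
            have := pow_le_pow_left₀ (abs_nonneg _) (hk2 i) 2
            rw [sq_abs, sq_abs, mul_pow, mul_pow, Real.sq_sqrt hn'.le] at this
            linarith
        _ ≤ 4 * n := by
            rw [← Finset.mul_sum]
            exact mul_le_of_le_one_right (by positivity) hx2
    exact_mod_cast this
  refine ⟨k, Finset.mem_filter.2 ⟨?_, hsum⟩, ?_⟩
  · rw [Fintype.mem_piFinset]
    intro i
    have h1 : (k i) ^ 2 ≤ 4 * (n : ℤ) :=
      (Finset.single_le_sum (f := fun i => (k i) ^ 2) (fun _ _ => sq_nonneg _)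
        (Finset.mem_univ i)).trans hsum
    have hn1 : (1 : ℤ) ≤ n := by exact_mod_cast hn
    have h2 : (k i) ^ 2 ≤ (2 * (n : ℤ)) ^ 2 := h1.trans (by nlinarith)
    have := abs_le_of_sq_le_sq' h2 (by positivity)
    exact Finset.mem_Icc.2 this
  · refine (pow_le_pow_iff_left₀ (norm_nonneg _) (by norm_num) two_ne_zero).1 ?_
    rw [EuclideanSpace.real_norm_sq_eq]
    calc ∑ i, (x - latticePoint k) i ^ 2 ≤ ∑ _i : Fin n, 1 / (4 * (n : ℝ)) := by
          refine Finset.sum_le_sum fun i _ => ?_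
          have h1 : (x - latticePoint k) i = (2 * √n * x i - k i) / (2 * √n) := by
            simp only [latticePoint, PiLp.sub_apply]
            field_simp
          rw [h1, div_pow, mul_pow, Real.sq_sqrt hn'.le, ← sq_abs]
          have := pow_le_one₀ (n := 2) (abs_nonneg _) (hk1 i)
          rw [show (2 : ℝ) ^ 2 = 4 by norm_num]
          exact div_le_div_of_nonneg_right this (by positivity)
      _ = (1 / 2) ^ 2 := by
          simp only [Finset.sum_const, Finset.card_univ, Fintype.card_fin, nsmul_eq_mul]
          field_simp; norm_num

/-- The usual net argument: passing from a unit vector to the nearest lattice point loses at most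
half of the operator norm, so the maximum over the net carries the other half. -/
lemma exists_opNorm_le {n : ℕ} {F : Type*} [NormedAddCommGroup F] [NormedSpace ℝ F]
    (T : EuclideanSpace ℝ (Fin n) →L[ℝ] F) :
    ∃ k ∈ latticeBall n, ‖T‖ ≤ 2 * ‖T (latticePoint k)‖ := by
  have hne : (latticeBall n).Nonempty := by
    obtain ⟨k, hk, _⟩ := exists_latticePoint (0 : EuclideanSpace ℝ (Fin n)) (by simp)
    exact ⟨k, hk⟩
  obtain ⟨k, hk, hmax⟩ := Finset.exists_max_image (latticeBall n)
    (fun k => ‖T (latticePoint k)‖) hne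
  refine ⟨k, hk, ?_⟩
  have h : ‖T‖ ≤ ‖T (latticePoint k)‖ + ‖T‖ / 2 := by
    refine T.opNorm_le_of_unit_norm (by positivity) fun x hx => ?_
    obtain ⟨l, hl, hxl⟩ := exists_latticePoint x hx.le
    calc ‖T x‖ = ‖T (latticePoint l) + T (x - latticePoint l)‖ := by rw [← map_add]; simp
      _ ≤ ‖T (latticePoint l)‖ + ‖T‖ * ‖x - latticePoint l‖ :=
          (norm_add_le _ _).trans (add_le_add_right (T.le_opNorm _) _)
      _ ≤ _ := by
          have := mul_le_mul_of_nonneg_left hxl (norm_nonneg T)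
          linarith [hmax l hl]
  linarith

variable {m n : ℕ}

lemma lintegral_exp_norm_sq_of_map {E : Type*} [NormedAddCommGroup E] [InnerProductSpace ℝ E]
    [FiniteDimensional ℝ E] [MeasurableSpace E] [BorelSpace E] {k : ℕ}
    {L : E → EuclideanSpace ℝ (Fin k)} (hL : Measurable L)
    (h : (stdGaussian E).map L = stdGaussian (EuclideanSpace ℝ (Fin k))) :
    ∫⁻ g, ENNReal.ofReal (Real.exp (‖L g‖ ^ 2 / 4)) ∂(stdGaussian E) = ENNReal.ofReal √2 ^ k := by
  have h2 := lintegral_stdGaussian_exp_norm_sq (Fin k)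
  rw [← h, lintegral_map (by fun_prop) hL, Fintype.card_fin] at h2
  exact h2

lemma stdGaussian_map_noiseFst :
    (stdGaussian (NoiseSpace m n)).map noiseFst = stdGaussian (EuclideanSpace ℝ (Fin m)) := by
  refine stdGaussian_map_of_adjoint _ measurable_noiseFst
    (fun t => WithLp.toLp 2 (Sum.elim 0 (Sum.elim t 0))) (fun x t => ?_) (fun t => ?_)
  · rw [noise_inner, PiLp.inner_apply]
    simp [noiseFst, mul_comm]
  · simp [EuclideanSpace.norm_eq, Fintype.sum_sum_type]

lemma stdGaussian_map_noiseSnd :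
    (stdGaussian (NoiseSpace m n)).map noiseSnd = stdGaussian (EuclideanSpace ℝ (Fin n)) := by
  refine stdGaussian_map_of_adjoint _ measurable_noiseSnd
    (fun t => WithLp.toLp 2 (Sum.elim 0 (Sum.elim 0 t))) (fun x t => ?_) (fun t => ?_)
  · rw [noise_inner, PiLp.inner_apply]
    simp [noiseSnd, mul_comm]
  · simp [EuclideanSpace.norm_eq, Fintype.sum_sum_type]

lemma measurable_noiseOp_apply (v : EuclideanSpace ℝ (Fin n)) :
    Measurable fun g => noiseOp m n g v :=
  ((ContinuousLinearMap.apply ℝ (EuclideanSpace ℝ (Fin m)) v).continuous.comp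
    (noiseOp m n).continuous_of_finiteDimensional).measurable

/-- The adjoint of `g ↦ W v` sends `t` to the rank-one matrix `t vᵀ`, of Frobenius norm `‖t‖` when
`v` is a unit vector. -/
lemma stdGaussian_map_noiseOp (v : EuclideanSpace ℝ (Fin n)) (hv : ‖v‖ = 1) :
    (stdGaussian (NoiseSpace m n)).map (fun g => noiseOp m n g v) =
      stdGaussian (EuclideanSpace ℝ (Fin m)) := by
  refine stdGaussian_map_of_adjoint _ (measurable_noiseOp_apply v)
    (fun t => WithLp.toLp 2 (Sum.elim (fun q => t q.1 * v q.2) 0)) (fun x t => ?_) (fun t => ?_)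
  · rw [noise_inner, PiLp.inner_apply]
    simp only [noiseOp_apply, Sum.elim_inl, Sum.elim_inr, Pi.zero_apply, mul_zero,
      Finset.sum_const_zero, add_zero, Real.inner_apply, Finset.sum_mul]
    exact Finset.sum_congr rfl fun i _ => Finset.sum_congr rfl fun j _ => by ring
  · refine (pow_left_inj₀ (norm_nonneg _) (norm_nonneg _) two_ne_zero).1 ?_
    have hv2 : ∑ j, v j ^ 2 = 1 := by rw [← EuclideanSpace.real_norm_sq_eq, hv, one_pow]
    rw [EuclideanSpace.real_norm_sq_eq, EuclideanSpace.real_norm_sq_eq, Fintype.sum_sum_type,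
      Fintype.sum_prod_type]
    simp [mul_pow, ← Finset.mul_sum, hv2]

lemma lintegral_exp_noiseOp_apply_le {v : EuclideanSpace ℝ (Fin n)} (hv : ‖v‖ ≤ 1) :
    ∫⁻ g, ENNReal.ofReal (Real.exp (‖noiseOp m n g v‖ ^ 2 / 4)) ∂(stdGaussian (NoiseSpace m n)) ≤
      ENNReal.ofReal √2 ^ m := by
  rcases eq_or_ne v 0 with rfl | hv0
  · simp only [map_zero, norm_zero, ne_eq, OfNat.ofNat_ne_zero, not_false_eq_true, zero_pow,
      zero_div, Real.exp_zero, ENNReal.ofReal_one, lintegral_const, measure_univ, mul_one]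
    exact one_le_pow₀ (by simp [Real.one_le_sqrt])
  · set u := (‖v‖⁻¹ : ℝ) • v with hu
    have hu1 : ‖u‖ = 1 := by
      rw [hu, norm_smul, norm_inv, norm_norm, inv_mul_cancel₀ (norm_ne_zero_iff.2 hv0)]
    rw [← lintegral_exp_norm_sq_of_map (measurable_noiseOp_apply u) (stdGaussian_map_noiseOp u hu1)]
    refine lintegral_mono fun g => ENNReal.ofReal_le_ofReal (Real.exp_le_exp.2 ?_)
    have hvu : v = ‖v‖ • u := by
      rw [hu, smul_smul, mul_inv_cancel₀ (norm_ne_zero_iff.2 hv0), one_smul]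
    have : ‖noiseOp m n g v‖ ≤ ‖noiseOp m n g u‖ := by
      conv_lhs => rw [hvu, map_smul, norm_smul, norm_norm]
      exact mul_le_of_le_one_left (norm_nonneg _) hv
    gcongr

/-- A union bound in exponential form: the largest exponential is at most the sum over the net plus
those of `U` and `V`. The `48 ^ n` net points cost at most `exp (4 n)`, comparable to the Gaussian
moments themselves. The squared noise norm is at most 30 times the largest of the three squares
involved, so dividing by 288 leaves room under the exponent `1 / 4`. -/
lemma lintegral_exp_noiseNorm_le (hmn : 1 ≤ m + n) :
    ∫⁻ g, ENNReal.ofReal (Real.exp (noiseNorm g ^ 2 / 288)) ∂(stdGaussian (NoiseSpace m n)) ≤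
      ENNReal.ofReal (Real.exp (6 * (m + n))) := by
  have hpt : ∀ g : NoiseSpace m n, Real.exp (noiseNorm g ^ 2 / 288) ≤
      ∑ k ∈ latticeBall n, Real.exp (‖noiseOp m n g (latticePoint k)‖ ^ 2 / 4) +
        (Real.exp (‖noiseFst g‖ ^ 2 / 4) + Real.exp (‖noiseSnd g‖ ^ 2 / 4)) := by
    intro g
    obtain ⟨k, hk, hle⟩ := exists_opNorm_le (noiseOp m n g)
    have h1 : Real.exp (‖noiseOp m n g (latticePoint k)‖ ^ 2 / 4) ≤
        ∑ k ∈ latticeBall n, Real.exp (‖noiseOp m n g (latticePoint k)‖ ^ 2 / 4) :=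
      Finset.single_le_sum (f := fun k => Real.exp (‖noiseOp m n g (latticePoint k)‖ ^ 2 / 4))
        (fun _ _ => (Real.exp_pos _).le) hk
    set α := ‖noiseOp m n g (latticePoint k)‖
    set β := ‖noiseFst g‖ with hβ
    set τ := ‖noiseSnd g‖ with hτ
    have hα0 : 0 ≤ α := norm_nonneg _
    have hβ0 : 0 ≤ β := norm_nonneg _
    have hτ0 : 0 ≤ τ := norm_nonneg _
    have hT : noiseNorm g ≤ √2 * (2 * α) + β + τ := by
      unfold noiseNorm
      have := mul_le_mul_of_nonneg_left hle (Real.sqrt_nonneg 2)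
      linarith
    have hT2 : noiseNorm g ^ 2 ≤ 3 * (8 * α ^ 2 + β ^ 2 + τ ^ 2) := by
      refine (pow_le_pow_left₀ (noiseNorm_nonneg g) hT 2).trans ?_
      have h2 : √2 ^ 2 = (2 : ℝ) := Real.sq_sqrt (by norm_num)
      nlinarith [sq_nonneg (√2 * (2 * α) - β), sq_nonneg (√2 * (2 * α) - τ), sq_nonneg (β - τ)]
    have e1 := Real.exp_pos (α ^ 2 / 4)
    have e2 := Real.exp_pos (β ^ 2 / 4)
    have e3 := Real.exp_pos (τ ^ 2 / 4)
    rcases le_total (α ^ 2) (β ^ 2) with h | h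
    · rcases le_total (β ^ 2) (τ ^ 2) with h' | h'
      · have := Real.exp_le_exp.2 (show noiseNorm g ^ 2 / 288 ≤ τ ^ 2 / 4 by nlinarith)
        linarith
      · have := Real.exp_le_exp.2 (show noiseNorm g ^ 2 / 288 ≤ β ^ 2 / 4 by nlinarith)
        linarith
    · rcases le_total (α ^ 2) (τ ^ 2) with h' | h'
      · have := Real.exp_le_exp.2 (show noiseNorm g ^ 2 / 288 ≤ τ ^ 2 / 4 by nlinarith)
        linarith
      · have := Real.exp_le_exp.2 (show noiseNorm g ^ 2 / 288 ≤ α ^ 2 / 4 by nlinarith)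
        linarith
  have hm1 := measurable_noiseFst (m := m) (n := n)
  have hm2 := measurable_noiseSnd (m := m) (n := n)
  have hm3 := fun v => measurable_noiseOp_apply (m := m) (n := n) v
  have hs2 : √2 ≤ Real.exp 1 := by
    have h1 : √2 ≤ 2 := by rw [Real.sqrt_le_left (by norm_num)]; norm_num
    linarith [Real.add_one_le_exp (1 : ℝ)]
  calc _ ≤ ∫⁻ g, (∑ k ∈ latticeBall n,
            ENNReal.ofReal (Real.exp (‖noiseOp m n g (latticePoint k)‖ ^ 2 / 4)) +
          (ENNReal.ofReal (Real.exp (‖noiseFst g‖ ^ 2 / 4)) +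
            ENNReal.ofReal (Real.exp (‖noiseSnd g‖ ^ 2 / 4)))) ∂(stdGaussian (NoiseSpace m n)) := by
        refine lintegral_mono fun g => (ENNReal.ofReal_le_ofReal (hpt g)).trans_eq ?_
        rw [ENNReal.ofReal_add (Finset.sum_nonneg fun _ _ => (Real.exp_pos _).le) (by positivity),
          ENNReal.ofReal_add (by positivity) (by positivity),
          ENNReal.ofReal_sum_of_nonneg fun _ _ => (Real.exp_pos _).le]
    _ ≤ (latticeBall n).card * ENNReal.ofReal √2 ^ m +
          (ENNReal.ofReal √2 ^ m + ENNReal.ofReal √2 ^ n) := by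
        rw [lintegral_add_right _ (by fun_prop), lintegral_add_left (by fun_prop),
          lintegral_exp_norm_sq_of_map hm1 stdGaussian_map_noiseFst,
          lintegral_exp_norm_sq_of_map hm2 stdGaussian_map_noiseSnd,
          lintegral_finsetSum _ fun k _ => by have := hm3 (latticePoint k); fun_prop]
        refine add_le_add_left ((Finset.sum_le_sum fun k hk =>
          lintegral_exp_noiseOp_apply_le (norm_latticePoint_le hk)).trans_eq ?_) _
        simp
    _ = ENNReal.ofReal ((latticeBall n).card * √2 ^ m + (√2 ^ m + √2 ^ n)) := by
        rw [ENNReal.ofReal_add (by positivity) (by positivity),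
          ENNReal.ofReal_add (by positivity) (by positivity), ENNReal.ofReal_mul (by positivity),
          ENNReal.ofReal_pow (by positivity), ENNReal.ofReal_pow (by positivity),
          ENNReal.ofReal_natCast]
    _ ≤ _ := by
        refine ENNReal.ofReal_le_ofReal ?_
        have c1 : ((latticeBall n).card : ℝ) ≤ Real.exp (4 * n) := by
          refine (card_latticeBall_le n).trans ?_
          rw [show (4 * n : ℝ) = n * 4 by ring, Real.exp_nat_mul]
          refine pow_le_pow_left₀ (by norm_num) ?_ n
          have h1 : (2.7 : ℝ) ≤ Real.exp 1 := by linarith [Real.exp_one_gt_d9]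
          have h2 : Real.exp 4 = Real.exp 1 ^ 4 := by rw [← Real.exp_nat_mul]; norm_num
          rw [h2]
          calc (48 : ℝ) ≤ 2.7 ^ 4 := by norm_num
            _ ≤ _ := pow_le_pow_left₀ (by norm_num) h1 4
        have c2 : ∀ k : ℕ, √2 ^ k ≤ Real.exp k := fun k => by
          rw [show (k : ℝ) = k * 1 by ring, Real.exp_nat_mul]
          exact pow_le_pow_left₀ (Real.sqrt_nonneg _) hs2 k
        have hmn' : (1 : ℝ) ≤ m + n := by exact_mod_cast hmn
        have hm0 : (0 : ℝ) ≤ m := by positivity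
        have hn0 : (0 : ℝ) ≤ n := by positivity
        have c3 : ((latticeBall n).card : ℝ) * √2 ^ m ≤ Real.exp (4 * (m + n)) := by
          calc _ ≤ Real.exp (4 * n) * Real.exp m :=
                mul_le_mul c1 (c2 m) (by positivity) (by positivity)
            _ ≤ _ := by rw [← Real.exp_add]; exact Real.exp_le_exp.2 (by linarith)
        have c4 : √2 ^ m ≤ Real.exp (4 * (m + n)) :=
          (c2 m).trans (Real.exp_le_exp.2 (by linarith))
        have c5 : √2 ^ n ≤ Real.exp (4 * (m + n)) :=
          (c2 n).trans (Real.exp_le_exp.2 (by linarith))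
        have c6 : Real.exp (6 * (m + n)) = Real.exp (4 * (m + n)) * Real.exp (2 * (m + n)) := by
          rw [← Real.exp_add]; congr 1; ring
        have c7 : 3 ≤ Real.exp (2 * ((m : ℝ) + n)) := by
          linarith [Real.add_one_le_exp (2 * ((m : ℝ) + n))]
        rw [c6]
        nlinarith [Real.exp_pos (4 * ((m : ℝ) + n))]

lemma lintegral_noiseNorm_pow_le (hmn : 1 ≤ m + n) {p : ℕ} (hp : p ≠ 0) :
    ∫⁻ g, ENNReal.ofReal (noiseNorm g ^ (2 * p)) ∂(stdGaussian (NoiseSpace m n)) ≤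
      ENNReal.ofReal ((288 * (12 * (m + n) + 2 * p)) ^ p) := by
  have hm := measurable_noiseNorm (m := m) (n := n)
  have h := lintegral_pow_le_of_exp (stdGaussian (NoiseSpace m n))
    (Y := fun g => noiseNorm g ^ 2 / 288) (by fun_prop) (fun g => by positivity)
    (A := 6 * (m + n)) (by positivity) (lintegral_exp_noiseNorm_le hmn) p hp
  calc _ = ∫⁻ g, ENNReal.ofReal (288 ^ p) * ENNReal.ofReal ((noiseNorm g ^ 2 / 288) ^ p)
        ∂(stdGaussian (NoiseSpace m n)) := by
        refine lintegral_congr fun g => ?_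
        rw [← ENNReal.ofReal_mul (by positivity), ← mul_pow, pow_mul]
        congr 2; ring
    _ ≤ ENNReal.ofReal (288 ^ p) * ENNReal.ofReal ((2 * (6 * (m + n)) + 2 * p) ^ p) := by
        rw [lintegral_const_mul _ (by fun_prop)]
        gcongr
    _ = _ := by
        rw [← ENNReal.ofReal_mul (by positivity), ← mul_pow]
        congr 2; ring

end NoiseMoments


/-! ### Invariance of the noise average under isometries -/

section Invariance

/-- A change of variables by `φ` makes the log-partition function invariant under `O`, and the noise
law is invariant under `O` as well. The noise average is therefore constant along orbits of `φ`. -/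
lemma integral_channelLog_of_isometry {E : Type*} [NormedAddCommGroup E] [InnerProductSpace ℝ E]
    [FiniteDimensional ℝ E] [MeasurableSpace E] [BorelSpace E] {Ω : Type*} [MeasurableSpace Ω]
    {P : Measure Ω} [IsProbabilityMeasure P] {e : Fin 3 → Ω → E} (he : ∀ i, Measurable (e i))
    {φ : Ω → Ω} (hφ : MeasurePreserving φ P P) (O : E ≃ₗᵢ[ℝ] E)
    (hO : ∀ i z, e i (φ z) = O (e i z)) (a : Fin 3 → ℝ) (w : Ω) :
    ∫ g, channelLog P e a (φ w, g) ∂(stdGaussian E) = ∫ g, channelLog P e a (w, g) ∂(stdGaussian E) := by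
  have hs : ∀ z, combine e a (φ z) = O (combine e a z) := by
    intro z
    simp [combine, hO, map_sum]
  have hm := measurable_combine he a
  have hmg : ∀ o : E, Measurable (gibbsExponent (combine e a) o) := fun o =>
    (measurable_gibbsExponent hm).comp measurable_prodMk_left
  have hlog : ∀ o, logPartition P (combine e a) (O o) = logPartition P (combine e a) o := by
    intro o
    unfold logPartition
    congr 1
    have h1 : ∫ z, Real.exp (gibbsExponent (combine e a) (O o) z) ∂P =
        ∫ z, Real.exp (gibbsExponent (combine e a) (O o) (φ z)) ∂P := by
      conv_lhs => rw [← hφ.map_eq]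
      exact integral_map hφ.measurable.aemeasurable
        (Real.measurable_exp.comp (hmg (O o))).aestronglyMeasurable
    rw [h1]
    refine integral_congr_ae (ae_of_all _ fun z => ?_)
    simp only [gibbsExponent, hs, LinearIsometryEquiv.inner_map_map, LinearIsometryEquiv.norm_map]
  have hmap := stdGaussian_map O
  have hcm := (measurable_channelLog (P := P) he a).comp (measurable_prodMk_left (x := φ w))
  conv_lhs => rw [← hmap]
  refine (integral_map (by fun_prop) hcm.aestronglyMeasurable).trans ?_
  refine integral_congr_ae (ae_of_all _ fun g => ?_)
  simp only [channelLog, Function.comp_apply, hs, ← map_add, hlog]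

variable {m n : ℕ}

/-- The action of an isometry of the Euclidean space on plain vectors. -/
def act {k : ℕ} (A : EuclideanSpace ℝ (Fin k) ≃ₗᵢ[ℝ] EuclideanSpace ℝ (Fin k)) (x : Fin k → ℝ) :
    Fin k → ℝ :=
  (A (WithLp.toLp 2 x)).ofLp

/-- The column `j` of the matrix part of an observation. -/
def colMap (m n : ℕ) (j : Fin n) : NoiseSpace m n →ₗ[ℝ] EuclideanSpace ℝ (Fin m) where
  toFun g := WithLp.toLp 2 fun i => g (.inl (i, j))
  map_add' _ _ := rfl
  map_smul' _ _ := rfl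

/-- The row `i` of the matrix part of an observation. -/
def rowMap (m n : ℕ) (i : Fin m) : NoiseSpace m n →ₗ[ℝ] EuclideanSpace ℝ (Fin n) where
  toFun g := WithLp.toLp 2 fun j => g (.inl (i, j))
  map_add' _ _ := rfl
  map_smul' _ _ := rfl

lemma noiseFst_add (f g : NoiseSpace m n) : noiseFst (f + g) = noiseFst f + noiseFst g := rfl
lemma noiseSnd_add (f g : NoiseSpace m n) : noiseSnd (f + g) = noiseSnd f + noiseSnd g := rfl
lemma noiseFst_smul (c : ℝ) (g : NoiseSpace m n) : noiseFst (c • g) = c • noiseFst g := rfl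
lemma noiseSnd_smul (c : ℝ) (g : NoiseSpace m n) : noiseSnd (c • g) = c • noiseSnd g := rfl

/-- An isometry of `ℝ^m` acting on the columns of `W` and on `U`. -/
def isometryFst (A : EuclideanSpace ℝ (Fin m) ≃ₗᵢ[ℝ] EuclideanSpace ℝ (Fin m)) :
    NoiseSpace m n →ₗᵢ[ℝ] NoiseSpace m n where
  toFun g := WithLp.toLp 2 (Sum.elim (fun q => A (colMap m n q.2 g) q.1)
    (Sum.elim (A (noiseFst g)).ofLp (noiseSnd g).ofLp))
  map_add' f g := by
    ext k
    rcases k with q | i | j <;> simp [noiseFst_add, noiseSnd_add]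
  map_smul' c g := by
    ext k
    rcases k with q | i | j <;> simp [noiseFst_smul, noiseSnd_smul]
  norm_map' g := by
    refine (pow_left_inj₀ (norm_nonneg _) (norm_nonneg _) two_ne_zero).1 ?_
    have h1 : ∀ j, ∑ i, A (colMap m n j g) i ^ 2 = ∑ i, g (.inl (i, j)) ^ 2 := fun j => by
      rw [← EuclideanSpace.real_norm_sq_eq, A.norm_map, EuclideanSpace.real_norm_sq_eq]; rfl
    have h2 : ∑ i, A (noiseFst g) i ^ 2 = ∑ i, g (.inr (.inl i)) ^ 2 := by
      rw [← EuclideanSpace.real_norm_sq_eq, A.norm_map, EuclideanSpace.real_norm_sq_eq]; rfl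
    rw [EuclideanSpace.real_norm_sq_eq, EuclideanSpace.real_norm_sq_eq, Fintype.sum_sum_type,
      Fintype.sum_sum_type, Fintype.sum_sum_type, Fintype.sum_sum_type, Fintype.sum_prod_type_right,
      Fintype.sum_prod_type_right]
    change ∑ j, ∑ i, A (colMap m n j g) i ^ 2 + (∑ i, A (noiseFst g) i ^ 2 + _) = _
    simp_rw [h1, h2]
    rfl

/-- An isometry of `ℝ^n` acting on the rows of `W` and on `V`. -/
def isometrySnd (A : EuclideanSpace ℝ (Fin n) ≃ₗᵢ[ℝ] EuclideanSpace ℝ (Fin n)) :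
    NoiseSpace m n →ₗᵢ[ℝ] NoiseSpace m n where
  toFun g := WithLp.toLp 2 (Sum.elim (fun q => A (rowMap m n q.1 g) q.2)
    (Sum.elim (noiseFst g).ofLp (A (noiseSnd g)).ofLp))
  map_add' f g := by
    ext k
    rcases k with q | i | j <;> simp [noiseFst_add, noiseSnd_add]
  map_smul' c g := by
    ext k
    rcases k with q | i | j <;> simp [noiseFst_smul, noiseSnd_smul]
  norm_map' g := by
    refine (pow_left_inj₀ (norm_nonneg _) (norm_nonneg _) two_ne_zero).1 ?_
    have h1 : ∀ i, ∑ j, A (rowMap m n i g) j ^ 2 = ∑ j, g (.inl (i, j)) ^ 2 := fun i => by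
      rw [← EuclideanSpace.real_norm_sq_eq, A.norm_map, EuclideanSpace.real_norm_sq_eq]; rfl
    have h2 : ∑ j, A (noiseSnd g) j ^ 2 = ∑ j, g (.inr (.inr j)) ^ 2 := by
      rw [← EuclideanSpace.real_norm_sq_eq, A.norm_map, EuclideanSpace.real_norm_sq_eq]; rfl
    rw [EuclideanSpace.real_norm_sq_eq, EuclideanSpace.real_norm_sq_eq, Fintype.sum_sum_type,
      Fintype.sum_sum_type, Fintype.sum_sum_type, Fintype.sum_sum_type, Fintype.sum_prod_type,
      Fintype.sum_prod_type]
    change ∑ i, ∑ j, A (rowMap m n i g) j ^ 2 + (_ + ∑ j, A (noiseSnd g) j ^ 2) = _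
    simp_rw [h1, h2]
    rfl

/-- The two symmetries are applied one after the other: `A` acts on the columns of the matrix block
and on the `U` block, `B` on the rows and on the `V` block. -/
lemma integral_channelLog_act {μ : Measure (Fin m → ℝ)} {ν : Measure (Fin n → ℝ)}
    [IsProbabilityMeasure μ] [IsProbabilityMeasure ν]
    (A : EuclideanSpace ℝ (Fin m) ≃ₗᵢ[ℝ] EuclideanSpace ℝ (Fin m))
    (B : EuclideanSpace ℝ (Fin n) ≃ₗᵢ[ℝ] EuclideanSpace ℝ (Fin n))
    (hA : MeasurePreserving (act A) μ μ) (hB : MeasurePreserving (act B) ν ν)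
    (a : Fin 3 → ℝ) (w : Signal m n) :
    ∫ g, channelLog (μ.prod ν) (component m n) a ((act A w.1, act B w.2), g) ∂(stdGaussian _) =
      ∫ g, channelLog (μ.prod ν) (component m n) a (w, g) ∂(stdGaussian _) := by
  have key : ∀ (T : EuclideanSpace ℝ (Fin m) ≃ₗᵢ[ℝ] EuclideanSpace ℝ (Fin m)) (c : ℝ)
      (x : Fin m → ℝ), T (WithLp.toLp 2 fun i => x i * c) = c • T (WithLp.toLp 2 x) := by
    intro T c x
    rw [← map_smul]; congr 1; ext i; simp [mul_comm]
  have key' : ∀ (T : EuclideanSpace ℝ (Fin n) ≃ₗᵢ[ℝ] EuclideanSpace ℝ (Fin n)) (c d : ℝ)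
      (x : Fin n → ℝ), T (WithLp.toLp 2 fun i => d * (x i / c)) = (d / c) • T (WithLp.toLp 2 x) := by
    intro T c d x
    rw [← map_smul]; congr 1; ext i; simp; ring
  have h1 := integral_channelLog_of_isometry (P := μ.prod ν) measurable_component
    (φ := fun z => (act A z.1, z.2)) (hA.prod (MeasurePreserving.id ν))
    ((isometryFst (n := n) A).toLinearIsometryEquiv rfl) (by
      intro i z
      ext k
      fin_cases i <;> rcases k with q | i | j <;>
        simp [component, isometryFst, act, colMap, noiseFst, noiseSnd, mul_div_assoc]
      · rw [mul_comm]
        exact (congrArg (fun v : EuclideanSpace ℝ (Fin m) => v q.1) (key A _ z.1)).symm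
      · exact (congrArg (fun v : EuclideanSpace ℝ (Fin m) => v i) (map_zero A)).symm
      · exact (congrArg (fun v : EuclideanSpace ℝ (Fin m) => v q.1) (map_zero A)).symm
      · exact (congrArg (fun v : EuclideanSpace ℝ (Fin m) => v q.1) (map_zero A)).symm
      · exact (congrArg (fun v : EuclideanSpace ℝ (Fin m) => v i) (map_zero A)).symm) a (w.1, act B w.2)
  have h2 := integral_channelLog_of_isometry (P := μ.prod ν) measurable_component
    (φ := fun z => (z.1, act B z.2)) ((MeasurePreserving.id μ).prod hB)
    ((isometrySnd (m := m) B).toLinearIsometryEquiv rfl) (by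
      intro i z
      ext k
      fin_cases i <;> rcases k with q | i | j <;>
        simp [component, isometrySnd, act, rowMap, noiseFst, noiseSnd, mul_div_assoc]
      · rw [mul_div_left_comm, mul_comm]
        exact (congrArg (fun v : EuclideanSpace ℝ (Fin n) => v q.2) (key' B _ _ z.2)).symm
      · exact (congrArg (fun v : EuclideanSpace ℝ (Fin n) => v j) (map_zero B)).symm
      · exact (congrArg (fun v : EuclideanSpace ℝ (Fin n) => v q.2) (map_zero B)).symm
      · exact (congrArg (fun v : EuclideanSpace ℝ (Fin n) => v j) (map_zero B)).symm
      · exact (congrArg (fun v : EuclideanSpace ℝ (Fin n) => v q.2) (map_zero B)).symm) a w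
  exact h1.trans h2

end Invariance


/-! ### The uniform measure on the sphere -/

section Sphere

variable {k : ℕ}

lemma isProbabilityMeasure_unitSphereUniform (hk : 1 ≤ k) :
    IsProbabilityMeasure (unitSphereUniform k) := by
  have : NeZero k := ⟨by omega⟩
  refine ⟨?_⟩
  rw [unitSphereUniform, Measure.smul_apply, smul_eq_mul]
  refine ENNReal.inv_mul_cancel ?_ (measure_ne_top _ _)
  exact Measure.measure_univ_ne_zero.2 (Measure.toSphere_ne_zero _)

lemma measurable_scale (k : ℕ) :
    Measurable fun (u : Metric.sphere (0 : EuclideanSpace ℝ (Fin k)) 1) i =>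
      √(k : ℝ) * (u : EuclideanSpace ℝ (Fin k)) i := by
  have h : Continuous fun (u : Metric.sphere (0 : EuclideanSpace ℝ (Fin k)) 1) i =>
      √(k : ℝ) * (u : EuclideanSpace ℝ (Fin k)) i := by fun_prop
  exact h.measurable

lemma isProbabilityMeasure_sphereUniform (hk : 1 ≤ k) : IsProbabilityMeasure (sphereUniform k) := by
  have := isProbabilityMeasure_unitSphereUniform hk
  exact Measure.isProbabilityMeasure_map (measurable_scale k).aemeasurable

lemma ae_sum_sq_sphereUniform (k : ℕ) : ∀ᵐ x ∂sphereUniform k, ∑ i, x i ^ 2 = (k : ℝ) := by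
  rw [sphereUniform, ae_map_iff (measurable_scale k).aemeasurable
    (measurableSet_eq_fun (by fun_prop) measurable_const)]
  refine ae_of_all _ fun u => ?_
  have hu : ‖(u : EuclideanSpace ℝ (Fin k))‖ = 1 := by simp
  simp_rw [mul_pow]
  rw [← Finset.mul_sum, ← EuclideanSpace.real_norm_sq_eq, hu, Real.sq_sqrt (Nat.cast_nonneg k)]
  simp

open scoped Pointwise in
-- Surface measure is, up to a constant, the volume of the cone over a set; linear isometries map
-- cones to cones and preserve volume.
lemma measurePreserving_act_sphereUniform
    (A : EuclideanSpace ℝ (Fin k) ≃ₗᵢ[ℝ] EuclideanSpace ℝ (Fin k)) :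
    MeasurePreserving (act A) (sphereUniform k) (sphereUniform k) := by
  set S := Metric.sphere (0 : EuclideanSpace ℝ (Fin k)) 1 with hS
  let φ : S → S := fun u => ⟨A u, by simp [hS]⟩
  have hφ : Measurable φ := by
    have : Continuous φ := by fun_prop
    exact this.measurable
  have hact : Measurable (act A) := by
    have : Continuous (act A) := by unfold act; fun_prop
    exact this.measurable
  have h1 : MeasurePreserving φ (volume : Measure (EuclideanSpace ℝ (Fin k))).toSphere
      (volume : Measure (EuclideanSpace ℝ (Fin k))).toSphere := by
    refine ⟨hφ, Measure.ext fun s hs => ?_⟩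
    rw [Measure.map_apply hφ hs, Measure.toSphere_apply' _ (hφ hs), Measure.toSphere_apply' _ hs]
    congr 1
    have e : (Set.Ioo (0 : ℝ) 1 • (Subtype.val '' (φ ⁻¹' s)) : Set (EuclideanSpace ℝ (Fin k))) =
        A ⁻¹' (Set.Ioo (0 : ℝ) 1 • (Subtype.val '' s)) := by
      ext v
      simp only [Set.mem_smul, Set.mem_image, Set.mem_preimage]
      constructor
      · rintro ⟨r, hr, _, ⟨u, hu, rfl⟩, rfl⟩
        exact ⟨r, hr, _, ⟨φ u, hu, rfl⟩, by simp [φ]⟩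
      · rintro ⟨r, hr, _, ⟨u, hu, rfl⟩, h⟩
        have hm : A.symm (u : EuclideanSpace ℝ (Fin k)) ∈ S := by simp [hS]
        refine ⟨r, hr, _, ⟨⟨A.symm u, hm⟩, ?_, rfl⟩, ?_⟩
        · have : φ ⟨A.symm u, hm⟩ = u := Subtype.ext (by simp [φ])
          rwa [this]
        · apply A.injective
          rw [map_smul, A.apply_symm_apply, h]
    rw [e]
    exact A.measurePreserving.measure_preimage_equiv (f := A.toMeasurableEquiv) _
  have h2 : MeasurePreserving φ (unitSphereUniform k) (unitSphereUniform k) := h1.smul_measure _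
  refine ⟨hact, ?_⟩
  rw [sphereUniform, Measure.map_map hact (measurable_scale k)]
  conv_rhs => rw [← h2.map_eq, Measure.map_map (measurable_scale k) hφ]
  congr 1
  funext u i
  have : (WithLp.toLp 2 fun i => √(k : ℝ) * (u : EuclideanSpace ℝ (Fin k)) i) =
    √(k : ℝ) • (u : EuclideanSpace ℝ (Fin k)) := rfl
  simp only [act, Function.comp_apply, this, map_smul]
  rfl

/-- Transitivity on spheres: the reflection exchanging two vectors of equal norm. -/
lemma exists_act_eq {x x' : Fin k → ℝ} (h : ∑ i, x i ^ 2 = ∑ i, x' i ^ 2) :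
    ∃ A : EuclideanSpace ℝ (Fin k) ≃ₗᵢ[ℝ] EuclideanSpace ℝ (Fin k), act A x = x' := by
  have hn : ‖(WithLp.toLp 2 x : EuclideanSpace ℝ (Fin k))‖ = ‖(WithLp.toLp 2 x' : EuclideanSpace ℝ (Fin k))‖ := by
    refine (pow_left_inj₀ (norm_nonneg _) (norm_nonneg _) two_ne_zero).1 ?_
    rw [EuclideanSpace.real_norm_sq_eq, EuclideanSpace.real_norm_sq_eq]
    exact h
  exact ⟨_, congrArg WithLp.ofLp (Submodule.reflection_sub hn)⟩

variable {m n : ℕ}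

lemma integral_channelLog_sphericalLaw_eq (hm : 1 ≤ m) (hn : 1 ≤ n) (a : Fin 3 → ℝ)
    {w w' : Signal m n} (h1 : ∑ i, w.1 i ^ 2 = ∑ i, w'.1 i ^ 2) (h2 : ∑ j, w.2 j ^ 2 = ∑ j, w'.2 j ^ 2) :
    ∫ g, channelLog (sphericalLaw m n) (component m n) a (w, g) ∂(stdGaussian _) =
      ∫ g, channelLog (sphericalLaw m n) (component m n) a (w', g) ∂(stdGaussian _) := by
  have := isProbabilityMeasure_sphereUniform hm
  have := isProbabilityMeasure_sphereUniform hn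
  obtain ⟨A, hA⟩ := exists_act_eq h1
  obtain ⟨B, hB⟩ := exists_act_eq h2
  have := integral_channelLog_act A B (measurePreserving_act_sphereUniform A)
    (measurePreserving_act_sphereUniform B) a w
  rw [hA, hB] at this
  exact this.symm

end Sphere

/-! ### Dependence of the noise average on the signal for product laws -/

section Lipschitz

variable {m n : ℕ}

/-- The matrix block has squared norm at most `mn / N = N`, and `N ≤ m + n`. -/
lemma norm_component_le {z : Signal m n} (h1 : ∑ i, z.1 i ^ 2 ≤ m) (h2 : ∑ j, z.2 j ^ 2 ≤ n)
    (i : Fin 3) : ‖component m n i z‖ ≤ √((m : ℝ) + n) := by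
  refine Real.le_sqrt_of_sq_le ?_
  have hm : (0 : ℝ) ≤ m := Nat.cast_nonneg m
  have hn : (0 : ℝ) ≤ n := Nat.cast_nonneg n
  have h1' : 0 ≤ ∑ i, z.1 i ^ 2 := Finset.sum_nonneg fun _ _ => sq_nonneg _
  have h2' : 0 ≤ ∑ j, z.2 j ^ 2 := Finset.sum_nonneg fun _ _ => sq_nonneg _
  rw [EuclideanSpace.real_norm_sq_eq, Fintype.sum_sum_type, Fintype.sum_sum_type]
  fin_cases i
  · simp only [component, Fin.zero_eta, Matrix.cons_val_zero, Sum.elim_inl, Sum.elim_inr, div_pow,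
      Real.sq_sqrt (size_nonneg m n), Pi.zero_apply, mul_pow]
    have e : ∑ q : Fin m × Fin n, z.1 q.1 ^ 2 * z.2 q.2 ^ 2 / size m n =
        (∑ i, z.1 i ^ 2) * (∑ j, z.2 j ^ 2) / size m n := by
      rw [← Finset.sum_div, Finset.sum_mul_sum, Fintype.sum_prod_type]
    simp only [e, ne_eq, OfNat.ofNat_ne_zero, not_false_eq_true, zero_pow, Finset.sum_const_zero, add_zero]
    refine div_le_of_le_mul₀ (size_nonneg m n) (by positivity) ?_
    have hs : size m n ^ 2 = m * n := Real.sq_sqrt (by positivity)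
    have hle : size m n ≤ (m : ℝ) + n := by
      refine (Real.sqrt_le_left (by positivity)).2 ?_
      nlinarith
    have : (∑ i, z.1 i ^ 2) * (∑ j, z.2 j ^ 2) ≤ m * n := mul_le_mul h1 h2 h2' hm
    nlinarith [size_nonneg m n]
  · simp [component]
    linarith
  · simp [component]
    linarith

/-- The `ℓ¹` distance is used because it is what sorting controls. In the matrix block, changing one
entry of `X` touches `n` products of weight `1 / N`, and one entry of `Y` touches `m`; both ratios
are at most `κ`. The vector blocks supply the remaining 1 in `1 + κ`. -/
lemma abs_inner_combine_le {κ A : ℝ} (hN : 0 < size m n)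
    (hmκ : (m : ℝ) ≤ κ * size m n) (hnκ : (n : ℝ) ≤ κ * size m n) {a : Fin 3 → ℝ}
    (ha : ∀ i, a i ∈ Set.Icc 0 A) {z w w' : Signal m n}
    (hz : (∀ i, |z.1 i| ≤ 1) ∧ ∀ j, |z.2 j| ≤ 1) (hw : (∀ i, |w.1 i| ≤ 1) ∧ ∀ j, |w.2 j| ≤ 1)
    (hw' : (∀ i, |w'.1 i| ≤ 1) ∧ ∀ j, |w'.2 j| ≤ 1) :
    |⟪combine (component m n) a z, combine (component m n) a w - combine (component m n) a w'⟫| ≤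
      A ^ 2 * (1 + κ) * (∑ i, |w.1 i - w'.1 i| + ∑ j, |w.2 j - w'.2 j|) := by
  have hA2 : ∀ i, |a i * a i| ≤ A ^ 2 := fun i => by
    rw [abs_mul_self, ← sq]; exact pow_le_pow_left₀ (ha i).1 (ha i).2 2
  set r := √(size m n) with hr
  have hr2 : r * r = size m n := Real.mul_self_sqrt hN.le
  have hr0 : 0 < r := Real.sqrt_pos.2 hN
  set X := ∑ i, |w.1 i - w'.1 i| with hX
  set Y := ∑ j, |w.2 j - w'.2 j| with hY
  have hX0 : 0 ≤ X := Finset.sum_nonneg fun _ _ => abs_nonneg _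
  have hY0 : 0 ≤ Y := Finset.sum_nonneg fun _ _ => abs_nonneg _
  rw [noise_inner]
  simp only [combine_component, PiLp.sub_apply, Sum.elim_inl, Sum.elim_inr]
  have b0 : |∑ i, ∑ j, a 0 * (z.1 i * z.2 j / r) * (a 0 * (w.1 i * w.2 j / r) -
      a 0 * (w'.1 i * w'.2 j / r))| ≤ A ^ 2 * (κ * (X + Y)) := by
    have t : ∀ i j, |a 0 * (z.1 i * z.2 j / r) * (a 0 * (w.1 i * w.2 j / r) -
      a 0 * (w'.1 i * w'.2 j / r))| ≤
        A ^ 2 / size m n * (|w.1 i - w'.1 i| + |w.2 j - w'.2 j|) := by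
      intro i j
      have e : a 0 * (z.1 i * z.2 j / r) * (a 0 * (w.1 i * w.2 j / r) -
          a 0 * (w'.1 i * w'.2 j / r)) = (a 0 * a 0) / size m n *
          ((z.1 i * z.2 j) * ((w.1 i - w'.1 i) * w.2 j + w'.1 i * (w.2 j - w'.2 j))) := by
        rw [← hr2]; field_simp; ring
      rw [e, abs_mul, abs_div, abs_of_pos hN, abs_mul (z.1 i * z.2 j)]
      refine mul_le_mul (div_le_div_of_nonneg_right (hA2 0) hN.le) ?_ (by positivity) (by positivity)
      have h1 : |z.1 i * z.2 j| ≤ 1 := by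
        rw [abs_mul]
        exact mul_le_one₀ (hz.1 i) (abs_nonneg _) (hz.2 j)
      have h2 : |(w.1 i - w'.1 i) * w.2 j + w'.1 i * (w.2 j - w'.2 j)| ≤
          |w.1 i - w'.1 i| + |w.2 j - w'.2 j| := by
        refine (abs_add_le _ _).trans ?_
        rw [abs_mul, abs_mul]
        exact add_le_add (mul_le_of_le_one_right (abs_nonneg _) (hw.2 j))
          (mul_le_of_le_one_left (abs_nonneg _) (hw'.1 i))
      exact (mul_le_of_le_one_left (abs_nonneg _) h1).trans h2
    refine (Finset.abs_sum_le_sum_abs _ _).trans ((Finset.sum_le_sum fun i _ =>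
      (Finset.abs_sum_le_sum_abs _ _).trans (Finset.sum_le_sum fun j _ => t i j)).trans ?_)
    have e : ∑ i, ∑ j, A ^ 2 / size m n * (|w.1 i - w'.1 i| + |w.2 j - w'.2 j|) =
        A ^ 2 / size m n * (n * X + m * Y) := by
      simp only [← Finset.mul_sum, Finset.sum_add_distrib, Finset.sum_const, Finset.card_univ,
        Fintype.card_fin, nsmul_eq_mul, hX, hY]
    rw [e]
    have h3 : n * X + m * Y ≤ size m n * (κ * (X + Y)) := by nlinarith
    calc A ^ 2 / size m n * (n * X + m * Y) ≤ A ^ 2 / size m n * (size m n * (κ * (X + Y))) :=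
          mul_le_mul_of_nonneg_left h3 (by positivity)
      _ = _ := by field_simp
  have b1 : ∀ {k : ℕ} (c : ℝ) (u v v' : Fin k → ℝ), |c * c| ≤ A ^ 2 → (∀ i, |u i| ≤ 1) →
      |∑ i, c * u i * (c * v i - c * v' i)| ≤ A ^ 2 * ∑ i, |v i - v' i| := by
    intro k c u v v' hc hu
    rw [Finset.mul_sum]
    refine (Finset.abs_sum_le_sum_abs _ _).trans (Finset.sum_le_sum fun i _ => ?_)
    have e : c * u i * (c * v i - c * v' i) = (c * c) * (u i * (v i - v' i)) := by ring
    rw [e, abs_mul, abs_mul (u i)]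
    exact mul_le_mul hc (mul_le_of_le_one_left (abs_nonneg _) (hu i)) (by positivity) (by positivity)
  have c1 := b1 (a 1) z.1 w.1 w'.1 (hA2 1) hz.1
  have c2 := b1 (a 2) z.2 w.2 w'.2 (hA2 2) hz.2
  refine (abs_add_le _ _).trans ((add_le_add b0 ((abs_add_le _ _).trans (add_le_add c1 c2))).trans
    (le_of_eq ?_))
  ring

lemma ae_iidBound {P : Measure (Signal m n)}
    (hP : ∀ᵐ z ∂P, (∀ i, |z.1 i| ≤ 1) ∧ ∀ j, |z.2 j| ≤ 1) :
    ∀ᵐ z ∂P, ∀ i, ‖component m n i z‖ ≤ √((m : ℝ) + n) := by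
  filter_upwards [hP] with z hz i
  refine norm_component_le ?_ ?_ i
  · refine (Finset.sum_le_sum fun i _ => (sq_le_one_iff_abs_le_one _).2 (hz.1 i)).trans ?_
    simp
  · refine (Finset.sum_le_sum fun i _ => (sq_le_one_iff_abs_le_one _).2 (hz.2 i)).trans ?_
    simp

/-- At fixed noise the true signal enters the exponent only through its inner product with `s z`, so
the preceding bound passes to the logarithm. -/
lemma abs_integral_channelLog_sub_le {P : Measure (Signal m n)} [IsProbabilityMeasure P] {κ A : ℝ}
    (hP : ∀ᵐ z ∂P, (∀ i, |z.1 i| ≤ 1) ∧ ∀ j, |z.2 j| ≤ 1) (hN : 0 < size m n)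
    (hmκ : (m : ℝ) ≤ κ * size m n) (hnκ : (n : ℝ) ≤ κ * size m n) {a : Fin 3 → ℝ}
    (ha : ∀ i, a i ∈ Set.Icc 0 A) {w w' : Signal m n}
    (hw : (∀ i, |w.1 i| ≤ 1) ∧ ∀ j, |w.2 j| ≤ 1) (hw' : (∀ i, |w'.1 i| ≤ 1) ∧ ∀ j, |w'.2 j| ≤ 1) :
    |∫ g, channelLog P (component m n) a (w, g) ∂(stdGaussian _) -
      ∫ g, channelLog P (component m n) a (w', g) ∂(stdGaussian _)| ≤
      A ^ 2 * (1 + κ) * (∑ i, |w.1 i - w'.1 i| + ∑ j, |w.2 j - w'.2 j|) := by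
  have hℓ := ae_iidBound hP
  have hc := measurable_component (m := m) (n := n)
  have hp : ∀ g, |channelLog P (component m n) a (w, g) - channelLog P (component m n) a (w', g)| ≤
      A ^ 2 * (1 + κ) * (∑ i, |w.1 i - w'.1 i| + ∑ j, |w.2 j - w'.2 j|) := by
    intro g
    refine abs_log_integral_exp_sub_le
      (integrable_exp_gibbsExponent (measurable_combine hc a) (ae_norm_combine_le hℓ ha) _)
      (integrable_exp_gibbsExponent (measurable_combine hc a) (ae_norm_combine_le hℓ ha) _) ?_
    filter_upwards [hP] with z hz
    have := abs_inner_combine_le hN hmκ hnκ ha hz hw hw'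
    convert this using 2
    simp only [gibbsExponent, inner_add_right, inner_sub_right]
    ring
  rw [← integral_sub (integrable_channelLog_right hc hℓ ha w) (integrable_channelLog_right hc hℓ ha w'),
    ← Real.norm_eq_abs]
  refine (norm_integral_le_of_norm_le_const (ae_of_all _ hp)).trans ?_
  simp

end Lipschitz


/-! ### The distance between the empirical measures of two vectors -/

section Empirical

variable {k : ℕ}

/-- The number of entries of `x` that are at most `u`. -/
def countLE (x : Fin k → ℝ) (u : ℝ) : ℝ := ∑ i, (Set.Iic u).indicator (fun _ => (1 : ℝ)) (x i)

/-- The `L¹` distance on `[-1, 1]` between the counting functions of two vectors. -/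
def countDist (x x' : Fin k → ℝ) : ℝ≥0∞ :=
  ∫⁻ u in Set.Icc (-1 : ℝ) 1, ‖countLE x u - countLE x' u‖ₑ

lemma measurable_countLE : Measurable fun q : (Fin k → ℝ) × ℝ => countLE q.1 q.2 := by
  have e : (fun q : (Fin k → ℝ) × ℝ => countLE q.1 q.2) =
      fun q => ∑ i, {q : (Fin k → ℝ) × ℝ | q.1 i ≤ q.2}.indicator (fun _ => (1 : ℝ)) q := by
    funext q
    refine Finset.sum_congr rfl fun i _ => ?_
    simp [Set.indicator_apply]
  rw [e]
  refine Finset.measurable_sum _ fun i _ => measurable_const.indicator ?_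
  exact measurableSet_le (by fun_prop) (by fun_prop)

lemma measurable_enorm_countLE_sub : Measurable fun q : ((Fin k → ℝ) × (Fin k → ℝ)) × ℝ =>
    ‖countLE q.1.1 q.2 - countLE q.1.2 q.2‖ₑ := by
  have h1 : Measurable fun q : ((Fin k → ℝ) × (Fin k → ℝ)) × ℝ => countLE q.1.1 q.2 :=
    measurable_countLE.comp (by fun_prop : Measurable fun q : ((Fin k → ℝ) × (Fin k → ℝ)) × ℝ => (q.1.1, q.2))
  have h2 : Measurable fun q : ((Fin k → ℝ) × (Fin k → ℝ)) × ℝ => countLE q.1.2 q.2 :=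
    measurable_countLE.comp (by fun_prop : Measurable fun q : ((Fin k → ℝ) × (Fin k → ℝ)) × ℝ => (q.1.2, q.2))
  exact (h1.sub h2).enorm

lemma measurable_countDist : Measurable fun q : (Fin k → ℝ) × (Fin k → ℝ) => countDist q.1 q.2 :=
  measurable_enorm_countLE_sub.lintegral_prod_right'

lemma countLE_comp_perm (x : Fin k → ℝ) (σ : Equiv.Perm (Fin k)) (u : ℝ) :
    countLE (x ∘ σ) u = countLE x u :=
  Equiv.sum_comp σ fun i => (Set.Iic u).indicator (fun _ => (1 : ℝ)) (x i)

lemma ofReal_abs_sub_le {x y : ℝ} (hx : x ∈ Set.Icc (-1 : ℝ) 1) (hy : y ∈ Set.Icc (-1 : ℝ) 1) :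
    ENNReal.ofReal |x - y| ≤ ∫⁻ u in Set.Icc (-1 : ℝ) 1,
      ‖(Set.Iic u).indicator (fun _ => (1 : ℝ)) x - (Set.Iic u).indicator (fun _ => (1 : ℝ)) y‖ₑ := by
  have key : ∀ {x y : ℝ}, x ∈ Set.Icc (-1 : ℝ) 1 → y ∈ Set.Icc (-1 : ℝ) 1 → x ≤ y →
      ENNReal.ofReal (y - x) ≤ ∫⁻ u in Set.Icc (-1 : ℝ) 1,
      ‖(Set.Iic u).indicator (fun _ => (1 : ℝ)) x - (Set.Iic u).indicator (fun _ => (1 : ℝ)) y‖ₑ := by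
    intro x y hx hy hxy
    rw [← Real.volume_Ico, ← setLIntegral_one]
    refine le_trans (setLIntegral_mono' measurableSet_Ico fun u hu => ?_)
      (lintegral_mono_set (Set.Ico_subset_Icc_self.trans (Set.Icc_subset_Icc hx.1 hy.2)))
    have h1 : x ∈ Set.Iic u := hu.1
    have h2 : y ∉ Set.Iic u := not_le.2 hu.2
    simp [Set.indicator_of_mem h1, Set.indicator_of_notMem h2]
  rcases le_total x y with h | h
  · rw [abs_sub_comm, abs_of_nonneg (sub_nonneg.2 h)]
    exact key hx hy h
  · rw [abs_of_nonneg (sub_nonneg.2 h)]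
    simp_rw [enorm_sub_rev ((Set.Iic _).indicator (fun _ => (1 : ℝ)) x)]
    exact key hy hx h

/-- Each `|x i - x' i|` is the length of the set of thresholds separating the two entries. At a
given threshold, sorted vectors cannot have two indices separated in opposite directions, so summing
over indices involves no cancellation and yields the difference of the counts. -/
lemma ofReal_sum_abs_sub_le_countDist {x x' : Fin k → ℝ} (hx : Monotone x) (hx' : Monotone x')
    (h : ∀ i, |x i| ≤ 1) (h' : ∀ i, |x' i| ≤ 1) :
    ENNReal.ofReal (∑ i, |x i - x' i|) ≤ countDist x x' := by
  rw [ENNReal.ofReal_sum_of_nonneg fun _ _ => abs_nonneg _]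
  refine (Finset.sum_le_sum fun i _ => ofReal_abs_sub_le (abs_le.1 (h i)) (abs_le.1 (h' i))).trans ?_
  have hmeas : ∀ y : ℝ, Measurable fun u : ℝ => (Set.Iic u).indicator (fun _ => (1 : ℝ)) y := by
    intro y
    have : (fun u : ℝ => (Set.Iic u).indicator (fun _ => (1 : ℝ)) y) =
        (Set.Ici y).indicator fun _ => (1 : ℝ) := by
      funext u; simp [Set.indicator_apply]
    rw [this]
    exact measurable_const.indicator measurableSet_Ici
  have hmeas2 : ∀ i, Measurable fun u : ℝ => ‖(Set.Iic u).indicator (fun _ => (1 : ℝ)) (x i) -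
      (Set.Iic u).indicator (fun _ => (1 : ℝ)) (x' i)‖ₑ := fun i => ((hmeas _).sub (hmeas _)).enorm
  rw [← lintegral_finsetSum _ fun i _ => hmeas2 i]
  refine lintegral_mono fun u => ?_
  set d : Fin k → ℝ := fun i => (Set.Iic u).indicator (fun _ => (1 : ℝ)) (x i) -
    (Set.Iic u).indicator (fun _ => (1 : ℝ)) (x' i) with hd
  have hs : countLE x u - countLE x' u = ∑ i, d i := by
    simp [countLE, hd, Finset.sum_sub_distrib]
  have hpos : ∀ i, 0 < d i → x i ≤ u ∧ u < x' i := by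
    intro i hi
    simp only [hd, Set.indicator_apply, Set.mem_Iic] at hi
    split_ifs at hi with h1 h2 <;> first | (exfalso; linarith) | exact ⟨h1, not_le.1 h2⟩
  have hneg : ∀ i, d i < 0 → u < x i ∧ x' i ≤ u := by
    intro i hi
    simp only [hd, Set.indicator_apply, Set.mem_Iic] at hi
    split_ifs at hi with h1 h2 h2 <;> first | (exfalso; linarith) | exact ⟨not_le.1 h1, h2⟩
  -- Opposite signs at `i` and `j` would contradict monotonicity of `x` if `i ≤ j`, and of `x'` if
  -- `j ≤ i`.
  have hsign : (∀ i, 0 ≤ d i) ∨ ∀ i, d i ≤ 0 := by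
    by_contra! hcon
    obtain ⟨⟨i, hi⟩, j, hj⟩ := hcon
    obtain ⟨i1, i2⟩ := hneg i hi
    obtain ⟨j1, j2⟩ := hpos j hj
    rcases le_total i j with hij | hij
    · linarith [hx hij]
    · linarith [hx' hij]
  have habs : ∑ i, |d i| = |∑ i, d i| := by
    rcases hsign with hp | hp
    · rw [abs_of_nonneg (Finset.sum_nonneg fun i _ => hp i)]
      exact Finset.sum_congr rfl fun i _ => abs_of_nonneg (hp i)
    · rw [abs_of_nonpos (Finset.sum_nonpos fun i _ => hp i), ← Finset.sum_neg_distrib]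
      exact Finset.sum_congr rfl fun i _ => abs_of_nonpos (hp i)
  change ∑ i, ‖d i‖ₑ ≤ _
  rw [hs]
  simp_rw [Real.enorm_eq_ofReal_abs]
  rw [← habs, ENNReal.ofReal_sum_of_nonneg fun _ _ => abs_nonneg _]

/-- The count is a sum of `k` independent variables with values in `[0, 1]`, each of variance at
most `1 / 4`. -/
lemma lintegral_countLE_sub_mean_sq_le (μ : Measure ℝ) [IsProbabilityMeasure μ] (u : ℝ) :
    ∫⁻ x, ‖countLE x u - ∫ y, countLE y u ∂(Measure.pi fun _ : Fin k => μ)‖ₑ ^ 2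
      ∂(Measure.pi fun _ : Fin k => μ) ≤ ENNReal.ofReal (k / 4) := by
  set X : ℝ → ℝ := (Set.Iic u).indicator fun _ => (1 : ℝ) with hX
  have hXm : Measurable X := measurable_const.indicator measurableSet_Iic
  have hX01 : ∀ y, X y ∈ Set.Icc (0 : ℝ) 1 := by
    intro y
    simp only [hX, Set.indicator_apply]
    split_ifs <;> simp
  have hL : MemLp X 2 μ := MemLp.of_bound hXm.aestronglyMeasurable 1 (ae_of_all _ fun y => by
    rw [Real.norm_eq_abs, abs_le]; constructor <;> linarith [(hX01 y).1, (hX01 y).2])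
  have hc : (fun x : Fin k → ℝ => countLE x u) = ∑ i, fun x : Fin k → ℝ => X (x i) := by
    funext x; simp [countLE, hX]
  have hLs : MemLp (fun x : Fin k → ℝ => countLE x u) 2 (Measure.pi fun _ : Fin k => μ) := by
    rw [hc]
    exact memLp_finsetSum' _ fun i _ =>
      hL.comp_measurePreserving (measurePreserving_eval (fun _ : Fin k => μ) i)
  have hv : Var[fun x : Fin k → ℝ => countLE x u; Measure.pi fun _ : Fin k => μ] ≤ k / 4 := by
    rw [hc, variance_sum_pi fun _ => hL]
    refine (Finset.sum_le_sum fun i _ =>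
      variance_le_sq_of_bounded (ae_of_all _ hX01) hXm.aemeasurable).trans (le_of_eq ?_)
    simp
    ring
  have := hLs.ofReal_variance_eq
  rw [evariance] at this
  rw [← this]
  exact ENNReal.ofReal_le_ofReal hv

lemma enorm_sub_sq_le (a b c : ℝ) : ‖a - b‖ₑ ^ 2 ≤ 2 * ‖a - c‖ₑ ^ 2 + 2 * ‖b - c‖ₑ ^ 2 := by
  simp_rw [Real.enorm_eq_ofReal_abs, ← ENNReal.ofReal_pow (abs_nonneg _), sq_abs]
  rw [← ENNReal.ofReal_ofNat, ← ENNReal.ofReal_mul (by norm_num), ← ENNReal.ofReal_mul (by norm_num),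
    ← ENNReal.ofReal_add (by positivity) (by positivity)]
  exact ENNReal.ofReal_le_ofReal (by nlinarith [sq_nonneg (a - c + (b - c))])

lemma lintegral_prod_sub_sq_le {α : Type*} [MeasurableSpace α] (π : Measure α)
    [IsProbabilityMeasure π] {f : α → ℝ} (hf : Measurable f) (c : ℝ) :
    ∫⁻ q, ‖f q.1 - f q.2‖ₑ ^ 2 ∂(π.prod π) ≤ 4 * ∫⁻ x, ‖f x - c‖ₑ ^ 2 ∂π := by
  have hm : Measurable fun x => ‖f x - c‖ₑ ^ 2 := ((hf.sub_const c).enorm).pow_const 2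
  have m1 : Measurable fun q : α × α => 2 * ‖f q.1 - c‖ₑ ^ 2 := (hm.comp measurable_fst).const_mul 2
  have e1 : ∫⁻ q, 2 * ‖f q.1 - c‖ₑ ^ 2 ∂(π.prod π) = 2 * ∫⁻ x, ‖f x - c‖ₑ ^ 2 ∂π := by
    rw [← lintegral_const_mul 2 hm]
    exact (measurePreserving_fst (μ := π) (ν := π)).lintegral_comp (hm.const_mul 2)
  have e2 : ∫⁻ q, 2 * ‖f q.2 - c‖ₑ ^ 2 ∂(π.prod π) = 2 * ∫⁻ x, ‖f x - c‖ₑ ^ 2 ∂π := by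
    rw [← lintegral_const_mul 2 hm]
    exact (measurePreserving_snd (μ := π) (ν := π)).lintegral_comp (hm.const_mul 2)
  calc _ ≤ ∫⁻ q, 2 * ‖f q.1 - c‖ₑ ^ 2 + 2 * ‖f q.2 - c‖ₑ ^ 2 ∂(π.prod π) :=
        lintegral_mono fun q => enorm_sub_sq_le _ _ _
    _ = _ := by
        rw [lintegral_add_left m1, e1, e2, ← add_mul]
        norm_num

lemma lintegral_countLE_sub_sq_le (μ : Measure ℝ) [IsProbabilityMeasure μ] (u : ℝ) :
    ∫⁻ q : (Fin k → ℝ) × (Fin k → ℝ), ‖countLE q.1 u - countLE q.2 u‖ₑ ^ 2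
      ∂((Measure.pi fun _ : Fin k => μ).prod (Measure.pi fun _ : Fin k => μ)) ≤ ENNReal.ofReal k := by
  have hm : Measurable fun x : Fin k → ℝ => countLE x u :=
    measurable_countLE.comp (measurable_prodMk_right (y := u))
  refine (lintegral_prod_sub_sq_le _ hm (∫ y, countLE y u ∂(Measure.pi fun _ : Fin k => μ))).trans ?_
  refine (mul_le_mul_right (lintegral_countLE_sub_mean_sq_le μ u) _).trans (le_of_eq ?_)
  rw [← ENNReal.ofReal_ofNat, ← ENNReal.ofReal_mul (by norm_num)]
  congr 1; ring

/-- Cauchy–Schwarz on an interval of length 2, then Fubini and the variance bound at each threshold: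
`2 * 2 * k`. Integrating over thresholds replaces any supremum of the empirical process. -/
lemma lintegral_countDist_sq_le (μ : Measure ℝ) [IsProbabilityMeasure μ] :
    ∫⁻ x, ∫⁻ x', countDist x x' ^ 2 ∂(Measure.pi fun _ : Fin k => μ) ∂(Measure.pi fun _ : Fin k => μ) ≤
      ENNReal.ofReal (4 * k) := by
  set π := Measure.pi fun _ : Fin k => μ
  rw [← lintegral_prod (fun q : (Fin k → ℝ) × (Fin k → ℝ) => countDist q.1 q.2 ^ 2)
    (measurable_countDist.pow_const 2).aemeasurable]
  have h1 : ∀ q : (Fin k → ℝ) × (Fin k → ℝ), countDist q.1 q.2 ^ 2 ≤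
      2 * ∫⁻ u in Set.Icc (-1 : ℝ) 1, ‖countLE q.1 u - countLE q.2 u‖ₑ ^ 2 := by
    intro q
    have := lintegral_pow_le (volume.restrict (Set.Icc (-1 : ℝ) 1))
      (measurable_enorm_countLE_sub.comp (measurable_prodMk_left (x := q))).aemeasurable 1
    refine this.trans (le_of_eq ?_)
    rw [pow_one, Measure.restrict_apply_univ, Real.volume_Icc]
    norm_num
  have h2 : ∀ u : ℝ, ∫⁻ q, ‖countLE q.1 u - countLE q.2 u‖ₑ ^ 2 ∂(π.prod π) ≤ ENNReal.ofReal k :=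
    fun u => lintegral_countLE_sub_sq_le μ u
  refine (lintegral_mono h1).trans ?_
  rw [lintegral_const_mul _ (measurable_enorm_countLE_sub.pow_const 2).lintegral_prod_right',
    lintegral_lintegral_swap (measurable_enorm_countLE_sub.pow_const 2).aemeasurable]
  refine (mul_le_mul_right (lintegral_mono h2) _).trans (le_of_eq ?_)
  rw [lintegral_const, Measure.restrict_apply_univ, Real.volume_Icc, ← ENNReal.ofReal_ofNat,
    ← ENNReal.ofReal_mul (by positivity), ← ENNReal.ofReal_mul (by norm_num)]
  congr 1; ring

end Empirical

/-! ### Signal fluctuations for i.i.d. entries, by sorting -/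

section Product

lemma lintegral_lintegral_prod_add {α β : Type*} [MeasurableSpace α] [MeasurableSpace β]
    (μ : Measure α) (ν : Measure β) [IsProbabilityMeasure μ] [IsProbabilityMeasure ν]
    {F : α × α → ℝ≥0∞} {G : β × β → ℝ≥0∞} (hF : Measurable F) (hG : Measurable G) (c : ℝ≥0∞) :
    ∫⁻ w, ∫⁻ w', c * (F (w.1, w'.1) + G (w.2, w'.2)) ∂(μ.prod ν) ∂(μ.prod ν) =
      c * (∫⁻ x, ∫⁻ x', F (x, x') ∂μ ∂μ + ∫⁻ y, ∫⁻ y', G (y, y') ∂ν ∂ν) := by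
  have e1 : ∀ w : α × β, ∫⁻ w', c * (F (w.1, w'.1) + G (w.2, w'.2)) ∂(μ.prod ν) =
      c * (∫⁻ x', F (w.1, x') ∂μ + ∫⁻ y', G (w.2, y') ∂ν) := by
    intro w
    have l1 : Measurable fun x' => F (w.1, x') := hF.comp measurable_prodMk_left
    have l2 : Measurable fun y' => G (w.2, y') := hG.comp measurable_prodMk_left
    have m1 : Measurable fun w' : α × β => F (w.1, w'.1) := l1.comp measurable_fst
    have m2 : Measurable fun w' : α × β => G (w.2, w'.2) := l2.comp measurable_snd
    have f1 : ∫⁻ w', F (w.1, w'.1) ∂(μ.prod ν) = ∫⁻ x', F (w.1, x') ∂μ :=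
      (measurePreserving_fst (μ := μ) (ν := ν)).lintegral_comp l1
    have f2 : ∫⁻ w', G (w.2, w'.2) ∂(μ.prod ν) = ∫⁻ y', G (w.2, y') ∂ν :=
      (measurePreserving_snd (μ := μ) (ν := ν)).lintegral_comp l2
    have m3 : Measurable fun w' : α × β => F (w.1, w'.1) + G (w.2, w'.2) := m1.add m2
    rw [lintegral_const_mul c m3, lintegral_add_left m1, f1, f2]
  have g1 : Measurable fun x => ∫⁻ x', F (x, x') ∂μ := hF.lintegral_prod_right'
  have g2 : Measurable fun y => ∫⁻ y', G (y, y') ∂ν := hG.lintegral_prod_right'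
  have m1 : Measurable fun w : α × β => ∫⁻ x', F (w.1, x') ∂μ := g1.comp measurable_fst
  have m2 : Measurable fun w : α × β => ∫⁻ y', G (w.2, y') ∂ν := g2.comp measurable_snd
  have f1 : ∫⁻ w, ∫⁻ x', F (w.1, x') ∂μ ∂(μ.prod ν) = ∫⁻ x, ∫⁻ x', F (x, x') ∂μ ∂μ :=
    (measurePreserving_fst (μ := μ) (ν := ν)).lintegral_comp g1
  have f2 : ∫⁻ w, ∫⁻ y', G (w.2, y') ∂ν ∂(μ.prod ν) = ∫⁻ y, ∫⁻ y', G (y, y') ∂ν ∂ν :=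
    (measurePreserving_snd (μ := μ) (ν := ν)).lintegral_comp g2
  have m3 : Measurable fun w : α × β => ∫⁻ x', F (w.1, x') ∂μ + ∫⁻ y', G (w.2, y') ∂ν := m1.add m2
  rw [lintegral_congr e1, lintegral_const_mul c m3, lintegral_add_left m1, f1, f2]

variable {m n : ℕ} {PX PY : Measure ℝ} [IsProbabilityMeasure PX] [IsProbabilityMeasure PY]

instance : IsProbabilityMeasure (iidLaw m n PX PY) := by unfold iidLaw; infer_instance

lemma ae_abs_le_one_iidLaw (hX : ∀ᵐ x ∂PX, x ∈ Set.Icc (-1 : ℝ) 1)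
    (hY : ∀ᵐ y ∂PY, y ∈ Set.Icc (-1 : ℝ) 1) :
    ∀ᵐ z ∂iidLaw m n PX PY, (∀ i, |z.1 i| ≤ 1) ∧ ∀ j, |z.2 j| ≤ 1 := by
  have key : ∀ (k : ℕ) (μ : Measure ℝ) [IsProbabilityMeasure μ], (∀ᵐ x ∂μ, x ∈ Set.Icc (-1 : ℝ) 1) →
      ∀ᵐ x ∂(Measure.pi fun _ : Fin k => μ), ∀ i, |x i| ≤ 1 := by
    intro k μ _ h
    rw [ae_all_iff]
    intro i
    exact (measurePreserving_eval (fun _ : Fin k => μ) i).quasiMeasurePreserving.ae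
      (h.mono fun x hx => abs_le.2 hx)
  filter_upwards [Measure.quasiMeasurePreserving_fst.ae (key m PX hX),
    Measure.quasiMeasurePreserving_snd.ae (key n PY hY)] with z h1 h2 using ⟨h1, h2⟩

/-- The isometry that permutes the coordinates. -/
def permIsometry {k : ℕ} (σ : Equiv.Perm (Fin k)) :
    EuclideanSpace ℝ (Fin k) ≃ₗᵢ[ℝ] EuclideanSpace ℝ (Fin k) :=
  LinearIsometryEquiv.piLpCongrLeft 2 ℝ ℝ σ.symm

lemma act_permIsometry {k : ℕ} (σ : Equiv.Perm (Fin k)) (x : Fin k → ℝ) :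
    act (permIsometry σ) x = x ∘ σ := rfl

lemma measurePreserving_act_permIsometry {k : ℕ} (σ : Equiv.Perm (Fin k)) (μ : Measure ℝ)
    [IsProbabilityMeasure μ] : MeasurePreserving (act (permIsometry σ)) (Measure.pi fun _ => μ)
      (Measure.pi fun _ => μ) := by
  convert measurePreserving_piCongrLeft (fun _ : Fin k => μ) σ.symm using 1
  funext x i
  rw [act_permIsometry, MeasurableEquiv.coe_piCongrLeft]
  have := Equiv.piCongrLeft_apply_apply (fun _ : Fin k => ℝ) σ.symm x (σ i)
  rw [Equiv.symm_apply_apply] at this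
  exact this.symm

lemma integral_channelLog_comp_perm (a : Fin 3 → ℝ) (w : Signal m n) (σ : Equiv.Perm (Fin m))
    (τ : Equiv.Perm (Fin n)) :
    ∫ g, channelLog (iidLaw m n PX PY) (component m n) a ((w.1 ∘ σ, w.2 ∘ τ), g) ∂(stdGaussian _) =
      ∫ g, channelLog (iidLaw m n PX PY) (component m n) a (w, g) ∂(stdGaussian _) :=
  integral_channelLog_act (permIsometry σ) (permIsometry τ) (measurePreserving_act_permIsometry σ PX)
    (measurePreserving_act_permIsometry τ PY) a w

/-- Permutation invariance allows both signals to be sorted before the `ℓ¹` bound is applied;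
sorting does not change the counting functions. The right-hand side is free of `a`, so the bound is
uniform over the parameters without a grid. -/
lemma enorm_integral_channelLog_sub_sq_le {κ A : ℝ} (hκ : 0 ≤ κ)
    (hX : ∀ᵐ x ∂PX, x ∈ Set.Icc (-1 : ℝ) 1) (hY : ∀ᵐ y ∂PY, y ∈ Set.Icc (-1 : ℝ) 1)
    (hN : 0 < size m n) (hmκ : (m : ℝ) ≤ κ * size m n) (hnκ : (n : ℝ) ≤ κ * size m n)
    {a : Fin 3 → ℝ} (ha : ∀ i, a i ∈ Set.Icc 0 A) {w w' : Signal m n}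
    (hw : (∀ i, |w.1 i| ≤ 1) ∧ ∀ j, |w.2 j| ≤ 1) (hw' : (∀ i, |w'.1 i| ≤ 1) ∧ ∀ j, |w'.2 j| ≤ 1) :
    ‖∫ g, channelLog (iidLaw m n PX PY) (component m n) a (w, g) ∂(stdGaussian _) -
      ∫ g, channelLog (iidLaw m n PX PY) (component m n) a (w', g) ∂(stdGaussian _)‖ₑ ^ 2 ≤
      ENNReal.ofReal (2 * (A ^ 2 * (1 + κ)) ^ 2) *
        (countDist w.1 w'.1 ^ 2 + countDist w.2 w'.2 ^ 2) := by
  have hdist : ∀ {k : ℕ} (x x' : Fin k → ℝ), (∀ i, |x i| ≤ 1) → (∀ i, |x' i| ≤ 1) →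
      ENNReal.ofReal (∑ i, |x (Tuple.sort x i) - x' (Tuple.sort x' i)|) ≤ countDist x x' := by
    intro k x x' h h'
    refine (ofReal_sum_abs_sub_le_countDist (Tuple.monotone_sort x) (Tuple.monotone_sort x')
      (fun i => h _) (fun i => h' _)).trans (le_of_eq ?_)
    simp [countDist, countLE_comp_perm]
  set q := A ^ 2 * (1 + κ) with hq
  have hq0 : 0 ≤ q := by positivity
  set X := ∑ i, |w.1 (Tuple.sort w.1 i) - w'.1 (Tuple.sort w'.1 i)| with hXdef
  set Y := ∑ j, |w.2 (Tuple.sort w.2 j) - w'.2 (Tuple.sort w'.2 j)| with hYdef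
  have hX0 : 0 ≤ X := Finset.sum_nonneg fun _ _ => abs_nonneg _
  have hY0 : 0 ≤ Y := Finset.sum_nonneg fun _ _ => abs_nonneg _
  rw [← integral_channelLog_comp_perm a w (Tuple.sort w.1) (Tuple.sort w.2),
    ← integral_channelLog_comp_perm a w' (Tuple.sort w'.1) (Tuple.sort w'.2),
    Real.enorm_eq_ofReal_abs, ← ENNReal.ofReal_pow (abs_nonneg _)]
  have h1 := abs_integral_channelLog_sub_le (ae_abs_le_one_iidLaw hX hY) hN hmκ hnκ ha
    (w := (w.1 ∘ Tuple.sort w.1, w.2 ∘ Tuple.sort w.2))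
    (w' := (w'.1 ∘ Tuple.sort w'.1, w'.2 ∘ Tuple.sort w'.2))
    ⟨fun i => hw.1 _, fun j => hw.2 _⟩ ⟨fun i => hw'.1 _, fun j => hw'.2 _⟩
  calc _ ≤ ENNReal.ofReal (2 * q ^ 2 * (X ^ 2 + Y ^ 2)) := by
        refine ENNReal.ofReal_le_ofReal ?_
        refine (pow_le_pow_left₀ (abs_nonneg _) h1 2).trans ?_
        change (q * (X + Y)) ^ 2 ≤ _
        nlinarith [mul_nonneg (sq_nonneg q) (sq_nonneg (X - Y))]
    _ = ENNReal.ofReal (2 * q ^ 2) * (ENNReal.ofReal X ^ 2 + ENNReal.ofReal Y ^ 2) := by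
        rw [← ENNReal.ofReal_pow hX0, ← ENNReal.ofReal_pow hY0, ← ENNReal.ofReal_add (by positivity)
          (by positivity), ← ENNReal.ofReal_mul (by positivity)]
    _ ≤ _ := by
        gcongr
        · exact hdist _ _ hw.1 hw'.1
        · exact hdist _ _ hw.2 hw'.2

lemma lintegral_countDist_iidLaw_le (c : ℝ) (hc : 0 ≤ c) :
    ∫⁻ w, ∫⁻ w', ENNReal.ofReal c * (countDist w.1 w'.1 ^ 2 + countDist w.2 w'.2 ^ 2)
      ∂(iidLaw m n PX PY) ∂(iidLaw m n PX PY) ≤ ENNReal.ofReal (4 * c * (m + n)) := by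
  have hD : ∀ k : ℕ, Measurable fun q : (Fin k → ℝ) × (Fin k → ℝ) => countDist q.1 q.2 ^ 2 :=
    fun k => measurable_countDist.pow_const 2
  have h := lintegral_lintegral_prod_add (Measure.pi fun _ : Fin m => PX)
    (Measure.pi fun _ : Fin n => PY) (hD m) (hD n) (ENNReal.ofReal c)
  refine h.le.trans ?_
  refine (mul_le_mul_right (add_le_add (lintegral_countDist_sq_le PX)
    (lintegral_countDist_sq_le PY)) _).trans (le_of_eq ?_)
  rw [← ENNReal.ofReal_add (by positivity) (by positivity), ← ENNReal.ofReal_mul hc]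
  congr 1; ring

end Product


/-! ### The concentration rate -/

section Rate

variable {m n : ℕ}

lemma measurePreserving_disorder (P : Measure (Signal m n)) [IsProbabilityMeasure P] :
    MeasurePreserving (Prod.map id encode) (disorderLaw P) (P.prod (stdGaussian (NoiseSpace m n))) :=
  (MeasurePreserving.id P).prod (measurePreserving_encode m n)

lemma meanFreeEnergy_eq (P : Measure (Signal m n)) [IsProbabilityMeasure P] {t h₁ h₂ : ℝ}
    (ht : 0 ≤ t) (hh₁ : 0 ≤ h₁) (hh₂ : 0 ≤ h₂) :
    meanFreeEnergy P t h₁ h₂ = 1 / size m n *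
      ∫ q, channelLog P (component m n) ![√(2 * t), √(2 * h₁), √(2 * h₂)] q
        ∂(P.prod (stdGaussian (NoiseSpace m n))) := by
  rw [meanFreeEnergy, ← integral_const_mul]
  simp_rw [freeEnergy_eq P _ ht hh₁ hh₂]
  have hm := measurable_channelLog (P := P) (measurable_component (m := m) (n := n))
    ![√(2 * t), √(2 * h₁), √(2 * h₂)]
  have hφ := measurePreserving_disorder P
  conv_rhs => rw [← hφ.map_eq]
  exact (integral_map hφ.measurable.aemeasurable (hm.const_mul _).aestronglyMeasurable).symm

/-- Domination by a measurable `D` makes it unnecessary to know that the uncountable supremum is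
measurable. Parameters up to `M` correspond to amplitudes up to `√(2 * M)`. -/
lemma concentrationRate_le {P : Measure (Signal m n)} [IsProbabilityMeasure P] (hN : 0 < size m n)
    {M : ℝ} {D : Signal m n × NoiseSpace m n → ℝ≥0∞} (hD : Measurable D)
    (h : ∀ᵐ q ∂(P.prod (stdGaussian (NoiseSpace m n))), ∀ a : Fin 3 → ℝ,
      (∀ i, a i ∈ Set.Icc 0 (√(2 * M))) → ‖channelLog P (component m n) a q -
        ∫ q, channelLog P (component m n) a q ∂(P.prod (stdGaussian (NoiseSpace m n)))‖ₑ ^ 2 ≤ D q)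
    {R : ℝ} (hR0 : 0 ≤ R) (hR : ∫⁻ q, D q ∂(P.prod (stdGaussian (NoiseSpace m n))) ≤ ENNReal.ofReal R) :
    concentrationRate P M ≤ ENNReal.ofReal (√R / size m n) := by
  have hφ := measurePreserving_disorder P
  have hb : ∀ᵐ ω ∂(disorderLaw P), (⨆ t ∈ Set.Icc (0 : ℝ) M, ⨆ h₁ ∈ Set.Icc (0 : ℝ) M,
      ⨆ h₂ ∈ Set.Icc (0 : ℝ) M,
        ENNReal.ofReal (|freeEnergy P ω t h₁ h₂ - meanFreeEnergy P t h₁ h₂| ^ 2)) ≤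
      ENNReal.ofReal ((1 / size m n) ^ 2) * D (Prod.map id encode ω) := by
    filter_upwards [hφ.quasiMeasurePreserving.ae h] with ω hω
    refine iSup₂_le fun t ht => iSup₂_le fun h₁ hh₁ => iSup₂_le fun h₂ hh₂ => ?_
    rw [freeEnergy_eq P ω ht.1 hh₁.1 hh₂.1, meanFreeEnergy_eq P ht.1 hh₁.1 hh₂.1, ← mul_sub, abs_mul,
      mul_pow, sq_abs, ENNReal.ofReal_mul (sq_nonneg _), ENNReal.ofReal_pow (abs_nonneg _),
      ← Real.enorm_eq_ofReal_abs]
    refine mul_le_mul_right (hω _ fun i => ?_) _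
    have key : ∀ s ∈ Set.Icc (0 : ℝ) M, √(2 * s) ∈ Set.Icc 0 (√(2 * M)) := fun s hs =>
      ⟨Real.sqrt_nonneg _, Real.sqrt_le_sqrt (by linarith [hs.2])⟩
    fin_cases i
    · exact key t ht
    · exact key h₁ hh₁
    · exact key h₂ hh₂
  have hI : ∫⁻ ω, ENNReal.ofReal ((1 / size m n) ^ 2) * D (Prod.map id encode ω) ∂(disorderLaw P) ≤
      ENNReal.ofReal ((√R / size m n) ^ 2) := by
    have hDφ : Measurable fun ω : Disorder m n => D (Prod.map id encode ω) := hD.comp hφ.measurable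
    rw [lintegral_const_mul _ hDφ, hφ.lintegral_comp hD]
    refine (mul_le_mul_right hR _).trans (le_of_eq ?_)
    rw [← ENNReal.ofReal_mul (sq_nonneg _), div_pow √R, Real.sq_sqrt hR0]
    congr 1; ring
  rw [concentrationRate]
  refine (ENNReal.rpow_le_rpow ((lintegral_mono_ae hb).trans hI) (by norm_num)).trans (le_of_eq ?_)
  rw [ENNReal.ofReal_rpow_of_nonneg (sq_nonneg _) (by norm_num), ← Real.sqrt_eq_rpow,
    Real.sqrt_sq (by positivity)]

/-- The bound contains neither `A` nor `ℓ`: the boundedness of the signal serves only to justify the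
calculus, and the size comes from the noise norm alone. -/
lemma lintegral_centredLogPartition_component_le {P : Measure (Signal m n)} [IsProbabilityMeasure P]
    (hmn : 1 ≤ m + n) {A ℓ : ℝ} (hℓ : ∀ᵐ z ∂P, ∀ i, ‖component m n i z‖ ≤ ℓ) {p : ℕ} (hp : p ≠ 0)
    {a : Fin 3 → ℝ} (ha : ∀ i, a i ∈ Set.Icc 0 A) :
    ∫⁻ w, ∫⁻ x : NoiseSpace m n × NoiseSpace m n,
        ‖centredLogPartition P (combine (component m n) a) (combine (component m n) a w) x.2 -
          centredLogPartition P (combine (component m n) a) (combine (component m n) a w) x.1‖ₑ ^ (2 * p)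
        ∂((stdGaussian (NoiseSpace m n)).prod (stdGaussian (NoiseSpace m n))) ∂P ≤
      ENNReal.ofReal (Real.pi ^ 2 * (8 * p) * (288 * (12 * (m + n) + 2 * p))) ^ p := by
  have hbd := ae_norm_combine_le hℓ ha
  have hb0 : 0 ≤ 3 * A * ℓ := by
    obtain ⟨z, hz⟩ := hbd.exists
    exact (norm_nonneg _).trans hz
  refine (lintegral_fluctuation_le (measurable_combine measurable_component a) hbd hb0
    measurable_noiseNorm noiseNorm_nonneg (abs_inner_combine_sub_le a) hp).trans ?_
  refine (mul_le_mul_right (lintegral_noiseNorm_pow_le hmn hp) _).trans ?_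
  rw [← ENNReal.ofReal_mul (by positivity), ← ENNReal.ofReal_pow (by positivity)]
  refine ENNReal.ofReal_le_ofReal ?_
  -- The single factor 2 is enlarged to `2 ^ p` so that the whole bound is a `p`-th power; this
  -- turns `4 * p` into `8 * p`.
  have h2 : (2 : ℝ) ≤ 2 ^ p := le_self_pow₀ (by norm_num) hp
  calc Real.pi ^ (2 * p) * (2 * (4 * (p : ℝ)) ^ p) * (288 * (12 * (m + n) + 2 * p)) ^ p
      ≤ Real.pi ^ (2 * p) * (2 ^ p * (4 * (p : ℝ)) ^ p) * (288 * (12 * (m + n) + 2 * p)) ^ p := by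
        gcongr
    _ = _ := by
        rw [mul_pow (Real.pi ^ 2 * (8 * (p : ℝ))), mul_pow (Real.pi ^ 2), ← pow_mul, ← mul_pow]
        ring

/-- The moment that is used to control a maximum over a net. -/
def momentOrder (n : ℕ) (M : ℝ) : ℕ := ⌈Real.log (n * M)⌉₊ + 1

lemma momentOrder_le {M : ℝ} (hM : 1 ≤ M) (hn : 1 ≤ n) :
    (momentOrder n M : ℝ) ≤ Real.log n + 3 * M := by
  have hn' : (1 : ℝ) ≤ n := by exact_mod_cast hn
  have h0 : 0 ≤ Real.log (n * M) := Real.log_nonneg (by nlinarith)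
  have h1 := (Nat.ceil_lt_add_one h0).le
  have h2 : Real.log (n * M) = Real.log n + Real.log M := Real.log_mul (by positivity) (by positivity)
  have h3 := Real.log_le_sub_one_of_pos (by linarith : 0 < M)
  rw [momentOrder]
  push_cast
  linarith

/-- With mesh `1 / n` a side of the grid has at most `2nM + 1` points. The moment order `p`
satisfies `exp p ≥ e * n * M`, so a side is at most `exp (2 p)` and the cube at most `exp (6 p)`. -/
lemma card_net_le {M : ℝ} (hM : 1 ≤ M) (hn : 1 ≤ n) :
    (((⌊√(2 * M) / (1 / (n : ℝ))⌋₊ + 1) ^ 3 : ℕ) : ℝ) ≤ Real.exp 6 ^ momentOrder n M := by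
  have hn' : (1 : ℝ) ≤ n := by exact_mod_cast hn
  have hy : 1 ≤ n * M := by nlinarith
  have hs : √(2 * M) ≤ 2 * M := (Real.sqrt_le_left (by positivity)).2 (by nlinarith)
  have hfl : ((⌊√(2 * M) / (1 / (n : ℝ))⌋₊ : ℕ) : ℝ) ≤ 2 * (n * M) := by
    refine (Nat.floor_le (by positivity)).trans ?_
    rw [div_div_eq_mul_div, div_one]
    nlinarith
  have hq : (n : ℝ) * M * Real.exp 1 ≤ Real.exp (momentOrder n M) := by
    calc (n : ℝ) * M * Real.exp 1 = Real.exp (Real.log (n * M) + 1) := by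
          rw [Real.exp_add, Real.exp_log (by positivity)]
      _ ≤ _ := by
          refine Real.exp_le_exp.2 ?_
          rw [momentOrder]
          push_cast
          linarith [Nat.le_ceil (Real.log (n * M))]
  have he : (2 : ℝ) ≤ Real.exp 1 := by linarith [Real.add_one_le_exp (1 : ℝ)]
  have hq2 : 2 * ((n : ℝ) * M) ≤ Real.exp (momentOrder n M) := by nlinarith
  have hq3 : 2 * ((n : ℝ) * M) + 1 ≤ Real.exp (momentOrder n M) ^ 2 := by nlinarith
  push_cast
  calc ((⌊√(2 * M) / (1 / (n : ℝ))⌋₊ : ℝ) + 1) ^ 3 ≤ (2 * (n * M) + 1) ^ 3 := by gcongr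
    _ ≤ (Real.exp (momentOrder n M) ^ 2) ^ 3 := pow_le_pow_left₀ (by positivity) hq3 3
    _ = _ := by
        rw [← pow_mul, ← Real.exp_nat_mul, ← Real.exp_nat_mul]
        congr 1
        push_cast
        ring

/-- The order `p` is at most `log n + 3 M`, hence `p (m + n)` is of order `n Q` with `Q = (M + √(log
n))²`. The `p²` term is harmless because `log² n ≤ 4 n`. The constant is `124 = 72 + 2 * 26`. -/
lemma moment_mul_le {M κ : ℝ} (hM : 1 ≤ M) (hn : 1 ≤ n) (hκ : 1 ≤ κ) (hmκ : (m : ℝ) ≤ κ * n) :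
    (momentOrder n M : ℝ) * (12 * (m + n) + 2 * momentOrder n M) ≤
      124 * κ * (n * (M + √(Real.log n)) ^ 2) := by
  have hn' : (1 : ℝ) ≤ n := by exact_mod_cast hn
  have hL : 0 ≤ Real.log n := Real.log_nonneg hn'
  have hp := momentOrder_le hM hn
  have hp0 : (0 : ℝ) ≤ momentOrder n M := Nat.cast_nonneg _
  set p : ℝ := (momentOrder n M : ℝ)
  set L := Real.log n with hLdef
  have hQ : M ^ 2 + L ≤ (M + √L) ^ 2 := by
    have := Real.sq_sqrt hL
    nlinarith [Real.sqrt_nonneg L]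
  set Q := (M + √L) ^ 2
  have hLn : L ^ 2 ≤ 4 * n := by
    have h1 : L = 2 * Real.log (√n) := by rw [Real.log_sqrt (by positivity)]; ring
    have h2 := Real.log_le_sub_one_of_pos (Real.sqrt_pos.2 (by linarith : (0 : ℝ) < n))
    have h3 : L ≤ 2 * √n := by linarith
    have h4 := Real.sq_sqrt (by linarith : (0 : ℝ) ≤ n)
    nlinarith
  have h1 : p ≤ 3 * Q := by nlinarith
  have h2 : p ^ 2 ≤ 26 * (n * Q) := by
    have a1 : p ^ 2 ≤ (L + 3 * M) ^ 2 := pow_le_pow_left₀ hp0 hp 2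
    have a2 : (L + 3 * M) ^ 2 ≤ 2 * L ^ 2 + 18 * M ^ 2 := by nlinarith [sq_nonneg (L - 3 * M)]
    have a3 : M ^ 2 ≤ n * Q := by nlinarith
    have a4 : (n : ℝ) ≤ n * Q := le_mul_of_one_le_right (by linarith) (by nlinarith)
    nlinarith
  have hQ0 : 0 ≤ n * Q := by positivity
  have h3 : p * (12 * (m + n)) ≤ 72 * κ * (n * Q) := by
    have b1 : (12 * (m + n) : ℝ) ≤ 24 * κ * n := by nlinarith
    calc p * (12 * (m + n)) ≤ (3 * Q) * (24 * κ * n) := by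
          exact mul_le_mul h1 b1 (by positivity) (by positivity)
      _ = _ := by ring
  nlinarith

/-- The constant in the bound for the part of the fluctuations due to the noise. -/
def noiseConst (κ : ℝ) : ℝ :=
  8 * (Real.exp 6 * (23040 * (124 * κ)) + 144 * κ + 23544 * κ ^ 2)

lemma noiseConst_nonneg {κ : ℝ} (hκ : 1 ≤ κ) : 0 ≤ noiseConst κ := by
  unfold noiseConst; positivity

lemma total_le {M κ : ℝ} (hM : 1 ≤ M) (hn : 1 ≤ n) (hκ : 1 ≤ κ) (hmκ : (m : ℝ) ≤ κ * n) :
    8 * (Real.exp 6 * (Real.pi ^ 2 * (8 * momentOrder n M) *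
        (288 * (12 * (m + n) + 2 * momentOrder n M))) +
      36 * √(2 * M) ^ 2 * √((m : ℝ) + n) ^ 2 + 36 * (1 / (n : ℝ)) ^ 2 * √((m : ℝ) + n) ^ 2 *
        ((m * n + m + n : ℝ) + 81 * √(2 * M) ^ 2 * √((m : ℝ) + n) ^ 2)) ≤
      noiseConst κ * (n * (M + √(Real.log n)) ^ 2) := by
  have hn' : (1 : ℝ) ≤ n := by exact_mod_cast hn
  have hm0 : (0 : ℝ) ≤ m := Nat.cast_nonneg m
  have hL : 0 ≤ Real.log n := Real.log_nonneg hn'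
  have h1 := moment_mul_le hM hn hκ hmκ
  rw [Real.sq_sqrt (by positivity), Real.sq_sqrt (by positivity)]
  set Q := (M + √(Real.log n)) ^ 2
  have hMQ : M ≤ Q := by
    have : M ^ 2 ≤ Q := pow_le_pow_left₀ (by linarith) (by linarith [Real.sqrt_nonneg (Real.log n)]) 2
    nlinarith
  have hs : (m + n : ℝ) ≤ 2 * κ * n := by nlinarith
  have hpi : Real.pi ^ 2 ≤ 10 := by nlinarith [Real.pi_lt_d2, Real.pi_pos]
  have t1 : Real.pi ^ 2 * (8 * momentOrder n M) * (288 * (12 * (m + n) + 2 * momentOrder n M)) ≤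
      23040 * (124 * κ) * (n * Q) := by
    calc _ = Real.pi ^ 2 * (2304 * (momentOrder n M * (12 * (m + n) + 2 * momentOrder n M))) := by ring
      _ ≤ 10 * (2304 * (124 * κ * (n * Q))) := by gcongr
      _ = _ := by ring
  have hnM : (n : ℝ) * M ≤ n * Q := by gcongr
  have t2 : 36 * (2 * M) * (m + n) ≤ 144 * κ * (n * Q) := by
    calc 36 * (2 * M) * ((m : ℝ) + n) ≤ 36 * (2 * M) * (2 * κ * n) := by gcongr
      _ = 144 * κ * (n * M) := by ring
      _ ≤ _ := by gcongr
  -- The mesh was chosen for this term: `n⁻² (m + n)` times a squared noise norm of order `n²` is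
  -- again of order `n`.
  have t3 : 36 * (1 / (n : ℝ)) ^ 2 * ((m : ℝ) + n) * ((m * n + m + n : ℝ) + 81 * (2 * M) * ((m : ℝ) + n)) ≤
      23544 * κ ^ 2 * (n * Q) := by
    have u1 : (m * n + m + n : ℝ) + 81 * (2 * M) * ((m : ℝ) + n) ≤ 327 * κ * M * n ^ 2 := by
      have v1 : (m * n : ℝ) ≤ κ * n ^ 2 := by nlinarith
      have v2 : (m + n : ℝ) ≤ 2 * κ * n ^ 2 := by nlinarith [mul_nonneg (by linarith : 0 ≤ κ) (by nlinarith : 0 ≤ (n : ℝ) ^ 2 - n)]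
      have v3 : κ * (n : ℝ) ^ 2 ≤ κ * n ^ 2 * M := le_mul_of_one_le_right (by positivity) hM
      have v4 : 81 * (2 * M) * ((m : ℝ) + n) ≤ 81 * (2 * M) * (2 * κ * n ^ 2) := by gcongr
      nlinarith
    calc _ ≤ 36 * (1 / (n : ℝ)) ^ 2 * (2 * κ * n) * (327 * κ * M * n ^ 2) := by gcongr
      _ = 23544 * κ ^ 2 * (n * M) := by field_simp; ring
      _ ≤ _ := by gcongr
  have t1' := mul_le_mul_of_nonneg_left t1 (Real.exp_pos 6).le
  unfold noiseConst
  linarith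

/-- Everything common to the two cases. The law enters only through the norm bound on the components
and through `S`, which must control the noise average for all parameters simultaneously. -/
theorem concentrationRate_le_of_signal {P : Measure (Signal m n)} [IsProbabilityMeasure P]
    {κ τ M : ℝ} (hκ : 1 ≤ κ) (hτ : 0 ≤ τ) (hM : 1 ≤ M) (hm : 1 ≤ m) (hn : 1 ≤ n)
    (hmκ : (m : ℝ) ≤ κ * n) (hnκ : (n : ℝ) ≤ κ * m)
    (hℓ : ∀ᵐ z ∂P, ∀ i, ‖component m n i z‖ ≤ √((m : ℝ) + n))
    {S : Signal m n × Signal m n → ℝ≥0∞} (hS : Measurable S)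
    (hSb : ∀ᵐ w ∂P, ∀ᵐ w' ∂P, ∀ a : Fin 3 → ℝ, (∀ i, a i ∈ Set.Icc 0 (√(2 * M))) →
      ‖∫ g, channelLog P (component m n) a (w, g) ∂(stdGaussian _) -
        ∫ g, channelLog P (component m n) a (w', g) ∂(stdGaussian _)‖ₑ ^ 2 ≤ S (w, w'))
    (hSτ : ∫⁻ w, ∫⁻ w', S (w, w') ∂P ∂P ≤ ENNReal.ofReal (τ * (n * M ^ 2))) :
    concentrationRate P M ≤ ENNReal.ofReal
      (√(κ * (noiseConst κ + 2 * τ)) * (n : ℝ) ^ (-(1 / 2) : ℝ) * (M + √(Real.log n))) := by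
  have hn' : (1 : ℝ) ≤ n := by exact_mod_cast hn
  have hm' : (1 : ℝ) ≤ m := by exact_mod_cast hm
  have hN : 0 < size m n := Real.sqrt_pos.2 (by positivity)
  have hp : momentOrder n M ≠ 0 := by simp [momentOrder]
  have hd : ∫⁻ g, ENNReal.ofReal (‖g‖ ^ 2) ∂(stdGaussian (NoiseSpace m n)) ≤
      ENNReal.ofReal (m * n + m + n) := by
    rw [lintegral_norm_sq_stdGaussian]
    refine le_of_eq ?_
    rw [← ENNReal.ofReal_natCast]
    congr 1
    simp [add_assoc]
  obtain ⟨D, hDm, hDb, hDi⟩ := exists_uniform_bound (P := P) (A := √(2 * M)) measurable_component hℓ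
    (Real.sqrt_nonneg _) (by positivity : (0 : ℝ) < 1 / n) hp (card_net_le hM hn)
    (Real.exp_pos 6).le
    (fun a ha => lintegral_centredLogPartition_component_le (by omega) hℓ hp ha) (by positivity)
    (by positivity) hd hS hSb (by positivity) hSτ
  have hT := total_le hM hn hκ hmκ
  set Q := (M + √(Real.log n)) ^ 2 with hQ
  have hMQ : M ^ 2 ≤ Q :=
    pow_le_pow_left₀ (by linarith) (by linarith [Real.sqrt_nonneg (Real.log n)]) 2
  have hc0 := noiseConst_nonneg hκ
  have hR : ∫⁻ q, D q ∂(P.prod (stdGaussian (NoiseSpace m n))) ≤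
      ENNReal.ofReal ((noiseConst κ + 2 * τ) * (n * Q)) := by
    refine hDi.trans (ENNReal.ofReal_le_ofReal ?_)
    have : τ * (n * M ^ 2) ≤ τ * (n * Q) := by gcongr
    linarith
  refine (concentrationRate_le hN hDm hDb (by positivity) hR).trans (ENNReal.ofReal_le_ofReal ?_)
  have hr : (n : ℝ) ^ (-(1 / 2) : ℝ) = 1 / √n := by
    rw [Real.rpow_neg (by positivity), ← Real.sqrt_eq_rpow, one_div]
  rw [hr, div_le_iff₀ hN]
  refine Real.sqrt_le_iff.2 ⟨by positivity, ?_⟩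
  rw [mul_pow, mul_pow, mul_pow, Real.sq_sqrt (by positivity), div_pow, Real.sq_sqrt (by positivity),
    size, Real.sq_sqrt (by positivity)]
  -- After squaring, division by `N² = mn` leaves a factor `1 / m`, whereas `1 / n` is wanted; `n ≤
  -- κ * m` supplies the exchange and the outer `κ` in the constant.
  have e : κ * (noiseConst κ + 2 * τ) * (1 ^ 2 / n) * (M + √(Real.log n)) ^ 2 * ((m : ℝ) * n) =
      (noiseConst κ + 2 * τ) * ((κ * m) * Q) := by
    rw [hQ]; field_simp
  rw [e]
  gcongr

lemma le_mul_size {κ : ℝ} (hκ : 1 ≤ κ) (hmκ : (m : ℝ) ≤ κ * n) : (m : ℝ) ≤ κ * size m n := by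
  have hm : (0 : ℝ) ≤ m := Nat.cast_nonneg m
  have hn : (0 : ℝ) ≤ n := Nat.cast_nonneg n
  have h : (m : ℝ) ≤ √((κ ^ 2) * (m * n)) := by
    refine Real.le_sqrt_of_sq_le ?_
    have h1 : (m : ℝ) * m ≤ m * (κ * n) := mul_le_mul_of_nonneg_left hmκ hm
    have h2 : κ * (m * n) ≤ κ ^ 2 * (m * n) := by
      have : κ ≤ κ ^ 2 := by nlinarith
      gcongr
    nlinarith
  rwa [Real.sqrt_mul (sq_nonneg κ), Real.sqrt_sq (by linarith)] at h

lemma size_comm (m n : ℕ) : size m n = size n m := by rw [size, size, mul_comm]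

/-- The constant in the bound for the part of the fluctuations due to the signal. -/
def signalConst (κ : ℝ) : ℝ := 64 * κ * (1 + κ) ^ 2

lemma concentrationRate_iidLaw_le {κ M : ℝ} (hκ : 1 ≤ κ) (hM : 1 ≤ M) (hm : 1 ≤ m) (hn : 1 ≤ n)
    (hmκ : (m : ℝ) ≤ κ * n) (hnκ : (n : ℝ) ≤ κ * m) (PX PY : Measure ℝ) [IsProbabilityMeasure PX]
    [IsProbabilityMeasure PY] (hX : ∀ᵐ x ∂PX, x ∈ Set.Icc (-1 : ℝ) 1)
    (hY : ∀ᵐ y ∂PY, y ∈ Set.Icc (-1 : ℝ) 1) :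
    concentrationRate (iidLaw m n PX PY) M ≤ ENNReal.ofReal
      (√(κ * (noiseConst κ + 2 * signalConst κ)) * (n : ℝ) ^ (-(1 / 2) : ℝ) * (M + √(Real.log n))) := by
  have hn' : (1 : ℝ) ≤ n := by exact_mod_cast hn
  have hm' : (1 : ℝ) ≤ m := by exact_mod_cast hm
  have hN : 0 < size m n := Real.sqrt_pos.2 (by positivity)
  have hae := ae_abs_le_one_iidLaw (m := m) (n := n) hX hY
  have hτ : 0 ≤ signalConst κ := by unfold signalConst; positivity
  have h1 : Measurable fun q : Signal m n × Signal m n => countDist q.1.1 q.2.1 ^ 2 :=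
    (measurable_countDist.comp (by fun_prop :
      Measurable fun q : Signal m n × Signal m n => (q.1.1, q.2.1))).pow_const 2
  have h2 : Measurable fun q : Signal m n × Signal m n => countDist q.1.2 q.2.2 ^ 2 :=
    (measurable_countDist.comp (by fun_prop :
      Measurable fun q : Signal m n × Signal m n => (q.1.2, q.2.2))).pow_const 2
  refine concentrationRate_le_of_signal hκ hτ hM hm hn hmκ hnκ (ae_iidBound hae)
    (S := fun q => ENNReal.ofReal (2 * (√(2 * M) ^ 2 * (1 + κ)) ^ 2) *
      (countDist q.1.1 q.2.1 ^ 2 + countDist q.1.2 q.2.2 ^ 2)) ((h1.add h2).const_mul _) ?_ ?_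
  · filter_upwards [hae] with w hw
    filter_upwards [hae] with w' hw' a ha
    exact enorm_integral_channelLog_sub_sq_le (by linarith) hX hY hN (le_mul_size hκ hmκ)
      (size_comm n m ▸ le_mul_size hκ hnκ) ha hw hw'
  · refine (lintegral_countDist_iidLaw_le _ (by positivity)).trans (ENNReal.ofReal_le_ofReal ?_)
    rw [Real.sq_sqrt (by positivity), signalConst]
    have hs : (m + n : ℝ) ≤ 2 * κ * n := by nlinarith
    calc 4 * (2 * (2 * M * (1 + κ)) ^ 2) * ((m : ℝ) + n)
        ≤ 4 * (2 * (2 * M * (1 + κ)) ^ 2) * (2 * κ * n) := by gcongr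
      _ = _ := by ring

lemma concentrationRate_sphericalLaw_le {κ M : ℝ} (hκ : 1 ≤ κ) (hM : 1 ≤ M) (hm : 1 ≤ m) (hn : 1 ≤ n)
    (hmκ : (m : ℝ) ≤ κ * n) (hnκ : (n : ℝ) ≤ κ * m) :
    concentrationRate (sphericalLaw m n) M ≤ ENNReal.ofReal
      (√(κ * (noiseConst κ + 2 * 0)) * (n : ℝ) ^ (-(1 / 2) : ℝ) * (M + √(Real.log n))) := by
  have := isProbabilityMeasure_sphereUniform hm
  have := isProbabilityMeasure_sphereUniform hn
  have : IsProbabilityMeasure (sphericalLaw m n) := by unfold sphericalLaw; infer_instance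
  have hae : ∀ᵐ z ∂sphericalLaw m n, ∑ i, z.1 i ^ 2 = (m : ℝ) ∧ ∑ j, z.2 j ^ 2 = (n : ℝ) := by
    filter_upwards [Measure.quasiMeasurePreserving_fst.ae (ae_sum_sq_sphereUniform m),
      Measure.quasiMeasurePreserving_snd.ae (ae_sum_sq_sphereUniform n)] with z h1 h2 using ⟨h1, h2⟩
  refine concentrationRate_le_of_signal hκ le_rfl hM hm hn hmκ hnκ ?_ (S := fun _ => 0)
    measurable_const ?_ (by simp)
  · filter_upwards [hae] with z hz using norm_component_le hz.1.le hz.2.le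
  · filter_upwards [hae] with w hw
    filter_upwards [hae] with w' hw' a _
    rw [integral_channelLog_sphericalLaw_eq hm hn a (hw.1.trans hw'.1.symm) (hw.2.trans hw'.2.symm)]
    simp

/-- A convergent sequence is bounded over all indices, and since the limit is positive so is the
sequence of inverses. This is the only use of the limit, and it makes `κ` depend on the sequence
alone. -/
lemma exists_ratio_bound {m : ℕ → ℕ} (hm : ∀ n : ℕ, 1 ≤ n → 1 ≤ m n) {α : ℝ} (hα : 0 < α)
    (hlim : Tendsto (fun n : ℕ => (m n : ℝ) / (n : ℝ)) atTop (𝓝 α)) :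
    ∃ κ : ℝ, 1 ≤ κ ∧ ∀ n : ℕ, 1 ≤ n → (m n : ℝ) ≤ κ * n ∧ (n : ℝ) ≤ κ * m n := by
  obtain ⟨b, hb⟩ := hlim.bddAbove_range
  obtain ⟨c, hc⟩ := (hlim.inv₀ hα.ne').bddAbove_range
  refine ⟨max 1 (max b c), le_max_left _ _, fun n hn => ?_⟩
  have hn' : (0 : ℝ) < n := by exact_mod_cast hn
  have hm' : (0 : ℝ) < m n := by exact_mod_cast hm n hn
  have h1 : (m n : ℝ) / n ≤ max 1 (max b c) :=
    (hb ⟨n, rfl⟩).trans ((le_max_left b c).trans (le_max_right _ _))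
  have h2 : ((m n : ℝ) / n)⁻¹ ≤ max 1 (max b c) :=
    (hc ⟨n, rfl⟩).trans ((le_max_right b c).trans (le_max_right _ _))
  rw [inv_div] at h2
  exact ⟨(div_le_iff₀ hn').1 h1, (div_le_iff₀ hm').1 h2⟩

end Rate

end RankOneInference

end

theorem mainTheorem9 (m : ℕ → ℕ) (hm : ∀ n : ℕ, 1 ≤ n → 1 ≤ m n)
    (α : ℝ) (hα : 0 < α)
    (hlim : Tendsto (fun n : ℕ => (m n : ℝ) / (n : ℝ)) atTop (𝓝 α)) :
    ∃ C : ℝ, 0 < C ∧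
      (∀ (PX PY : Measure ℝ) [IsProbabilityMeasure PX] [IsProbabilityMeasure PY],
        (∀ᵐ x ∂PX, x ∈ Set.Icc (-1 : ℝ) 1) → (∀ᵐ y ∂PY, y ∈ Set.Icc (-1 : ℝ) 1) →
        ∀ (M : ℝ), 1 ≤ M → ∀ n : ℕ, 1 ≤ n →
          RankOneInference.concentrationRate (RankOneInference.iidLaw (m n) n PX PY) M ≤
            ENNReal.ofReal (C * (n : ℝ) ^ (-(1 / 2) : ℝ) * (M + √(Real.log n)))) ∧
      (∀ (M : ℝ), 1 ≤ M → ∀ n : ℕ, 1 ≤ n →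
          RankOneInference.concentrationRate (RankOneInference.sphericalLaw (m n) n) M ≤
            ENNReal.ofReal (C * (n : ℝ) ^ (-(1 / 2) : ℝ) * (M + √(Real.log n)))) := by
  obtain ⟨κ, hκ, hr⟩ := RankOneInference.exists_ratio_bound hm hα hlim
  have hτ : 0 < RankOneInference.signalConst κ := by
    unfold RankOneInference.signalConst; positivity
  have hc := RankOneInference.noiseConst_nonneg hκ
  -- The i.i.d. constant serves both cases: the spherical bound has no signal contribution, so its
  -- constant is smaller.
  refine ⟨√(κ * (RankOneInference.noiseConst κ + 2 * RankOneInference.signalConst κ)),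
    Real.sqrt_pos.2 (by positivity), ?_, ?_⟩
  · intro PX PY _ _ hX hY M hM n hn
    exact RankOneInference.concentrationRate_iidLaw_le hκ hM (hm n hn) hn (hr n hn).1 (hr n hn).2
      PX PY hX hY
  · intro M hM n hn
    refine (RankOneInference.concentrationRate_sphericalLaw_le hκ hM (hm n hn) hn (hr n hn).1
      (hr n hn).2).trans (ENNReal.ofReal_le_ofReal ?_)
    have hM0 : 0 ≤ M := by linarith
    gcongr
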